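/- Let $q\ge 1$, let $\mathbb T^2=\mathbb R^2/\mathbb Z^2$, and write $PU(q)=U(q)/\mathbb S^1$ for the quotient of $U(q)$ by the scalar matrices and $\mu_q\subset\mathbb C^\times$ for the group of $q$-th roots of unity. Identify - $\pi_1(U(q))\cong\pi_1(\mathbb S^1)\cong\mathbb Z$ via $\pi_1(\det)$ and the degree; - $\pi_1(PU(q))\cong\mu_q$ via the connecting map of $1\to\mu_q\to SU(q)\to PU(q)\to 1$, which sends the class of a loop at $1$ to the endpoint in $\mu_q$ of its lift to a path in $SU(q)$ starting at $1$. (Both of these maps are group isomorphisms.) Fix an orientation on $\mathbb T^2$, and choose a basis $(v_0,v_1)$ of $\mathbb Z^2$ that is positively oriented; the map $\mathbb S^1\times[0,1]\to\mathbb T^2$, $(s,t)\mapsto sv_0+tv_1$ (with $\mathbb S^1=\mathbb R/\mathbb Z$) presents $\mathbb T^2$ as the cylinder with the boundary circles glued by $(s,0)\sim(s,1)$. - For a rank-$q$ complex vector bundle $\mathcal E$ on $\mathbb T^2$, trivialize $\mathcal E$ over $\mathbb S^1\times[0,1]$ so that $\mathcal E$ is recovered by gluing $(s,0,w)\sim(s,1,g(s)w)$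 for a continuous $g:\mathbb S^1\to U(q)$ (for instance by a unitary trivialization with respect to a Hermitian metric on $\mathcal E$). The twist $\mathrm{tw}(\mathcal E)\in\mathbb Z\cong\pi_1(U(q))$ is the class of $g$, i.e. that of the loop $s\mapsto g(0)^{-1}g(s)$. - For a bundle $\mathcal A$ of $q\times q$ matrix algebras on $\mathbb T^2$, trivialize $\mathcal A$ over $\mathbb S^1\times[0,1]$ so that $\mathcal A$ is recovered by gluing $(s,0,M)\sim(s,1,g(s)Mg(s)^{-1})$ for a continuous $g:\mathbb S^1\to PU(q)$. The invariant $\omega(\mathcal A)\in\mu_q\cong\pi_1(PU(q))$ is the class of $g$, i.e. that of the loop $s\mapsto g(0)^{-1}g(s)$. Then for every rank-$q$ complex vector bundle $\mathcal E$ on $\mathbb T^2$ the twist $\mathrm{tw}(\mathcal E)$ and the invariant $\omega(\mathcal E\otimes\mathcal E^*)$ of the matrix bundle $\mathcal E\otimes\mathcal E^*\cong\mathcal End(\mathcal E)$ are well defined (trivializations as above exist, and the results depend on nothing but the bundle and the orientation), and $$\omega(\mathcal E\otimes\mathcal E^*)\in\mu_q\cong\pi_1(PU(q))$$ is the image of $$\mathrm{tw}(\mathcal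 E)\in\mathbb Z\cong\pi_1(U(q))$$ under the homomorphism $\pi_1(U(q))\to\pi_1(PU(q))$ induced by the quotient map $U(q)\to PU(q)$. -/

import Mathlib

open scoped unitInterval Matrix

noncomputable section

namespace TorusTwist

/-! ### The groups `U(q)`, `SU(q)`, `PU(q)` -/

/-- The unitary group `U(q)`, topologized as a subspace of the `q × q` complex matrices. -/
abbrev U (q : ℕ) : Type := Matrix.unitaryGroup (Fin q) ℂ

/-- The special unitary group `SU(q)`. -/
abbrev SU (q : ℕ) : Type := Matrix.specialUnitaryGroup (Fin q) ℂ

/-- The inclusion `SU(q) → U(q)`. -/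
def SU.toU (q : ℕ) : SU q →* U q :=
  Submonoid.inclusion Matrix.specialUnitaryGroup_le_unitaryGroup

/-- The central circle of scalar matrices in `U(q)`. -/
def scalarCircle (q : ℕ) : Subgroup (U q) where
  carrier := {u | ∃ z : Circle, (u : Matrix (Fin q) (Fin q) ℂ) = (z : ℂ) • 1}
  mul_mem' := by
    rintro a b ⟨z, hz⟩ ⟨w, hw⟩
    exact ⟨z * w, by simp [hz, hw, smul_smul, mul_comm]⟩
  one_mem' := ⟨1, by simp⟩
  inv_mem' := by
    rintro a ⟨z, hz⟩
    refine ⟨z⁻¹, ?_⟩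
    rw [Matrix.UnitaryGroup.inv_val, hz, star_smul, star_one, Circle.coe_inv_eq_conj]
    rfl

instance scalarCircle_normal (q : ℕ) : (scalarCircle q).Normal where
  conj_mem := by
    rintro a ⟨z, hz⟩ g
    refine ⟨z, ?_⟩
    have h : (g : Matrix (Fin q) (Fin q) ℂ) * ((g⁻¹ : U q) : Matrix (Fin q) (Fin q) ℂ) = 1 := by
      rw [← Matrix.UnitaryGroup.mul_val, mul_inv_cancel, Matrix.UnitaryGroup.one_val]
    simp only [Matrix.UnitaryGroup.mul_val, hz, Matrix.mul_smul, Matrix.smul_mul, mul_one, h]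

/-- The projective unitary group `PU(q) = U(q) / S¹`, with the quotient topology. -/
abbrev PU (q : ℕ) : Type := U q ⧸ scalarCircle q

/-- The quotient map `U(q) → PU(q)`. -/
def proj (q : ℕ) : C(U q, PU q) := ⟨QuotientGroup.mk, QuotientGroup.continuous_mk⟩

/-- The determinant `U(q) → S¹`. -/
def detMap (q : ℕ) : C(U q, Circle) where
  toFun u := ⟨(u : Matrix (Fin q) (Fin q) ℂ).det, by
    have h := Matrix.det_of_mem_unitary u.2
    rw [Submonoid.unitSphere, Submonoid.mem_mk, Subsemigroup.mem_mk, mem_sphere_zero_iff_norm]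
    exact CStarRing.norm_of_mem_unitary h⟩
  continuous_toFun := by
    refine Continuous.subtype_mk ?_ _
    exact Continuous.matrix_det continuous_subtype_val

/-! ### Fundamental groups -/

/-- The homomorphism `π₁(U(q)) → π₁(PU(q))` induced by the quotient map. -/
def piProj (q : ℕ) : FundamentalGroup (U q) 1 →* FundamentalGroup (PU q) 1 :=
  FundamentalGroup.mapOfEq (proj q) rfl

/-- The homomorphism `π₁(det) : π₁(U(q)) → π₁(S¹)`. -/
def piDet (q : ℕ) : FundamentalGroup (U q) 1 →* FundamentalGroup Circle 1 :=
  FundamentalGroup.mapOfEq (detMap q) (Subtype.ext Matrix.det_one)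

/-- The class `c ∈ π₁(S¹)` has degree `n`: some loop in `c` lifts through `θ ↦ e^{2πiθ}` to a path
in `ℝ` going from `0` to `n`. -/
def HasDegree (c : FundamentalGroup Circle 1) (n : ℤ) : Prop :=
  ∃ (γ : Path (1 : Circle) 1) (θ : C(I, ℝ)),
    c = FundamentalGroup.fromPath (Path.Homotopic.Quotient.mk γ) ∧
      (∀ s, Circle.exp (2 * Real.pi * θ s) = γ s) ∧ θ 0 = 0 ∧ θ 1 = n

/-- The connecting map `π₁(PU(q)) → π₀(μ_q) = μ_q` of `1 → μ_q → SU(q) → PU(q) → 1` sends `c`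
to `ζ`: some loop in `c` lifts to a path in `SU(q)` going from `1` to `ζ • 1`. -/
def HasBoundary {q : ℕ} (c : FundamentalGroup (PU q) 1) (ζ : rootsOfUnity q ℂ) : Prop :=
  ∃ (γ : Path (1 : PU q) 1) (Γ : C(I, SU q)),
    c = FundamentalGroup.fromPath (Path.Homotopic.Quotient.mk γ) ∧
      (∀ s, proj q (SU.toU q (Γ s)) = γ s) ∧ Γ 0 = 1 ∧
        (Γ 1 : Matrix (Fin q) (Fin q) ℂ) = ((ζ : ℂˣ) : ℂ) • 1

/-- The class in `π₁(G, 1)` of a free loop `g : S¹ → G` in a topological group, moved to the base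
point by translation: the class of `s ↦ g(0)⁻¹ g(s)`. -/
def loopClass {G : Type*} [Group G] [TopologicalSpace G] [IsTopologicalGroup G]
    (g : C(UnitAddCircle, G)) : FundamentalGroup G 1 :=
  FundamentalGroup.fromPath (Path.Homotopic.Quotient.mk
    { toFun := fun t : I => (g 0)⁻¹ * g ((t : ℝ) : UnitAddCircle)
      continuous_toFun := continuous_const.mul
        (g.continuous.comp ((AddCircle.continuous_mk' 1).comp continuous_subtype_val))
      source' := by simp
      target' := by
        have h : ((1 : ℝ) : UnitAddCircle) = 0 := AddCircle.coe_period 1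
        simp [h] })

/-! ### The oriented torus as a glued cylinder -/

/-- The `2`-torus `ℝ² / ℤ²`. -/
abbrev T2 : Type := UnitAddTorus (Fin 2)

/-- The basis `v` of the lattice `ℤ²` is positively oriented for the orientation `o` of the tangent
space `ℝ²` of the torus. -/
def IsPositive (o : Orientation ℝ (Fin 2 → ℝ) (Fin 2))
    (v : Module.Basis (Fin 2) ℤ (Fin 2 → ℤ)) : Prop :=
  ∃ b : Module.Basis (Fin 2) ℝ (Fin 2 → ℝ), (∀ i j, b i j = (v i j : ℝ)) ∧ b.orientation = o

/-- The map `S¹ × [0,1] → T²`, `(s, t) ↦ s v₀ + t v₁`, identifying the torus with the quotient of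
the cylinder that glues `S¹ × {0}` to `S¹ × {1}` by `(s, 0) ∼ (s, 1)`. The orientation associated
with these coordinates is that of `ds ∧ dt`. -/
def glue (v : Module.Basis (Fin 2) ℤ (Fin 2 → ℤ)) (s : UnitAddCircle) (t : I) : T2 :=
  fun j => v 0 j • s + v 1 j • ((t : ℝ) : UnitAddCircle)

/-! ### The twist of a vector bundle -/

/-- A trivialization over `S¹ × [0,1]` of (the pullback of) a rank-`q` vector bundle on the torus:
a bundle isomorphism from the product bundle, that is, a continuous family of linear isomorphisms
from `ℂ^q` to the fibres. -/
structure VectorFrame (q : ℕ) (E : T2 → Type*) [∀ x, AddCommGroup (E x)] [∀ x, Module ℂ (E x)]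
    [TopologicalSpace (Bundle.TotalSpace (Fin q → ℂ) E)]
    (v : Module.Basis (Fin 2) ℤ (Fin 2 → ℤ)) where
  /-- the isomorphism onto the fibre over `(s, t)` -/
  toEquiv : ∀ (s : UnitAddCircle) (t : I), (Fin q → ℂ) ≃ₗ[ℂ] E (glue v s t)
  continuous_toEquiv : Continuous fun p : UnitAddCircle × I × (Fin q → ℂ) =>
    Bundle.TotalSpace.mk' (Fin q → ℂ) (glue v p.1 p.2.1) (toEquiv p.1 p.2.1 p.2.2)

/-- The map `g : S¹ → U(q)` identifies the trivialized bundles over the two boundary circles, so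
that the bundle is recovered by gluing `(s, 0, w)` to `(s, 1, g(s) w)`.
(The two fibres compared lie over the same point of the torus. As `g` is unitary, the frame is a
unitary trivialization for a Hermitian metric on the bundle, the one it transports from `ℂ^q`.) -/
def VectorFrame.IsClutching {q : ℕ} {E : T2 → Type*} [∀ x, AddCommGroup (E x)]
    [∀ x, Module ℂ (E x)] [TopologicalSpace (Bundle.TotalSpace (Fin q → ℂ) E)]
    {v : Module.Basis (Fin 2) ℤ (Fin 2 → ℤ)} (τ : VectorFrame q E v)
    (g : C(UnitAddCircle, U q)) : Prop :=
  ∀ (s : UnitAddCircle) (w : Fin q → ℂ),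
    Bundle.TotalSpace.mk' (Fin q → ℂ) (glue v s 0) (τ.toEquiv s 0 w) =
      Bundle.TotalSpace.mk' (Fin q → ℂ) (glue v s 1)
        (τ.toEquiv s 1 ((g s : Matrix (Fin q) (Fin q) ℂ) *ᵥ w))

/-- `n` is a value of the twist of `E`, computed with some positively oriented coordinates, some
trivialization over the cylinder and the resulting map `S¹ → U(q)`. -/
def IsTwist {q : ℕ} (o : Orientation ℝ (Fin 2 → ℝ) (Fin 2)) (E : T2 → Type*)
    [∀ x, AddCommGroup (E x)] [∀ x, Module ℂ (E x)]
    [TopologicalSpace (Bundle.TotalSpace (Fin q → ℂ) E)] (n : ℤ) : Prop :=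
  ∃ v, IsPositive o v ∧ ∃ (τ : VectorFrame q E v) (g : C(UnitAddCircle, U q)),
    τ.IsClutching g ∧ HasDegree (piDet q (loopClass g)) n

/-- The twist `tw(E) ∈ ℤ` of a rank-`q` vector bundle on the oriented torus. -/
def twist (q : ℕ) (o : Orientation ℝ (Fin 2 → ℝ) (Fin 2)) (E : T2 → Type*)
    [∀ x, AddCommGroup (E x)] [∀ x, Module ℂ (E x)]
    [TopologicalSpace (Bundle.TotalSpace (Fin q → ℂ) E)] : ℤ :=
  Classical.epsilon fun n => IsTwist (q := q) o E n

/-! ### The invariant `ω` of a matrix bundle -/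

/-- A trivialization over `S¹ × [0,1]` of (the pullback of) a `q × q` matrix algebra bundle on the
torus: a continuous family of algebra isomorphisms from `M_q(ℂ)` to the fibres. (`F` is the model
fibre with which the total space of `A` is labelled.) -/
structure MatrixFrame (q : ℕ) (F : Type*) (A : T2 → Type*) [∀ x, Ring (A x)]
    [∀ x, Algebra ℂ (A x)] [TopologicalSpace (Bundle.TotalSpace F A)]
    (v : Module.Basis (Fin 2) ℤ (Fin 2 → ℤ)) where
  /-- the isomorphism onto the fibre over `(s, t)` -/
  toEquiv : ∀ (s : UnitAddCircle) (t : I), Matrix (Fin q) (Fin q) ℂ ≃ₐ[ℂ] A (glue v s t)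
  continuous_toEquiv : Continuous fun p : UnitAddCircle × I × Matrix (Fin q) (Fin q) ℂ =>
    Bundle.TotalSpace.mk' F (glue v p.1 p.2.1) (toEquiv p.1 p.2.1 p.2.2)

/-- The map `g : S¹ → PU(q)` identifies the trivialized matrix bundles over the two boundary
circles, `PU(q)` acting on `M_q(ℂ)` by conjugation: `(s, 0, M)` is glued to `(s, 1, u M u⋆)` for
`u` representing `g(s)`. (As `g` takes values in `PU(q)`, the frame transports the conjugate
transpose of `M_q(ℂ)` to an involution of the bundle, making it a bundle of `*`-algebras.) -/
def MatrixFrame.IsClutching {q : ℕ} {F : Type*} {A : T2 → Type*} [∀ x, Ring (A x)]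
    [∀ x, Algebra ℂ (A x)] [TopologicalSpace (Bundle.TotalSpace F A)]
    {v : Module.Basis (Fin 2) ℤ (Fin 2 → ℤ)} (α : MatrixFrame q F A v)
    (g : C(UnitAddCircle, PU q)) : Prop :=
  ∀ (s : UnitAddCircle) (u : U q), proj q u = g s → ∀ M : Matrix (Fin q) (Fin q) ℂ,
    Bundle.TotalSpace.mk' F (glue v s 0) (α.toEquiv s 0 M) =
      Bundle.TotalSpace.mk' F (glue v s 1)
        (α.toEquiv s 1 ((u : Matrix (Fin q) (Fin q) ℂ) * M * (u : Matrix (Fin q) (Fin q) ℂ)ᴴ))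

/-- `ζ` is a value of `ω(A)`, computed with some positively oriented coordinates, some
trivialization over the cylinder and the resulting map `S¹ → PU(q)`. -/
def IsOmega {q : ℕ} (o : Orientation ℝ (Fin 2 → ℝ) (Fin 2)) (F : Type*) (A : T2 → Type*)
    [∀ x, Ring (A x)] [∀ x, Algebra ℂ (A x)] [TopologicalSpace (Bundle.TotalSpace F A)]
    (ζ : rootsOfUnity q ℂ) : Prop :=
  ∃ v, IsPositive o v ∧ ∃ (α : MatrixFrame q F A v) (g : C(UnitAddCircle, PU q)),
    α.IsClutching g ∧ HasBoundary (loopClass g) ζ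

/-- The invariant `ω(A) ∈ μ_q` of a `q × q` matrix bundle on the oriented torus. -/
def omega (q : ℕ) (o : Orientation ℝ (Fin 2 → ℝ) (Fin 2)) (F : Type*) (A : T2 → Type*)
    [∀ x, Ring (A x)] [∀ x, Algebra ℂ (A x)] [TopologicalSpace (Bundle.TotalSpace F A)] :
    rootsOfUnity q ℂ :=
  Classical.epsilon fun ζ => IsOmega o F A ζ

end TorusTwist

end

noncomputable section

namespace TorusTwist

/-! ### Logarithms -/

/-! Both invariants are read off from one number attached to the universal cover. The pullback of
the bundle to ℝ² has a global frame F (`exists_frameOn_plane`). Its failure to be periodic is a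
cocycle of matrices: F(x + l) = F(x) a_l(x) for l in ℤ². With continuous logarithms f_l of det a_l,
normalized so that exponentiation is z ↦ e^{2πiz}, the commutator pairing f_l(x + m) − f_l(x) −
f_m(x + l) + f_m(x) is independent of x, biadditive and alternating in (l, m). It is thus a multiple
of the determinant (`IsLogCocycle.pairing_eq_det`), and takes a single value p on all positively
oriented bases (`exists_sign`).

For every choice of coordinates, trivialization and clutching map, the twist equals p
(`IsPeriodFrame.degree_eq`): compare the two frames over the square and follow a logarithm of the
determinant of the transition matrix around the boundary. Likewise, for every choice, ω of the
endomorphism bundle equals e^{-2πip/q} (`IsPeriodFrame.boundary_eq`): over the square, a continuous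
form of Skolem–Noether (`exists_continuous_inner`) corrects F by matrices of determinant 1 so that
it induces the given trivialization of the endomorphisms. The period matrices then become scalars
whose q-th powers are known determinants, and the cocycle identity at the corner of the square
yields ω. This gives independence of the choices. Existence comes from closing F up along the
cylinder and making the clutching map unitary by polar decomposition.

On the side of the groups, a loop in U(q) with determinant e^{2πiθ} becomes a path in SU(q) with the
same image in PU(q) after multiplication by e^{-2πiθ/q}. So degree n goes to e^{-2πin/q}
(`HasDegree.hasBoundary`), which matches the two computations. That the identifications of π₁ are
isomorphisms rests on `homotopic_refl_of_hasDegree_zero`: a loop in GL is freely homotopic to one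
living in a single diagonal entry, where its determinant is its only content; for PU(q) one adds
that SU(q) → PU(q) is a covering. -/

/-- The normalized exponential `z ↦ e^{2πiz}`. -/
def expTwoPiI (z : ℂ) : ℂ := Complex.exp (2 * Real.pi * Complex.I * z)

theorem continuous_expTwoPiI : Continuous expTwoPiI := by
  unfold expTwoPiI; fun_prop

theorem expTwoPiI_zero : expTwoPiI 0 = 1 := by simp [expTwoPiI]

theorem expTwoPiI_add (z w : ℂ) : expTwoPiI (z + w) = expTwoPiI z * expTwoPiI w := by
  simp [expTwoPiI, mul_add, Complex.exp_add]

theorem expTwoPiI_neg (z : ℂ) : expTwoPiI (-z) = (expTwoPiI z)⁻¹ := by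
  simp [expTwoPiI, Complex.exp_neg]

theorem expTwoPiI_sub (z w : ℂ) : expTwoPiI (z - w) = expTwoPiI z / expTwoPiI w := by
  rw [sub_eq_add_neg, expTwoPiI_add, expTwoPiI_neg, div_eq_mul_inv]

theorem expTwoPiI_ne_zero (z : ℂ) : expTwoPiI z ≠ 0 := Complex.exp_ne_zero _

theorem expTwoPiI_nat_mul (n : ℕ) (z : ℂ) : expTwoPiI (n * z) = expTwoPiI z ^ n := by
  rw [expTwoPiI, expTwoPiI, ← Complex.exp_nat_mul]; ring_nf

theorem expTwoPiI_div_pow {q : ℕ} (hq : 0 < q) (z : ℂ) : expTwoPiI (z / q) ^ q = expTwoPiI z := by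
  rw [← expTwoPiI_nat_mul, mul_div_cancel₀]
  exact_mod_cast hq.ne'

theorem expTwoPiI_eq_one_iff {z : ℂ} : expTwoPiI z = 1 ↔ ∃ n : ℤ, z = n := by
  rw [expTwoPiI, Complex.exp_eq_one_iff]
  have h : (2 * Real.pi * Complex.I : ℂ) ≠ 0 := Complex.two_pi_I_ne_zero
  refine exists_congr fun n => ?_
  rw [mul_comm (n : ℂ), mul_right_inj' h]

theorem expTwoPiI_int (n : ℤ) : expTwoPiI n = 1 := expTwoPiI_eq_one_iff.2 ⟨n, rfl⟩

theorem expTwoPiI_surj {z : ℂ} (hz : z ≠ 0) : ∃ w, expTwoPiI w = z := by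
  refine ⟨Complex.log z / (2 * Real.pi * Complex.I), ?_⟩
  rw [expTwoPiI, mul_div_cancel₀ _ Complex.two_pi_I_ne_zero, Complex.exp_log hz]

theorem circleExp_coe (x : ℝ) : (Circle.exp (2 * Real.pi * x) : ℂ) = expTwoPiI x := by
  rw [Circle.coe_exp, expTwoPiI]; push_cast; ring_nf

/-- Continuous logarithms exist on retracts of simply connected locally path connected spaces. -/
theorem exists_continuous_log {X Y : Type*} [TopologicalSpace X] [TopologicalSpace Y]
    [SimplyConnectedSpace Y] [LocallyPathConnectedSpace Y] (i : C(X, Y)) (r : C(Y, X))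
    (hri : ∀ x, r (i x) = x) {f : X → ℂ} (hf : Continuous f) (h0 : ∀ x, f x ≠ 0) :
    ∃ φ : X → ℂ, Continuous φ ∧ ∀ x, expTwoPiI (φ x) = f x := by
  obtain ⟨y₀⟩ : Nonempty Y := inferInstance
  -- The exponential covers the punctured plane, so `f ∘ r` lifts on the simply connected `Y`;
  -- restricting the lift along `i` recovers `f`.
  obtain ⟨F, ⟨-, hF⟩, -⟩ := Complex.isCoveringMapOn_exp.existsUnique_continuousMap_lifts
    (⟨fun y => f (r y), by fun_prop⟩ : C(Y, ℂ)) (a₀ := y₀) (Complex.exp_log (h0 (r y₀)))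
    (fun y => h0 (r y))
  refine ⟨fun x => F (i x) / (2 * Real.pi * Complex.I), by fun_prop, fun x => ?_⟩
  rw [expTwoPiI, mul_div_cancel₀ _ Complex.two_pi_I_ne_zero]
  simpa [hri] using congrFun hF (i x)

/-- The retraction of the line to the unit interval. -/
def projI : C(ℝ, I) := ⟨Set.projIcc 0 1 zero_le_one, continuous_projIcc⟩

theorem projI_coe (t : I) : projI t = t := Set.projIcc_val zero_le_one t

theorem exists_continuous_log_I {f : I → ℂ} (hf : Continuous f) (h0 : ∀ x, f x ≠ 0) :
    ∃ φ : I → ℂ, Continuous φ ∧ ∀ x, expTwoPiI (φ x) = f x :=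
  exists_continuous_log (⟨Subtype.val, continuous_subtype_val⟩ : C(I, ℝ)) projI projI_coe hf h0

theorem exists_continuous_log_square {f : I × I → ℂ} (hf : Continuous f) (h0 : ∀ x, f x ≠ 0) :
    ∃ φ : I × I → ℂ, Continuous φ ∧ ∀ x, expTwoPiI (φ x) = f x :=
  exists_continuous_log (Y := ℝ × ℝ)
    (⟨fun x => (x.1, x.2), by fun_prop⟩ : C(I × I, ℝ × ℝ))
    (⟨fun y => (projI y.1, projI y.2), by fun_prop⟩ : C(ℝ × ℝ, I × I))
    (fun x => Prod.ext (projI_coe x.1) (projI_coe x.2)) hf h0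

theorem exists_continuous_log_plane {f : (Fin 2 → ℝ) → ℂ} (hf : Continuous f)
    (h0 : ∀ x, f x ≠ 0) :
    ∃ φ : (Fin 2 → ℝ) → ℂ, Continuous φ ∧ ∀ x, expTwoPiI (φ x) = f x :=
  exists_continuous_log (.id _) (.id _) (fun _ => rfl) hf h0

/-- A continuous complex function with integer values is constant. -/
theorem eq_of_forall_int {X : Type*} [TopologicalSpace X] [PreconnectedSpace X] {f : X → ℂ}
    (hf : Continuous f) (h : ∀ x, ∃ n : ℤ, f x = n) (x y : X) : f x = f y := by
  have hc : Continuous fun x => (f x).re := Complex.continuous_re.comp hf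
  choose n hn using h
  have hn' : Continuous n := by
    refine Int.isClosedEmbedding_coe_real.isInducing.continuous_iff.2 ?_
    convert hc using 2 with x
    simp [hn]
  rw [hn, hn, PreconnectedSpace.constant ‹_› hn']

/-- Two logarithms of proportional functions differ by a constant. -/
theorem sub_eq_sub_of_expTwoPiI {X : Type*} [TopologicalSpace X] [PreconnectedSpace X]
    {φ ψ : X → ℂ} (hφ : Continuous φ) (hψ : Continuous ψ) {c : ℂ}
    (h : ∀ x, expTwoPiI (φ x) = c * expTwoPiI (ψ x)) (x y : X) : φ x - φ y = ψ x - ψ y := by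
  have hc : c ≠ 0 := by
    rintro rfl
    exact expTwoPiI_ne_zero _ ((h x).trans (zero_mul _))
  -- The exponential of this difference is c / c = 1, so its values are integers.
  have := eq_of_forall_int (f := fun z => φ z - ψ z - (φ y - ψ y)) (by fun_prop) (fun z => by
    apply expTwoPiI_eq_one_iff.1
    simp only [expTwoPiI_sub, h]
    field_simp [expTwoPiI_ne_zero]) x y
  linear_combination this

/-! ### Descent to the circle -/

/-- The parametrization of the circle by the unit interval. -/
def toCircle : C(I, UnitAddCircle) :=
  ⟨fun t => ((t : ℝ) : UnitAddCircle), (AddCircle.continuous_mk' 1).comp continuous_subtype_val⟩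

theorem toCircle_apply (t : I) : toCircle t = ((t : ℝ) : UnitAddCircle) := rfl

theorem toCircle_zero : toCircle 0 = 0 := by simp [toCircle_apply]

theorem toCircle_one : toCircle 1 = 0 := by
  simp [toCircle_apply]

theorem coe_one_eq_zero : ((1 : ℝ) : UnitAddCircle) = 0 := AddCircle.coe_period (1 : ℝ)

theorem toCircle_surjective : Function.Surjective toCircle := fun x => by
  obtain ⟨t, ht, rfl⟩ := AddCircle.eq_coe_Ico x
  exact ⟨⟨t, ht.1, ht.2.le⟩, rfl⟩

theorem toCircle_eq_iff {s t : I} (h : toCircle s = toCircle t) :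
    s = t ∨ (s = 0 ∧ t = 1) ∨ (s = 1 ∧ t = 0) := by
  rw [toCircle_apply, toCircle_apply, ← sub_eq_zero, ← AddCircle.coe_sub,
    AddCircle.coe_eq_zero_iff] at h
  obtain ⟨n, hn⟩ := h
  have hs := s.2
  have ht := t.2
  simp only [zsmul_eq_mul, mul_one, Set.mem_Icc] at hn hs ht
  have h1 : -1 ≤ n := by exact_mod_cast (by linarith : (-1 : ℝ) ≤ n)
  have h2 : n ≤ 1 := by exact_mod_cast (by linarith : (n : ℝ) ≤ 1)
  interval_cases n <;> norm_num at hn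
  · exact Or.inr (Or.inl ⟨Subtype.ext (by rw [Set.Icc.coe_zero]; linarith), Subtype.ext (by rw [Set.Icc.coe_one]; linarith)⟩)
  · exact Or.inl (Subtype.ext (by linarith))
  · exact Or.inr (Or.inr ⟨Subtype.ext (by rw [Set.Icc.coe_one]; linarith), Subtype.ext (by rw [Set.Icc.coe_zero]; linarith)⟩)

/-- The interval is compact, so `toCircle` times the identity of `Z` is proper, hence a closed
surjection and a quotient map. The parameter space `Z` needs no local compactness. -/
theorem exists_descent {Z Y : Type*} [TopologicalSpace Z] [TopologicalSpace Y] {f : I × Z → Y}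
    (hf : Continuous f) (h : ∀ z, f (0, z) = f (1, z)) :
    ∃ g : UnitAddCircle × Z → Y, Continuous g ∧ ∀ t z, g (toCircle t, z) = f (t, z) := by
  have hp : IsProperMap (Prod.map toCircle (id : Z → Z)) :=
    (toCircle.continuous.isProperMap).prodMap isProperMap_id
  have hs : Function.Surjective (Prod.map toCircle (id : Z → Z)) :=
    toCircle_surjective.prodMap Function.surjective_id
  have hq := hp.isClosedMap.isQuotientMap hp.continuous hs
  choose u hu using toCircle_surjective
  have key : ∀ t z, f (u (toCircle t), z) = f (t, z) := fun t z => by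
    rcases toCircle_eq_iff (hu (toCircle t)) with h1 | ⟨h1, h2⟩ | ⟨h1, h2⟩
    · rw [h1]
    · rw [h1, h2, h]
    · rw [h1, h2, h]
  refine ⟨fun p => f (u p.1, p.2), ?_, key⟩
  rw [hq.continuous_iff]
  convert hf using 1
  ext ⟨t, z⟩
  exact key t z

/-! ### Free homotopy classes of loops in `GL` -/

/-- Trigonometric polynomials are smooth and uniformly dense. Smoothness is what allows a dimension
count for the image of the loop. -/
theorem exists_contDiff_near (a : C(UnitAddCircle, ℂ)) {ε : ℝ} (hε : 0 < ε) :
    ∃ b : C(UnitAddCircle, ℂ), ContDiff ℝ 1 (fun t : ℝ => b (t : UnitAddCircle)) ∧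
      ∀ x, ‖b x - a x‖ < ε := by
  have ha : a ∈ closure (Submodule.span ℂ (Set.range (@fourier 1)) : Set C(UnitAddCircle, ℂ)) := by
    have := span_fourier_closure_eq_top (T := 1)
    rw [← Submodule.topologicalClosure_coe, this]; trivial
  obtain ⟨b, hb, hab⟩ := Metric.mem_closure_iff.1 ha ε hε
  refine ⟨b, ?_, fun x => ?_⟩
  · clear hab
    induction hb using Submodule.span_induction with
    | mem f hf =>
      obtain ⟨n, rfl⟩ := hf
      have h : ContDiff ℝ 1 fun t : ℝ => 2 * Real.pi * Complex.I * n * (t : ℂ) / ((1 : ℝ) : ℂ) := by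
        have : ContDiff ℝ 1 fun t : ℝ => (t : ℂ) := Complex.ofRealCLM.contDiff
        fun_prop
      exact (funext fun t => fourier_coe_apply :
        (fun t : ℝ => fourier n (t : AddCircle (1 : ℝ))) = _) ▸ h.cexp
    | zero => exact contDiff_const
    | add f g _ _ hf hg => exact hf.add hg
    | smul c f _ hf => exact contDiff_const.smul hf
  · rw [← dist_eq_norm, dist_comm]
    exact (ContinuousMap.dist_apply_le_dist x).trans_lt hab

/-- Loops in the plane can be perturbed so as to avoid the origin. -/
theorem exists_nonvanishing_near (a : C(UnitAddCircle, ℂ)) {ε : ℝ} (hε : 0 < ε) :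
    ∃ b : C(UnitAddCircle, ℂ), (∀ x, b x ≠ 0) ∧ ∀ x, ‖b x - a x‖ < ε := by
  obtain ⟨b, hb, hab⟩ := exists_contDiff_near a (half_pos hε)
  -- A C¹ curve cannot fill any open set of the plane, so an arbitrarily small `w` is off its image
  -- and `b - w` has no zero.
  have hd := hb.dense_compl_range_of_finrank_lt_finrank (by simp)
  obtain ⟨w, hw, hw'⟩ := Metric.dense_iff.1 hd 0 (ε / 2) (half_pos hε)
  rw [mem_ball_zero_iff] at hw
  let b' : C(UnitAddCircle, ℂ) := ⟨fun x => b x - w, by fun_prop⟩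
  refine ⟨b', fun x hx => ?_, fun x => ?_⟩
  · obtain ⟨t, rfl⟩ := QuotientAddGroup.mk_surjective x
    exact hw' ⟨t, sub_eq_zero.1 hx⟩
  · calc ‖b' x - a x‖ = ‖(b x - a x) - w‖ := by
          simp only [b', ContinuousMap.coe_mk]; ring_nf
      _ ≤ ‖b x - a x‖ + ‖w‖ := norm_sub_le _ _
      _ < ε := by linarith [hab x]

section GeneralLinear

variable {ι κ X : Type} [Fintype ι] [DecidableEq ι] [Fintype κ] [DecidableEq κ]
  [TopologicalSpace X]

theorem continuous_matrix_inv {Y : Type*} [TopologicalSpace Y] {f : Y → Matrix ι ι ℂ}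
    (hf : Continuous f) (h : ∀ y, (f y).det ≠ 0) : Continuous fun y => (f y)⁻¹ := by
  simp only [Matrix.inv_def, Ring.inverse_eq_inv']
  exact (hf.matrix_det.inv₀ h).smul hf.matrix_adjugate

theorem continuous_gl_iff {Y : Type*} [TopologicalSpace Y] {f : Y → GL ι ℂ} :
    Continuous f ↔ Continuous fun y => (f y : Matrix ι ι ℂ) := by
  refine ⟨fun h => Units.continuous_val.comp h, fun h => Units.continuous_iff.2 ⟨h, ?_⟩⟩
  simp only [Matrix.coe_units_inv]
  exact continuous_matrix_inv h fun y => (Matrix.isUnits_det_units (f y)).ne_zero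

/-- The continuous map to `GL` defined by a continuous family of nonsingular matrices. -/
def glMap {Y : Type*} [TopologicalSpace Y] (f : Y → Matrix ι ι ℂ) (hf : Continuous f)
    (h : ∀ y, (f y).det ≠ 0) : C(Y, GL ι ℂ) :=
  ⟨fun y => Matrix.GeneralLinearGroup.mkOfDetNeZero (f y) (h y), continuous_gl_iff.2 hf⟩

theorem homotopic_of_matrix {γ γ' : C(X, GL ι ℂ)} (H : I × X → Matrix ι ι ℂ) (hH : Continuous H)
    (hd : ∀ p, (H p).det ≠ 0) (h0 : ∀ x, H (0, x) = γ x) (h1 : ∀ x, H (1, x) = γ' x) :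
    γ.Homotopic γ' :=
  ⟨{ toContinuousMap := glMap H hH hd
     map_zero_left := fun x => Units.ext (h0 x)
     map_one_left := fun x => Units.ext (h1 x) }⟩

theorem homotopic_mul {G : Type*} [Group G] [TopologicalSpace G] [IsTopologicalGroup G]
    {f f' g g' : C(X, G)} (hf : f.Homotopic f') (hg : g.Homotopic g') :
    (f * g).Homotopic (f' * g') :=
  ContinuousMap.Homotopic.comp
    (ContinuousMap.Homotopic.refl (⟨fun p => p.1 * p.2, continuous_mul⟩ : C(G × G, G)))
    (hf.prodMk hg)

/-- `GL(ℂ)` is path connected. -/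
theorem exists_gl_path (A : GL ι ℂ) : ∃ p : C(I, GL ι ℂ), p 0 = 1 ∧ p 1 = A := by
  -- The determinant along the complex line through 1 and A is a nonzero polynomial in the
  -- parameter. Its finitely many zeros do not disconnect ℂ, so 0 and 1 can be joined away from
  -- them.
  let P : Polynomial ℂ := (Polynomial.C.mapMatrix (1 : Matrix ι ι ℂ) +
    (Polynomial.X : Polynomial ℂ) • Polynomial.C.mapMatrix ((A : Matrix ι ι ℂ) - 1)).det
  have hP : ∀ z, P.eval z = ((1 : Matrix ι ι ℂ) + z • ((A : Matrix ι ι ℂ) - 1)).det := fun z => by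
    rw [← Polynomial.coe_evalRingHom, RingHom.map_det]
    congr 1
    ext i j
    by_cases h : i = j <;> (simp [h]; try ring)
  have h0 : P.eval 0 ≠ 0 := by simp [hP]
  have h1 : P.eval 1 ≠ 0 := by
    simpa [hP] using (Matrix.isUnits_det_units A).ne_zero
  have hP0 : P ≠ 0 := by rintro h; simp [h] at h0
  have hc : IsPathConnected {z : ℂ | P.eval z = 0}ᶜ := by
    refine Set.Countable.isPathConnected_compl_of_one_lt_rank (by simp) ?_
    exact (Polynomial.finite_setOfPred_isRoot hP0).countable
  obtain ⟨γ, hγ⟩ := hc.joinedIn 0 h0 1 h1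
  refine ⟨glMap (fun t => 1 + γ t • ((A : Matrix ι ι ℂ) - 1)) (by fun_prop) fun t => ?_,
    Units.ext ?_, Units.ext ?_⟩
  · rw [← hP]; exact hγ t
  · simp [glMap]
  · simp [glMap]

theorem const_homotopic_one (A : GL ι ℂ) : (ContinuousMap.const X A).Homotopic 1 := by
  obtain ⟨p, h0, h1⟩ := exists_gl_path A
  exact ContinuousMap.Homotopic.symm
    ⟨{ toContinuousMap := p.comp ⟨Prod.fst, continuous_fst⟩
       map_zero_left := fun x => h0
       map_one_left := fun x => h1 }⟩

/-- Diagonal matrices. -/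
def diagHom (ι : Type) [Fintype ι] [DecidableEq ι] : (ι → ℂˣ) →* GL ι ℂ :=
  (Units.map (Matrix.diagonalRingHom ι ℂ : (ι → ℂ) →* Matrix ι ι ℂ)).comp
    MulEquiv.piUnits.symm.toMonoidHom

theorem diagHom_val (d : ι → ℂˣ) :
    (diagHom ι d : Matrix ι ι ℂ) = Matrix.diagonal fun i => (d i : ℂ) := rfl

/-- Loops of diagonal matrices. -/
def diagMap (d : C(X, ι → ℂˣ)) : C(X, GL ι ℂ) :=
  ⟨fun x => diagHom ι (d x), continuous_gl_iff.2 <| by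
    simp only [diagHom_val]
    refine Continuous.matrix_diagonal ?_
    exact continuous_pi fun i => Units.continuous_val.comp ((continuous_apply i).comp d.continuous)⟩

/-- The loop of diagonal matrices with one nontrivial entry. -/
def singleMap (i : ι) (c : C(X, ℂˣ)) : C(X, GL ι ℂ) :=
  diagMap ⟨fun x => Pi.mulSingle i (c x), continuous_pi fun j => by
    by_cases h : j = i
    · subst h; simpa using c.continuous
    · simpa [h] using continuous_const⟩

theorem singleMap_mul (i : ι) (c c' : C(X, ℂˣ)) :
    singleMap i (c * c') = singleMap i c * singleMap i c' := by
  ext1 x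
  simp [singleMap, diagMap, Pi.mulSingle_mul]

/-- Conjugation by a transposition matrix moves one diagonal slot to the other. It does not change
the free homotopy class because constant maps into the path connected GL are homotopic to 1. -/
theorem singleMap_homotopic (i j : ι) (c : C(X, ℂˣ)) :
    (singleMap i c).Homotopic (singleMap j c) := by
  let P : GL ι ℂ := Matrix.GeneralLinearGroup.mkOfDetNeZero
    ((Equiv.swap i j).toPEquiv.toMatrix : Matrix ι ι ℂ) (by
      rw [Matrix.det_permutation]
      exact_mod_cast (Equiv.Perm.sign (Equiv.swap i j)).ne_zero)
  have h : singleMap i c = ContinuousMap.const X P * singleMap j c * ContinuousMap.const X P⁻¹ := by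
    ext1 x
    change diagHom ι (Pi.mulSingle i (c x)) = P * diagHom ι (Pi.mulSingle j (c x)) * P⁻¹
    rw [eq_mul_inv_iff_mul_eq]
    refine Units.ext ?_
    change (diagHom ι _ : Matrix ι ι ℂ) * (Equiv.swap i j).toPEquiv.toMatrix =
      (Equiv.swap i j).toPEquiv.toMatrix * (diagHom ι _ : Matrix ι ι ℂ)
    rw [PEquiv.mul_toMatrix_toPEquiv, PEquiv.toMatrix_toPEquiv_mul, diagHom_val, diagHom_val]
    ext a b
    have h1 : a = Equiv.swap i j b ↔ Equiv.swap i j a = b :=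
      ⟨fun h => by simp [h], fun h => by simp [← h]⟩
    have h2 : Equiv.swap i j a = j ↔ a = i := by
      rw [← Equiv.eq_symm_apply, Equiv.symm_swap, Equiv.swap_apply_right]
    simp [Matrix.diagonal_apply, h1, Pi.mulSingle_apply, h2]
  rw [h]
  simpa using homotopic_mul (homotopic_mul (const_homotopic_one P) (.refl _))
    (const_homotopic_one P⁻¹)

/-- A diagonal loop is the product of its one-entry factors; each factor can be moved to the slot
`i₀`, where the entries multiply. The induction runs over a finite set containing the nontrivial
slots. -/
theorem diagMap_homotopic (i₀ : ι) (d : C(X, ι → ℂˣ)) : ∃ c : C(X, ℂˣ),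
    (diagMap d).Homotopic (singleMap i₀ c) := by
  have key : ∀ s : Finset ι, ∀ d : C(X, ι → ℂˣ), (∀ x, ∀ i ∉ s, d x i = 1) →
      ∃ c : C(X, ℂˣ), (diagMap d).Homotopic (singleMap i₀ c) := by
    intro s
    induction s using Finset.induction_on with
    | empty =>
      intro d hd
      refine ⟨1, ?_⟩
      convert ContinuousMap.Homotopic.refl _ using 1
      ext1 x
      have : d x = 1 := funext fun i => hd x i (by simp)
      simp [singleMap, diagMap, this]
    | insert i s hi ih =>
      intro d hd
      let di : C(X, ℂˣ) := ⟨fun x => d x i, (continuous_apply i).comp d.continuous⟩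
      let d' : C(X, ι → ℂˣ) := ⟨fun x => Function.update (d x) i 1,
        d.continuous.update i continuous_const⟩
      obtain ⟨c, hc⟩ := ih d' fun x j hj => by
        by_cases h : j = i
        · subst h; simp [d']
        · simp [d', h, hd x j (by simp [h, hj])]
      refine ⟨di * c, ?_⟩
      have : diagMap d = singleMap i di * diagMap d' := by
        ext1 x
        simp only [diagMap, singleMap, ContinuousMap.coe_mk, ContinuousMap.mul_apply, ← map_mul]
        congr 1
        ext j
        by_cases h : j = i
        · subst h; simp [di, d']
        · simp [h, d']
      rw [this, singleMap_mul]
      exact homotopic_mul (singleMap_homotopic _ _ _) hc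
  exact key Finset.univ d (by simp)

/-- Loops of unipotent lower triangular matrices are null-homotopic. -/
theorem lower_homotopic_one (γ : C(X, GL (ι ⊕ κ) ℂ)) (C : X → Matrix κ ι ℂ) (hC : Continuous C)
    (h : ∀ x, (γ x : Matrix (ι ⊕ κ) (ι ⊕ κ) ℂ) = Matrix.fromBlocks 1 0 (C x) 1) :
    γ.Homotopic 1 :=
  homotopic_of_matrix (fun p => Matrix.fromBlocks 1 0 ((1 - ((p.1 : ℝ) : ℂ)) • C p.2) 1)
    (by fun_prop) (by simp) (by simp [h]) (by simp)

/-- Loops of unipotent upper triangular matrices are null-homotopic. -/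
theorem upper_homotopic_one (γ : C(X, GL (ι ⊕ κ) ℂ)) (B : X → Matrix ι κ ℂ) (hB : Continuous B)
    (h : ∀ x, (γ x : Matrix (ι ⊕ κ) (ι ⊕ κ) ℂ) = Matrix.fromBlocks 1 (B x) 0 1) :
    γ.Homotopic 1 :=
  homotopic_of_matrix (fun p => Matrix.fromBlocks 1 ((1 - ((p.1 : ℝ) : ℂ)) • B p.2) 0 1)
    (by fun_prop) (by simp) (by simp [h]) (by simp)

/-- A loop in `GL` can be perturbed so that a given entry does not vanish. -/
theorem exists_homotopic_entry_ne_zero (i : ι) (γ : C(UnitAddCircle, GL ι ℂ)) :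
    ∃ γ' : C(UnitAddCircle, GL ι ℂ), γ.Homotopic γ' ∧
      ∀ x, (γ' x : Matrix ι ι ℂ) i i ≠ 0 := by
  have hγ : Continuous fun x => (γ x : Matrix ι ι ℂ) := continuous_gl_iff.1 γ.continuous
  -- By compactness of the circle, one bound on the perturbation of the entry keeps the determinant
  -- nonzero at all points simultaneously.
  have key : ∀ᶠ c in nhds (0 : ℂ), ∀ x ∈ (Set.univ : Set UnitAddCircle),
      ((γ x : Matrix ι ι ℂ) + c • Matrix.single i i 1).det ≠ 0 := by
    refine isCompact_univ.eventually_forall_of_forall_eventually fun x _ => ?_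
    have hc : Continuous fun p : ℂ × UnitAddCircle =>
        ((γ p.2 : Matrix ι ι ℂ) + p.1 • Matrix.single i i 1).det := by
      have := hγ.comp (continuous_snd : Continuous (Prod.snd : ℂ × UnitAddCircle → _))
      fun_prop
    refine hc.continuousAt.eventually_ne ?_
    simpa using (Matrix.isUnits_det_units (γ x)).ne_zero
  obtain ⟨ε, hε, hdet⟩ := Metric.eventually_nhds_iff.1 key
  have hdet' : ∀ c : ℂ, ‖c‖ < ε → ∀ x, ((γ x : Matrix ι ι ℂ) + c • Matrix.single i i 1).det ≠ 0 :=
    fun c hc x => hdet (by simpa using hc) x trivial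
  obtain ⟨b, hb, hab⟩ := exists_nonvanishing_near
    ⟨fun x => (γ x : Matrix ι ι ℂ) i i, hγ.matrix_elem i i⟩ hε
  let H : I × UnitAddCircle → Matrix ι ι ℂ := fun p => (γ p.2 : Matrix ι ι ℂ) +
    (((p.1 : ℝ) : ℂ) * (b p.2 - (γ p.2 : Matrix ι ι ℂ) i i)) • Matrix.single i i 1
  have hH : Continuous H := by
    have h1 := hγ.comp (continuous_snd : Continuous (Prod.snd : I × UnitAddCircle → _))
    have h2 : Continuous fun p : I × UnitAddCircle => ((p.1 : ℝ) : ℂ) := by fun_prop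
    have h3 : Continuous fun p : I × UnitAddCircle => b p.2 := by fun_prop
    exact h1.add ((h2.mul (h3.sub (h1.matrix_elem i i))).smul continuous_const)
  have hd : ∀ p, (H p).det ≠ 0 := fun p => by
    change ((γ p.2 : Matrix ι ι ℂ) +
      (((p.1 : ℝ) : ℂ) * (b p.2 - (γ p.2 : Matrix ι ι ℂ) i i)) • Matrix.single i i 1).det ≠ 0
    refine hdet' (((p.1 : ℝ) : ℂ) * (b p.2 - (γ p.2 : Matrix ι ι ℂ) i i)) ?_ p.2
    rw [norm_mul, Complex.norm_real]
    have h1 : ‖(p.1 : ℝ)‖ ≤ 1 := by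
      rw [Real.norm_of_nonneg p.1.2.1]
      exact p.1.2.2
    exact (mul_le_of_le_one_left (norm_nonneg _) h1).trans_lt (hab p.2)
  refine ⟨glMap (fun x => H (1, x)) (hH.comp (by fun_prop)) (fun x => hd _),
    homotopic_of_matrix H hH hd (fun x => by simp [H]) (fun x => rfl), fun x => ?_⟩
  have : H (1, x) i i = b x := by simp [H]
  change H (1, x) i i ≠ 0
  rw [this]
  exact hb x

/-- The block diagonal loop. -/
def blockMap (γ : C(X, GL ι ℂ)) (δ : C(X, GL κ ℂ)) : C(X, GL (ι ⊕ κ) ℂ) :=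
  glMap (fun x => Matrix.fromBlocks (γ x : Matrix ι ι ℂ) 0 0 (δ x : Matrix κ κ ℂ))
    (Continuous.matrix_fromBlocks (continuous_gl_iff.1 γ.continuous) continuous_const
      continuous_const (continuous_gl_iff.1 δ.continuous))
    (fun x => by
      rw [Matrix.det_fromBlocks_zero₁₂]
      exact mul_ne_zero (Matrix.isUnits_det_units _).ne_zero (Matrix.isUnits_det_units _).ne_zero)

theorem blockMap_homotopic {γ γ' : C(X, GL ι ℂ)} {δ δ' : C(X, GL κ ℂ)} (h : γ.Homotopic γ')
    (h' : δ.Homotopic δ') : (blockMap γ δ).Homotopic (blockMap γ' δ') := by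
  obtain ⟨H⟩ := h
  obtain ⟨H'⟩ := h'
  refine homotopic_of_matrix
    (fun p => (blockMap H.toContinuousMap H'.toContinuousMap p : Matrix (ι ⊕ κ) (ι ⊕ κ) ℂ))
    (continuous_gl_iff.1 (ContinuousMap.continuous _))
    (fun p => (Matrix.isUnits_det_units _).ne_zero) (fun x => ?_) (fun x => ?_) <;>
  simp [blockMap, glMap]

/-- Block elimination for loops with invertible lower right block. -/
theorem homotopic_blockMap (γ : C(X, GL (ι ⊕ κ) ℂ))
    (h : ∀ x, (γ x : Matrix (ι ⊕ κ) (ι ⊕ κ) ℂ).toBlocks₂₂.det ≠ 0) :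
    ∃ (γ' : C(X, GL ι ℂ)) (δ : C(X, GL κ ℂ)), γ.Homotopic (blockMap γ' δ) := by
  have hγ : Continuous fun x => (γ x : Matrix (ι ⊕ κ) (ι ⊕ κ) ℂ) :=
    continuous_gl_iff.1 γ.continuous
  let A := fun x => (γ x : Matrix (ι ⊕ κ) (ι ⊕ κ) ℂ).toBlocks₁₁
  let B := fun x => (γ x : Matrix (ι ⊕ κ) (ι ⊕ κ) ℂ).toBlocks₁₂
  let C := fun x => (γ x : Matrix (ι ⊕ κ) (ι ⊕ κ) ℂ).toBlocks₂₁
  let D := fun x => (γ x : Matrix (ι ⊕ κ) (ι ⊕ κ) ℂ).toBlocks₂₂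
  have hA : Continuous A := continuous_matrix fun i j => hγ.matrix_elem _ _
  have hB : Continuous B := continuous_matrix fun i j => hγ.matrix_elem _ _
  have hC : Continuous C := continuous_matrix fun i j => hγ.matrix_elem _ _
  have hD : Continuous D := continuous_matrix fun i j => hγ.matrix_elem _ _
  have hDi := continuous_matrix_inv hD h
  -- Factorization through the Schur complement of the lower right block; the two unipotent factors
  -- contract to 1.
  have e : ∀ x, (γ x : Matrix (ι ⊕ κ) (ι ⊕ κ) ℂ) = Matrix.fromBlocks 1 (B x * (D x)⁻¹) 0 1 *
      Matrix.fromBlocks (A x - B x * (D x)⁻¹ * C x) 0 0 (D x) *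
        Matrix.fromBlocks 1 0 ((D x)⁻¹ * C x) 1 := fun x => by
    let _ : Invertible (D x) := Matrix.invertibleOfIsUnitDet _ (h x).isUnit
    conv_lhs => rw [← Matrix.fromBlocks_toBlocks (γ x : Matrix (ι ⊕ κ) (ι ⊕ κ) ℂ)]
    rw [Matrix.fromBlocks_eq_of_invertible₂₂ (A x) (B x) (C x) (D x), Matrix.invOf_eq_nonsing_inv]
  have hdet : ∀ x, (A x - B x * (D x)⁻¹ * C x).det ≠ 0 := fun x h0 => by
    refine (Matrix.isUnits_det_units (γ x)).ne_zero ?_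
    rw [e, Matrix.det_mul, Matrix.det_mul, Matrix.det_fromBlocks_zero₁₂ _ _ (D x), h0]
    ring
  let U := glMap (fun x => Matrix.fromBlocks 1 (B x * (D x)⁻¹) 0 1)
    (by fun_prop) (by simp)
  let L := glMap (fun x => Matrix.fromBlocks 1 0 ((D x)⁻¹ * C x) 1)
    (by fun_prop) (by simp)
  let S := glMap (fun x => A x - B x * (D x)⁻¹ * C x) (by fun_prop) hdet
  refine ⟨S, glMap D hD h, ?_⟩
  have : γ = U * blockMap S (glMap D hD h) * L := by
    ext1 x
    exact Units.ext (e x)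
  rw [this]
  simpa using homotopic_mul (homotopic_mul
    (upper_homotopic_one U _ (by fun_prop) fun x => rfl) (.refl _))
    (lower_homotopic_one L _ (by fun_prop) fun x => rfl)

/-- Renaming the rows and columns. -/
def reindexGL (e : ι ≃ κ) : C(GL ι ℂ, GL κ ℂ) :=
  glMap (fun A => (A : Matrix ι ι ℂ).submatrix e.symm e.symm)
    (Units.continuous_val.matrix_submatrix _ _)
    (fun A => by
      rw [Matrix.det_submatrix_equiv_self]
      exact (Matrix.isUnits_det_units A).ne_zero)

/-- Loops in `GL` can be diagonalized up to homotopy. -/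
theorem exists_homotopic_diagMap (ι : Type) [Fintype ι] [DecidableEq ι]
    (γ : C(UnitAddCircle, GL ι ℂ)) :
    ∃ d : C(UnitAddCircle, ι → ℂˣ), γ.Homotopic (diagMap d) := by
  have transfer : ∀ {α β : Type} [Fintype α] [Fintype β] [DecidableEq α] [DecidableEq β]
      (e : α ≃ β), (∀ γ : C(UnitAddCircle, GL α ℂ), ∃ d : C(UnitAddCircle, α → ℂˣ),
        γ.Homotopic (diagMap d)) → ∀ γ : C(UnitAddCircle, GL β ℂ),
          ∃ d : C(UnitAddCircle, β → ℂˣ), γ.Homotopic (diagMap d) := by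
    intro α β _ _ _ _ e h γ
    obtain ⟨d, hd⟩ := h ((reindexGL e.symm).comp γ)
    refine ⟨⟨fun x i => d x (e.symm i), by fun_prop⟩, ?_⟩
    convert ContinuousMap.Homotopic.comp (.refl (reindexGL e)) hd using 1
    · ext x i j
      simp [reindexGL, glMap]
    · ext x i j
      simp [reindexGL, glMap, diagMap, diagHom_val, Matrix.diagonal_apply]
  have := Fintype.induction_empty_option (P := fun ι _ => ∀ [DecidableEq ι]
    (γ : C(UnitAddCircle, GL ι ℂ)), ∃ d : C(UnitAddCircle, ι → ℂˣ), γ.Homotopic (diagMap d))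
    ?_ ?_ ?_ ι
  · exact this γ
  · intro α β _ e ih _
    classical
    let _ := Fintype.ofEquiv β e.symm
    exact transfer e (fun γ => ih γ)
  · intro _ γ
    refine ⟨1, ?_⟩
    convert ContinuousMap.Homotopic.refl _ using 1
    ext x i
    exact i.elim
  · intro α _ ih _
    classical
    refine transfer (Equiv.optionEquivSumPUnit α).symm fun γ => ?_
    -- The split-off coordinate is a 1×1 lower right block. Once made nowhere zero it can be used as
    -- a pivot, and the induction hypothesis applies to the complementary block.
    obtain ⟨γ₁, h₁, hne⟩ := exists_homotopic_entry_ne_zero (Sum.inr PUnit.unit) γ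
    obtain ⟨γ₂, δ, h₂⟩ := homotopic_blockMap γ₁ fun x => by
      simpa [Matrix.det_unique, Matrix.toBlocks₂₂] using hne x
    obtain ⟨d, hd⟩ := ih γ₂
    refine ⟨⟨fun x => Sum.elim (d x) fun _ => Units.mk0 _ (Matrix.isUnits_det_units (δ x)).ne_zero,
      ?_⟩, ?_⟩
    · refine continuous_pi fun i => ?_
      rcases i with i | i
      · exact (continuous_apply i).comp d.continuous
      · rw [Units.continuous_iff]
        have := (continuous_gl_iff.1 δ.continuous).matrix_det
        exact ⟨this, this.inv₀ fun x => (Matrix.isUnits_det_units (δ x)).ne_zero⟩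
    · refine (h₁.trans h₂).trans ?_
      convert blockMap_homotopic hd (.refl δ) using 1
      ext x i j
      rcases i with i | i <;> rcases j with j | j <;>
        simp [blockMap, glMap, diagMap, diagHom_val, Matrix.diagonal_apply, Matrix.det_unique]

/-- A loop in `GL` is freely homotopic to one concentrated in a single diagonal entry. -/
theorem exists_homotopic_singleMap (i₀ : ι) (γ : C(UnitAddCircle, GL ι ℂ)) :
    ∃ c : C(UnitAddCircle, ℂˣ), γ.Homotopic (singleMap i₀ c) := by
  obtain ⟨d, hd⟩ := exists_homotopic_diagMap ι γ
  obtain ⟨c, hc⟩ := diagMap_homotopic i₀ d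
  exact ⟨c, hd.trans hc⟩

end GeneralLinear

/-! ### Polar decomposition -/

section Polar

open scoped ComplexOrder MatrixOrder Matrix.Norms.L2Operator

/-- Polar decomposition `A = P U`, continuous in the invertible matrix `A`. -/
theorem exists_polar (q : ℕ) : ∃ (P : GL (Fin q) ℂ → Matrix (Fin q) (Fin q) ℂ)
    (u : C(GL (Fin q) ℂ, U q)), Continuous P ∧ (∀ A, (P A).PosDef) ∧
      (∀ A, P A * (u A : Matrix (Fin q) (Fin q) ℂ) = A) ∧
        ∀ (A : GL (Fin q) ℂ) (v : U q), (A : Matrix (Fin q) (Fin q) ℂ) = v → u A = v := by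
  -- The positive factor is the square root of A Aᴴ, continuous in A by the functional calculus; the
  -- unitary factor is P⁻¹A.
  let P : GL (Fin q) ℂ → Matrix (Fin q) (Fin q) ℂ := fun A =>
    CFC.sqrt ((A : Matrix (Fin q) (Fin q) ℂ) * (A : Matrix (Fin q) (Fin q) ℂ)ᴴ)
  have hnn : ∀ A : GL (Fin q) ℂ,
      0 ≤ (A : Matrix (Fin q) (Fin q) ℂ) * (A : Matrix (Fin q) (Fin q) ℂ)ᴴ := fun A =>
    Matrix.nonneg_iff_posSemidef.2 (Matrix.posSemidef_self_mul_conjTranspose _)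
  have hsq : ∀ A, P A * P A = (A : Matrix (Fin q) (Fin q) ℂ) * (A : Matrix (Fin q) (Fin q) ℂ)ᴴ :=
    fun A => CFC.sqrt_mul_sqrt_self _ (hnn A)
  have hP : Continuous P := by
    refine CFC.continuousOn_sqrt.comp_continuous ?_ hnn
    have : Continuous fun A : GL (Fin q) ℂ => (A : Matrix (Fin q) (Fin q) ℂ) :=
      Units.continuous_val
    fun_prop
  have hdet : ∀ A, (P A).det ≠ 0 := fun A h => by
    have h1 := congrArg Matrix.det (hsq A)
    rw [Matrix.det_mul, Matrix.det_mul, h, Matrix.det_conjTranspose, zero_mul] at h1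
    exact mul_ne_zero (Matrix.isUnits_det_units A).ne_zero
      (star_ne_zero.2 (Matrix.isUnits_det_units A).ne_zero) h1.symm
  have hpd : ∀ A, (P A).PosDef := fun A =>
    (Matrix.nonneg_iff_posSemidef.1 (CFC.sqrt_nonneg _)).posDef_iff_isUnit.2
      ((Matrix.isUnit_iff_isUnit_det _).2 (hdet A).isUnit)
  have hinv : ∀ A, P A * (P A)⁻¹ = 1 := fun A => Matrix.mul_nonsing_inv _ (hdet A).isUnit
  have hinv' : ∀ A, (P A)⁻¹ * P A = 1 := fun A => Matrix.nonsing_inv_mul _ (hdet A).isUnit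
  have hu : ∀ A : GL (Fin q) ℂ, (P A)⁻¹ * (A : Matrix (Fin q) (Fin q) ℂ) ∈
      Matrix.unitaryGroup (Fin q) ℂ := fun A => by
    rw [Matrix.mem_unitaryGroup_iff, Matrix.star_eq_conjTranspose, Matrix.conjTranspose_mul,
      Matrix.conjTranspose_nonsing_inv, (hpd A).isHermitian.eq]
    calc (P A)⁻¹ * (A : Matrix (Fin q) (Fin q) ℂ) *
          ((A : Matrix (Fin q) (Fin q) ℂ)ᴴ * (P A)⁻¹)
        = (P A)⁻¹ * (P A * P A) * (P A)⁻¹ := by rw [hsq]; simp only [Matrix.mul_assoc]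
      _ = 1 := by rw [← Matrix.mul_assoc, hinv', Matrix.one_mul, hinv]
  refine ⟨P, ⟨fun A => ⟨_, hu A⟩, ?_⟩, hP, hpd, fun A => ?_, fun A v h => ?_⟩
  · exact ((continuous_matrix_inv hP hdet).mul Units.continuous_val).subtype_mk _
  · change P A * ((P A)⁻¹ * (A : Matrix (Fin q) (Fin q) ℂ)) = A
    rw [← Matrix.mul_assoc, hinv, Matrix.one_mul]
  · have h1 : P A = 1 := by
      change CFC.sqrt _ = 1
      rw [h, ← Matrix.star_eq_conjTranspose, Matrix.mem_unitaryGroup_iff.1 v.2, CFC.sqrt_one]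
    refine Subtype.ext ?_
    change (P A)⁻¹ * (A : Matrix (Fin q) (Fin q) ℂ) = v
    rw [h1, inv_one, Matrix.one_mul, h]

end Polar

/-- The inclusion of the unitary group in the general linear group. -/
def inclGL (q : ℕ) : C(U q, GL (Fin q) ℂ) :=
  ⟨fun u => Unitary.toUnits u, continuous_gl_iff.2 continuous_subtype_val⟩

theorem exists_retraction (q : ℕ) : ∃ r : C(GL (Fin q) ℂ, U q), ∀ u, r (inclGL q u) = u := by
  obtain ⟨-, r, -, -, -, h⟩ := exists_polar q
  exact ⟨r, fun u => h _ _ rfl⟩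

/-! ### Homotopy classes of paths -/

/-- The class of a loop in the fundamental group. -/
abbrev pathClass {X : Type*} [TopologicalSpace X] {x : X} (γ : Path x x) : FundamentalGroup X x :=
  FundamentalGroup.fromPath (Path.Homotopic.Quotient.mk γ)

theorem pathClass_surjective {X : Type*} [TopologicalSpace X] {x : X} (c : FundamentalGroup X x) :
    ∃ γ : Path x x, c = pathClass γ := by
  obtain ⟨γ, hγ⟩ := Path.Homotopic.Quotient.mk_surjective c
  exact ⟨γ, hγ.symm⟩

theorem pathClass_eq {X : Type*} [TopologicalSpace X] {x : X} {γ γ' : Path x x} :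
    pathClass γ = pathClass γ' ↔ γ.Homotopic γ' := Path.Homotopic.Quotient.eq

theorem pathClass_mul {X : Type*} [TopologicalSpace X] {x : X} (γ γ' : Path x x) :
    pathClass γ * pathClass γ' = pathClass (γ'.trans γ) := rfl

theorem mapOfEq_pathClass {X Y : Type*} [TopologicalSpace X] [TopologicalSpace Y] (f : C(X, Y))
    {x : X} {y : Y} (h : f x = y) (γ : Path x x) :
    FundamentalGroup.mapOfEq f h (pathClass γ) =
      pathClass ((γ.map f.continuous).cast h.symm h.symm) := by
  rw [FundamentalGroup.mapOfEq_apply]; rfl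

/-- Lifts of homotopic paths along a covering have the same end points. -/
theorem lift_end_eq {E X : Type*} [TopologicalSpace E] [TopologicalSpace X] {p : E → X}
    (cov : IsCoveringMap p) {x y : X} {γ γ' : Path x y} (h : γ.Homotopic γ') {Γ Γ' : C(I, E)}
    (hΓ : ∀ s, p (Γ s) = γ s) (hΓ' : ∀ s, p (Γ' s) = γ' s) (h0 : Γ 0 = Γ' 0) : Γ 1 = Γ' 1 := by
  have e : γ.toContinuousMap 0 = p (Γ 0) := (hΓ 0).symm
  have e' : γ'.toContinuousMap 0 = p (Γ 0) := by rw [h0]; exact (hΓ' 0).symm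
  have h1 := cov.liftPath_apply_one_eq_of_homotopicRel h (Γ 0) e e'
  rw [← (cov.eq_liftPath_iff' e).2 ⟨funext hΓ, rfl⟩,
    ← (cov.eq_liftPath_iff' e').2 ⟨funext hΓ', h0.symm⟩] at h1
  exact h1

theorem lift_trans {E X : Type*} [TopologicalSpace E] [TopologicalSpace X] {p : E → X}
    {x y z : X} {γ : Path x y} {γ' : Path y z} {a b c : E} {Γ : Path a b} {Γ' : Path b c}
    (hΓ : ∀ s, p (Γ s) = γ s) (hΓ' : ∀ s, p (Γ' s) = γ' s) (s : I) :
    p (Γ.trans Γ' s) = γ.trans γ' s := by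
  simp only [Path.trans_apply]
  split_ifs
  · exact hΓ _
  · exact hΓ' _

/-- A functional relation compatible with the products, with trivial kernel and full image, is
the graph of a group isomorphism. -/
theorem exists_mulEquiv_of_rel {G A : Type*} [Group G] [Group A] (R : G → A → Prop)
    (hex : ∀ g, ∃ a, R g a) (huniq : ∀ g a b, R g a → R g b → a = b)
    (hmul : ∀ g h a b, R g a → R h b → R (g * h) (a * b)) (hker : ∀ g, R g 1 → g = 1)
    (hsurj : ∀ a, ∃ g, R g a) : ∃ δ : G ≃* A, ∀ g a, δ g = a ↔ R g a := by
  choose f hf using hex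
  have hiff : ∀ g a, f g = a ↔ R g a := fun g a =>
    ⟨fun h => h ▸ hf g, fun h => huniq g _ _ (hf g) h⟩
  let F : G →* A := MonoidHom.mk' f fun g h => (hiff _ _).2 (hmul _ _ _ _ (hf g) (hf h))
  refine ⟨MulEquiv.ofBijective F ⟨?_, fun a => ?_⟩, hiff⟩
  · rw [injective_iff_map_eq_one]
    exact fun g hg => hker g ((hiff _ _).1 hg)
  · obtain ⟨g, hg⟩ := hsurj a
    exact ⟨g, (hiff _ _).2 hg⟩

/-! ### The degree -/

/-- The definition allows any representative of the class. Homotopic loops have lifts with the same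
endpoint, so the prescribed representative can be used instead. -/
theorem hasDegree_pathClass_iff {γ : Path (1 : Circle) 1} {n : ℤ} :
    HasDegree (pathClass γ) n ↔ ∃ θ : C(I, ℝ), (∀ s, Circle.exp (2 * Real.pi * θ s) = γ s) ∧
      θ 0 = 0 ∧ θ 1 = n := by
  refine ⟨?_, fun ⟨θ, h, h0, h1⟩ => ⟨γ, θ, rfl, h, h0, h1⟩⟩
  rintro ⟨γ', θ', hc, h, h0, h1⟩
  have cov := Circle.isCoveringMap_exp
  obtain ⟨Γ, hΓ, hΓ0⟩ := cov.exists_path_lifts (γ : C(I, Circle)) 0 (by simp)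
  have hΓ' : ∀ s, Circle.exp (Γ s) = γ s := congrFun hΓ
  have key := lift_end_eq cov (pathClass_eq.1 hc) (Γ := Γ)
    (Γ' := ⟨fun s => 2 * Real.pi * θ' s, by fun_prop⟩) hΓ' h (by simp [hΓ0, h0])
  have hpi := Real.pi_ne_zero
  refine ⟨⟨fun s => Γ s / (2 * Real.pi), by fun_prop⟩, fun s => ?_, by simp [hΓ0], ?_⟩
  · rw [← hΓ']
    congr 1
    simp only [ContinuousMap.coe_mk]
    field_simp
  · simp only [ContinuousMap.coe_mk, key, h1]
    field_simp

theorem exists_hasDegree (c : FundamentalGroup Circle 1) : ∃ n, HasDegree c n := by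
  obtain ⟨γ, rfl⟩ := pathClass_surjective c
  obtain ⟨Γ, hΓ, hΓ0⟩ := Circle.isCoveringMap_exp.exists_path_lifts (γ : C(I, Circle)) 0 (by simp)
  have hΓ' : ∀ s, Circle.exp (Γ s) = γ s := congrFun hΓ
  have h1 : Circle.exp (Γ 1) = 1 := by rw [hΓ', γ.target]
  obtain ⟨n, hn⟩ := Circle.exp_eq_one.1 h1
  have hpi := Real.pi_ne_zero
  refine ⟨n, γ, ⟨fun s => Γ s / (2 * Real.pi), by fun_prop⟩, rfl, fun s => ?_, by simp [hΓ0], ?_⟩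
  · rw [← hΓ']
    congr 1
    simp only [ContinuousMap.coe_mk]
    field_simp
  · simp only [ContinuousMap.coe_mk, hn]
    field_simp

theorem hasDegree_unique {c : FundamentalGroup Circle 1} {m n : ℤ} (hm : HasDegree c m)
    (hn : HasDegree c n) : m = n := by
  obtain ⟨γ, rfl⟩ := pathClass_surjective c
  obtain ⟨θ, h, h0, h1⟩ := hasDegree_pathClass_iff.1 hm
  obtain ⟨θ', h', h0', h1'⟩ := hasDegree_pathClass_iff.1 hn
  have key := lift_end_eq Circle.isCoveringMap_exp (Path.Homotopic.refl γ)
    (Γ := ⟨fun s => 2 * Real.pi * θ s, by fun_prop⟩)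
    (Γ' := ⟨fun s => 2 * Real.pi * θ' s, by fun_prop⟩) h h' (by simp [h0, h0'])
  have hpi := Real.pi_ne_zero
  simp only [ContinuousMap.coe_mk, h1, h1'] at key
  have : (m : ℝ) = n := by
    field_simp at key
    exact key
  exact_mod_cast this

/-- The product in `FundamentalGroup` traverses γ' first, so the lift of γ is shifted by n before
being appended to that of γ'. -/
theorem HasDegree.mul {c d : FundamentalGroup Circle 1} {m n : ℤ} (hc : HasDegree c m)
    (hd : HasDegree d n) : HasDegree (c * d) (m + n) := by
  obtain ⟨γ, rfl⟩ := pathClass_surjective c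
  obtain ⟨γ', rfl⟩ := pathClass_surjective d
  obtain ⟨θ, h, h0, h1⟩ := hasDegree_pathClass_iff.1 hc
  obtain ⟨θ', h', h0', h1'⟩ := hasDegree_pathClass_iff.1 hd
  rw [pathClass_mul, hasDegree_pathClass_iff]
  let Γ' : Path (0 : ℝ) n := ⟨θ', h0', h1'⟩
  let Γ : Path (n : ℝ) (m + n : ℤ) :=
    ⟨⟨fun s => θ s + n, by fun_prop⟩, by simp [h0], by simp [h1]⟩
  refine ⟨(Γ'.trans Γ).toContinuousMap, ?_, (Γ'.trans Γ).source, (Γ'.trans Γ).target⟩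
  refine lift_trans (p := fun x : ℝ => Circle.exp (2 * Real.pi * x)) h' fun s => ?_
  change Circle.exp (2 * Real.pi * (θ s + n)) = γ s
  rw [mul_add, Circle.exp_add, h, Circle.exp_eq_one.2 ⟨n, by ring⟩, mul_one]

theorem piDet_pathClass {q : ℕ} (γ : Path (1 : U q) 1) : piDet q (pathClass γ) =
    pathClass ((γ.map (detMap q).continuous).cast (Subtype.ext Matrix.det_one).symm
      (Subtype.ext Matrix.det_one).symm) :=
  mapOfEq_pathClass _ _ γ

/-- A loop in `U(q)` whose determinant has degree `n` has a continuous logarithm of the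
determinant. -/
theorem hasDegree_piDet_iff {q : ℕ} {γ : Path (1 : U q) 1} {n : ℤ} :
    HasDegree (piDet q (pathClass γ)) n ↔ ∃ θ : C(I, ℝ),
      (∀ s, expTwoPiI (θ s) = (γ s : Matrix (Fin q) (Fin q) ℂ).det) ∧ θ 0 = 0 ∧ θ 1 = n := by
  rw [piDet_pathClass, hasDegree_pathClass_iff]
  refine exists_congr fun θ => and_congr_left' (forall_congr' fun s => ?_)
  rw [← circleExp_coe]
  exact Circle.ext_iff

/-! ### `π₁(U(q))` -/

theorem continuous_det_gl (q : ℕ) : Continuous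
    (Matrix.GeneralLinearGroup.det : GL (Fin q) ℂ → ℂˣ) :=
  Units.continuous_iff.2 ⟨Units.continuous_val.matrix_det,
    (Units.continuous_val.matrix_det.inv₀ fun A => (Matrix.isUnits_det_units A).ne_zero).congr
      fun A => by simp⟩

/-- A loop in `U(q)` whose determinant has degree `0` is null-homotopic. -/
theorem homotopic_refl_of_hasDegree_zero {q : ℕ} (hq : 0 < q) {γ : Path (1 : U q) 1}
    (h : HasDegree (piDet q (pathClass γ)) 0) : γ.Homotopic (Path.refl 1) := by
  obtain ⟨θ, hθ, hθ0, hθ1⟩ := hasDegree_piDet_iff.1 h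
  -- Since θ(0) = θ(1) = 0, the logarithm descends to the circle along with γ. The argument is then
  -- carried out with free loops in GL.
  obtain ⟨g', hg', hgγ⟩ := exists_descent (Z := Unit) (f := fun p => γ p.1) (by fun_prop) (by simp)
  obtain ⟨ϑ', hϑ', hϑθ⟩ := exists_descent (Z := Unit) (f := fun p => θ p.1) (by fun_prop)
    (by simp [hθ0, hθ1])
  let g : C(UnitAddCircle, U q) := ⟨fun x => g' (x, ()), by fun_prop⟩
  let ϑ : C(UnitAddCircle, ℝ) := ⟨fun x => ϑ' (x, ()), by fun_prop⟩
  let det : C(GL (Fin q) ℂ, ℂˣ) := ⟨_, continuous_det_gl q⟩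
  let i₀ : Fin q := ⟨0, hq⟩
  obtain ⟨c, hc⟩ := exists_homotopic_singleMap i₀ ((inclGL q).comp g)
  have hdet : det.comp (singleMap i₀ c) = c := by
    ext x
    change (diagHom _ (Pi.mulSingle i₀ (c x)) : Matrix (Fin q) (Fin q) ℂ).det = _
    rw [diagHom_val, Matrix.det_diagonal, Finset.prod_eq_single i₀ _ (by simp)]
    · simp
    · intro i _ hi
      simp [hi]
  -- Scaling the periodic logarithm ϑ to zero contracts the determinant. As det of `singleMap i₀ c`
  -- is c, it follows that c, and with it the original loop, is freely null-homotopic.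
  have hdet' : (det.comp ((inclGL q).comp g)).Homotopic 1 := by
    refine ⟨{ toFun := fun p => Units.mk0 (expTwoPiI (((1 - (p.1 : ℝ)) * ϑ p.2 : ℝ)))
                (expTwoPiI_ne_zero _)
              continuous_toFun := ?_
              map_zero_left := fun x => ?_
              map_one_left := fun x => ?_ }⟩
    · have : Continuous fun p : I × UnitAddCircle =>
          expTwoPiI (((1 - (p.1 : ℝ)) * ϑ p.2 : ℝ)) :=
        continuous_expTwoPiI.comp (by fun_prop)
      exact Units.continuous_iff.2 ⟨this, this.inv₀ fun _ => expTwoPiI_ne_zero _⟩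
    · obtain ⟨t, rfl⟩ := toCircle_surjective x
      refine Units.ext ?_
      change expTwoPiI (((1 - ((0 : I) : ℝ)) * ϑ' (toCircle t, ()) : ℝ)) =
        (g' (toCircle t, ()) : Matrix (Fin q) (Fin q) ℂ).det
      rw [hϑθ, hgγ, ← hθ]
      simp
    · refine Units.ext ?_
      simp [expTwoPiI_zero]
  have hc1 : c.Homotopic 1 := by
    rw [← hdet]
    exact ((ContinuousMap.Homotopic.comp (.refl det) hc).symm).trans hdet'
  have hs1 : (singleMap i₀ c).Homotopic 1 := by
    have := ContinuousMap.Homotopic.comp (.refl (singleMap i₀ (.id ℂˣ))) hc1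
    have e : (singleMap i₀ (.id ℂˣ)).comp (1 : C(UnitAddCircle, ℂˣ)) = 1 := by
      ext1 x
      change diagHom (Fin q) (Pi.mulSingle i₀ 1) = 1
      simp
    rwa [e] at this
  obtain ⟨H⟩ := hc.trans hs1
  obtain ⟨r, hr⟩ := exists_retraction q
  -- The homotopy is retracted to U(q) and translated by the inverse of its value at the base point,
  -- which turns a free homotopy into one fixing the endpoints.
  let K : C(I × I, U q) := ⟨fun p => (r (H (p.1, 0)))⁻¹ * r (H (p.1, toCircle p.2)), by fun_prop⟩
  have hK : ∀ s t, K (s, t) = (r (H (s, 0)))⁻¹ * r (H (s, toCircle t)) := fun s t => rfl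
  have hg : ∀ t, g (toCircle t) = γ t := fun t => hgγ t ()
  have hg0 : g 0 = 1 := by rw [← toCircle_zero, hg, γ.source]
  have h0 : ∀ x, r (H (0, x)) = g x := fun x => by
    rw [H.apply_zero]; exact hr _
  have h1 : ∀ x, r (H (1, x)) = 1 := fun x => by
    rw [H.apply_one]
    have : (1 : C(UnitAddCircle, GL (Fin q) ℂ)) x = inclGL q 1 := Units.ext rfl
    rw [this, hr]
  refine ⟨{ toContinuousMap := K, map_zero_left := fun t => ?_, map_one_left := fun t => ?_,
            prop' := fun s t ht => ?_ }⟩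
  · change K (0, t) = γ t
    rw [hK, h0, h0, hg0, hg, inv_one, one_mul]
  · change K (1, t) = 1
    rw [hK, h1, h1, inv_one, one_mul]
  · change K (s, t) = γ t
    rcases ht with rfl | rfl
    · rw [hK, toCircle_zero, inv_mul_cancel, γ.source]
    · rw [hK, toCircle_one, inv_mul_cancel, γ.target]

/-- The path of unitary matrices `diag(e^{2πi n t}, 1, …, 1)`. -/
theorem exists_loop_of_degree {q : ℕ} (hq : 0 < q) (n : ℤ) :
    ∃ γ : Path (1 : U q) 1, HasDegree (piDet q (pathClass γ)) n := by
  let i₀ : Fin q := ⟨0, hq⟩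
  let d : I → Fin q → ℂ := fun t => Function.update 1 i₀ (expTwoPiI ((n * (t : ℝ) : ℝ)))
  have hd : Continuous d := by
    refine continuous_const.update i₀ (continuous_expTwoPiI.comp ?_)
    fun_prop
  have hu : ∀ t, Matrix.diagonal (d t) ∈ Matrix.unitaryGroup (Fin q) ℂ := fun t => by
    rw [Matrix.mem_unitaryGroup_iff, Matrix.star_eq_conjTranspose, Matrix.diagonal_conjTranspose,
      Matrix.diagonal_mul_diagonal, ← Matrix.diagonal_one]
    congr 1
    ext i
    by_cases h : i = i₀
    · subst h
      simp only [d, Function.update_self, Pi.star_apply, ← circleExp_coe]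
      rw [RCLike.star_def, ← Circle.coe_inv_eq_conj, ← Circle.coe_mul, mul_inv_cancel,
        Circle.coe_one]
    · simp [d, h]
  refine ⟨⟨⟨fun t => ⟨_, hu t⟩, (hd.matrix_diagonal).subtype_mk _⟩, Subtype.ext ?_,
    Subtype.ext ?_⟩, hasDegree_piDet_iff.2 ⟨⟨fun t => n * (t : ℝ), by fun_prop⟩, fun t => ?_, ?_, ?_⟩⟩
  · simp [d, expTwoPiI_zero]
  · have : expTwoPiI n = 1 := expTwoPiI_int n
    simp [d, this]
  · change _ = (Matrix.diagonal (d t)).det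
    rw [Matrix.det_diagonal, Finset.prod_update_of_mem (Finset.mem_univ _)]
    simp
  · simp
  · simp

/-- `π₁(U(q)) ≅ ℤ` through the degree of the determinant. -/
theorem exists_degreeEquiv {q : ℕ} (hq : 0 < q) :
    ∃ δ : FundamentalGroup (U q) 1 ≃* Multiplicative ℤ,
      ∀ c n, δ c = Multiplicative.ofAdd n ↔ HasDegree (piDet q c) n :=
  exists_mulEquiv_of_rel (fun c (n : Multiplicative ℤ) => HasDegree (piDet q c) n.toAdd)
    (fun c => (exists_hasDegree (piDet q c)))
    (fun _ _ _ h h' => hasDegree_unique h h')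
    (fun c d m n h h' => by
      rw [map_mul]
      exact h.mul h')
    (fun c h => by
      obtain ⟨γ, rfl⟩ := pathClass_surjective c
      exact pathClass_eq.2 (homotopic_refl_of_hasDegree_zero hq h))
    (fun n => by
      obtain ⟨γ, hγ⟩ := exists_loop_of_degree hq n.toAdd
      exact ⟨_, hγ⟩)

/-! ### The covering `SU(q) → PU(q)` -/

instance SU.isTopologicalGroup (q : ℕ) : IsTopologicalGroup (SU q) where
  continuous_inv := by
    refine Continuous.subtype_mk (f := fun u : SU q => star (u : Matrix (Fin q) (Fin q) ℂ)) ?_ _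
    exact continuous_subtype_val.star

instance SU.compactSpace (q : ℕ) : CompactSpace (SU q) := by
  refine isCompact_iff_compactSpace.1 ?_
  have hK : IsCompact (Set.univ.pi fun _ => Set.univ.pi fun _ => Metric.closedBall 0 1 :
      Set (Fin q → Fin q → ℂ)) :=
    isCompact_univ_pi fun _ => isCompact_univ_pi fun _ => isCompact_closedBall 0 1
  refine IsCompact.of_isClosed_subset (X := Matrix (Fin q) (Fin q) ℂ) hK ?_ fun u hu i _ j _ => ?_
  · have : (Matrix.specialUnitaryGroup (Fin q) ℂ : Set (Matrix (Fin q) (Fin q) ℂ)) =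
        {u | u * star u = 1} ∩ {u | u.det = 1} := by
      ext u
      simp [Matrix.mem_specialUnitaryGroup_iff, Matrix.mem_unitaryGroup_iff]
    rw [this]
    exact (isClosed_eq (continuous_id.mul continuous_id.star) continuous_const).inter
      (isClosed_eq continuous_id.matrix_det continuous_const)
  · rw [mem_closedBall_zero_iff]
    exact entry_norm_bound_of_unitary (Matrix.specialUnitaryGroup_le_unitaryGroup hu) i j

theorem SU.continuous_toU (q : ℕ) : Continuous (SU.toU q) :=
  continuous_subtype_val.subtype_mk _

theorem SU.det_eq {q : ℕ} (u : SU q) : (u : Matrix (Fin q) (Fin q) ℂ).det = 1 :=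
  (Matrix.mem_specialUnitaryGroup_iff.1 u.2).2

theorem proj_mul {q : ℕ} (u v : U q) : proj q (u * v) = proj q u * proj q v := rfl

theorem proj_one (q : ℕ) : proj q 1 = 1 := rfl

theorem proj_surjective (q : ℕ) : Function.Surjective (proj q) := QuotientGroup.mk_surjective

theorem proj_eq_iff {q : ℕ} {u v : U q} : proj q u = proj q v ↔
    ∃ z : Circle, (v : Matrix (Fin q) (Fin q) ℂ) = (z : ℂ) • (u : Matrix (Fin q) (Fin q) ℂ) := by
  refine QuotientGroup.eq.trans (exists_congr fun z => ?_)
  have h1 : (u : Matrix (Fin q) (Fin q) ℂ) * ((u⁻¹ * v : U q) : Matrix (Fin q) (Fin q) ℂ) = v := by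
    rw [← Matrix.UnitaryGroup.mul_val, mul_inv_cancel_left]
  have h2 : ((u⁻¹ : U q) : Matrix (Fin q) (Fin q) ℂ) * u = 1 := by
    rw [← Matrix.UnitaryGroup.mul_val, inv_mul_cancel, Matrix.UnitaryGroup.one_val]
  constructor <;> intro h
  · rw [← h1, h, Matrix.mul_smul, Matrix.mul_one]
  · rw [Matrix.UnitaryGroup.mul_val, h, Matrix.mul_smul, h2]

theorem isClosed_scalarCircle (q : ℕ) : IsClosed (scalarCircle q : Set (U q)) := by
  have hc : IsCompact (Set.range fun z : Circle => (z : ℂ) • (1 : Matrix (Fin q) (Fin q) ℂ)) :=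
    isCompact_range (by fun_prop)
  have : (scalarCircle q : Set (U q)) = (Subtype.val : U q → Matrix (Fin q) (Fin q) ℂ) ⁻¹'
      (Set.range fun z : Circle => (z : ℂ) • (1 : Matrix (Fin q) (Fin q) ℂ)) := by
    ext u
    exact exists_congr fun z => eq_comm
  rw [this]
  exact hc.isClosed.preimage continuous_subtype_val

/-- The projection `SU(q) → PU(q)`. -/
def suProj (q : ℕ) : SU q →* PU q := (QuotientGroup.mk' (scalarCircle q)).comp (SU.toU q)

theorem suProj_apply {q : ℕ} (u : SU q) : suProj q u = proj q (SU.toU q u) := rfl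

theorem continuous_suProj (q : ℕ) : Continuous (suProj q) :=
  (proj q).continuous.comp (SU.continuous_toU q)

theorem norm_expTwoPiI_ofReal (x : ℝ) : ‖expTwoPiI x‖ = 1 := by
  rw [← circleExp_coe, Circle.norm_coe]

/-- Normalizing the determinant of a unitary matrix. -/
theorem smul_mem_specialUnitaryGroup {q : ℕ} (hq : 0 < q) {u : Matrix (Fin q) (Fin q) ℂ}
    (hu : u ∈ Matrix.unitaryGroup (Fin q) ℂ) {x : ℝ} (hx : expTwoPiI x = u.det) :
    expTwoPiI ((-x / q : ℝ)) • u ∈ Matrix.specialUnitaryGroup (Fin q) ℂ := by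
  refine Matrix.mem_specialUnitaryGroup_iff.2 ⟨?_, ?_⟩
  · rw [Matrix.mem_unitaryGroup_iff, star_smul, Matrix.smul_mul, Matrix.mul_smul, smul_smul,
      Matrix.mem_unitaryGroup_iff.1 hu, Complex.star_def, Complex.mul_conj,
      Complex.normSq_eq_norm_sq, norm_expTwoPiI_ofReal]
    simp
  · rw [Matrix.det_smul, Fintype.card_fin, ← hx]
    push_cast
    rw [expTwoPiI_div_pow hq, expTwoPiI_neg, inv_mul_cancel₀ (expTwoPiI_ne_zero _)]

theorem suProj_surjective {q : ℕ} (hq : 0 < q) : Function.Surjective (suProj q) := fun c => by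
  obtain ⟨u, rfl⟩ := proj_surjective q c
  have h1 : ‖(u : Matrix (Fin q) (Fin q) ℂ).det‖ = 1 :=
    CStarRing.norm_of_mem_unitary (Matrix.det_of_mem_unitary u.2)
  have hx : expTwoPiI ((Complex.arg (u : Matrix (Fin q) (Fin q) ℂ).det / (2 * Real.pi) : ℝ)) =
      (u : Matrix (Fin q) (Fin q) ℂ).det := by
    have := Complex.norm_mul_exp_arg_mul_I (u : Matrix (Fin q) (Fin q) ℂ).det
    rw [h1, Complex.ofReal_one, one_mul] at this
    rw [expTwoPiI]
    conv_rhs => rw [← this]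
    congr 1
    have := Real.pi_ne_zero
    push_cast
    field_simp
  refine ⟨⟨_, smul_mem_specialUnitaryGroup hq u.2 hx⟩, ?_⟩
  rw [suProj_apply, eq_comm, proj_eq_iff]
  exact ⟨_, congrArg (· • (u : Matrix (Fin q) (Fin q) ℂ)) (circleExp_coe _).symm⟩

/-- Scalar matrices of determinant `1` are given by roots of unity. -/
theorem exists_rootsOfUnity_of_scalar {q : ℕ} {u : SU q} {z : ℂ}
    (h : (u : Matrix (Fin q) (Fin q) ℂ) = z • 1) : z ^ q = 1 := by
  have := SU.det_eq u
  rwa [h, Matrix.det_smul, Matrix.det_one, mul_one, Fintype.card_fin] at this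

theorem exists_scalar_of_suProj_eq_one {q : ℕ} (hq : 0 < q) {u : SU q} (h : suProj q u = 1) :
    ∃ ζ : rootsOfUnity q ℂ, (u : Matrix (Fin q) (Fin q) ℂ) = ((ζ : ℂˣ) : ℂ) • 1 := by
  rw [suProj_apply, ← proj_one, eq_comm, proj_eq_iff] at h
  obtain ⟨z, hz⟩ := h
  have hz' : (u : Matrix (Fin q) (Fin q) ℂ) = (z : ℂ) • 1 := hz
  have := NeZero.of_pos hq
  exact ⟨rootsOfUnity.mkOfPowEq (z : ℂ) (exists_rootsOfUnity_of_scalar hz'), by simpa using hz'⟩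

/-- The scalar circle is closed, so PU(q) is Hausdorff and the surjection from the compact SU(q) is
a quotient map. Its kernel consists of scalar q-th roots of unity, hence is finite and discrete. -/
theorem isCoveringMap_suProj {q : ℕ} (hq : 0 < q) : IsCoveringMap (suProj q) := by
  have := isClosed_scalarCircle q
  have hcl : IsClosedMap (suProj q) := (continuous_suProj q).isClosedMap
  have hquot := hcl.isQuotientMap (continuous_suProj q) (suProj_surjective hq)
  refine (hquot.isQuotientCoveringMap_of_isDiscrete_ker_monoidHom ?_).isCoveringMap
  have := NeZero.of_pos hq
  have hfin : ((suProj q).ker : Set (SU q)).Finite := by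
    refine Set.Finite.of_finite_image (f := Subtype.val) (Set.Finite.subset
      (Set.finite_range fun ζ : rootsOfUnity q ℂ =>
        ((ζ : ℂˣ) : ℂ) • (1 : Matrix (Fin q) (Fin q) ℂ)) ?_) Subtype.val_injective.injOn
    rintro _ ⟨u, hu, rfl⟩
    obtain ⟨ζ, hζ⟩ := exists_scalar_of_suProj_eq_one hq hu
    exact ⟨ζ, hζ.symm⟩
  exact hfin.isDiscrete

/-! ### `π₁(PU(q))` -/

theorem scalar_injective {q : ℕ} (hq : 0 < q) {z w : ℂ}
    (h : z • (1 : Matrix (Fin q) (Fin q) ℂ) = w • 1) : z = w := by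
  simpa using congrFun (congrFun h ⟨0, hq⟩) ⟨0, hq⟩

/-- As for the degree, uniqueness of the endpoint of a lift frees the relation from the choice of a
representative. -/
theorem hasBoundary_pathClass_iff {q : ℕ} (hq : 0 < q) {γ : Path (1 : PU q) 1}
    {ζ : rootsOfUnity q ℂ} : HasBoundary (pathClass γ) ζ ↔ ∃ Γ : C(I, SU q),
      (∀ s, suProj q (Γ s) = γ s) ∧ Γ 0 = 1 ∧
        (Γ 1 : Matrix (Fin q) (Fin q) ℂ) = ((ζ : ℂˣ) : ℂ) • 1 := by
  refine ⟨?_, fun ⟨Γ, h, h0, h1⟩ => ⟨γ, Γ, rfl, h, h0, h1⟩⟩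
  rintro ⟨γ', Γ', hc, h, h0, h1⟩
  have cov := isCoveringMap_suProj hq
  obtain ⟨Γ, hΓ, hΓ0⟩ := cov.exists_path_lifts (γ : C(I, PU q)) 1 (by simp)
  refine ⟨Γ, congrFun hΓ, hΓ0, ?_⟩
  rw [lift_end_eq cov (pathClass_eq.1 hc) (congrFun hΓ) h (hΓ0.trans h0.symm), h1]

theorem exists_hasBoundary {q : ℕ} (hq : 0 < q) (c : FundamentalGroup (PU q) 1) :
    ∃ ζ, HasBoundary c ζ := by
  obtain ⟨γ, rfl⟩ := pathClass_surjective c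
  obtain ⟨Γ, hΓ, hΓ0⟩ := (isCoveringMap_suProj hq).exists_path_lifts (γ : C(I, PU q)) 1 (by simp)
  obtain ⟨ζ, hζ⟩ := exists_scalar_of_suProj_eq_one hq
    ((congrFun hΓ 1).trans γ.target)
  exact ⟨ζ, γ, Γ, rfl, congrFun hΓ, hΓ0, hζ⟩

theorem hasBoundary_unique {q : ℕ} (hq : 0 < q) {c : FundamentalGroup (PU q) 1}
    {ζ ζ' : rootsOfUnity q ℂ} (h : HasBoundary c ζ) (h' : HasBoundary c ζ') : ζ = ζ' := by
  obtain ⟨γ, rfl⟩ := pathClass_surjective c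
  obtain ⟨Γ, hΓ, hΓ0, hΓ1⟩ := (hasBoundary_pathClass_iff hq).1 h
  obtain ⟨Γ', hΓ', hΓ0', hΓ1'⟩ := (hasBoundary_pathClass_iff hq).1 h'
  have := lift_end_eq (isCoveringMap_suProj hq) (.refl γ) hΓ hΓ' (hΓ0.trans hΓ0'.symm)
  rw [this, hΓ1'] at hΓ1
  exact Subtype.ext (Units.ext (scalar_injective hq hΓ1.symm))

/-- The endpoint of the lift of γ' projects to 1, so the left translate of the lift of γ by it still
lifts γ and can be appended. -/
theorem HasBoundary.mul {q : ℕ} (hq : 0 < q) {c d : FundamentalGroup (PU q) 1}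
    {ζ ξ : rootsOfUnity q ℂ} (hc : HasBoundary c ζ) (hd : HasBoundary d ξ) :
    HasBoundary (c * d) (ζ * ξ) := by
  obtain ⟨γ, rfl⟩ := pathClass_surjective c
  obtain ⟨γ', rfl⟩ := pathClass_surjective d
  obtain ⟨Γ, h, h0, h1⟩ := (hasBoundary_pathClass_iff hq).1 hc
  obtain ⟨Γ', h', h0', h1'⟩ := (hasBoundary_pathClass_iff hq).1 hd
  rw [pathClass_mul, hasBoundary_pathClass_iff hq]
  let P' : Path (1 : SU q) (Γ' 1) := ⟨Γ', h0', rfl⟩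
  let P : Path (Γ' 1) (Γ' 1 * Γ 1) := ⟨⟨fun s => Γ' 1 * Γ s, by fun_prop⟩, by simp [h0], rfl⟩
  refine ⟨(P'.trans P).toContinuousMap, lift_trans h' fun s => ?_, (P'.trans P).source, ?_⟩
  · change suProj q (Γ' 1 * Γ s) = γ s
    rw [map_mul, h, h', γ'.target, one_mul]
  · rw [show (P'.trans P).toContinuousMap 1 = Γ' 1 * Γ 1 from (P'.trans P).target]
    change (Γ' 1 : Matrix (Fin q) (Fin q) ℂ) * (Γ 1 : Matrix (Fin q) (Fin q) ℂ) = _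
    rw [h1, h1', Matrix.smul_mul, Matrix.one_mul, smul_smul, mul_comm]
    rfl

/-- The root of unity `e^{-2πin/q}`. -/
def zetaRoot {q : ℕ} (hq : 0 < q) (n : ℤ) : rootsOfUnity q ℂ :=
  have := NeZero.of_pos hq
  rootsOfUnity.mkOfPowEq (expTwoPiI (-n / q)) (by
    rw [expTwoPiI_div_pow hq, ← Int.cast_neg, expTwoPiI_int])

theorem zetaRoot_val {q : ℕ} (hq : 0 < q) (n : ℤ) :
    ((zetaRoot hq n : ℂˣ) : ℂ) = expTwoPiI (-n / q) := rfl

theorem zetaRoot_surjective {q : ℕ} (hq : 0 < q) : Function.Surjective (zetaRoot hq) := fun ζ => by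
  have hne : NeZero q := NeZero.of_pos hq
  obtain ⟨w, hw⟩ := expTwoPiI_surj (ζ : ℂˣ).ne_zero
  have h1 : expTwoPiI (q * w) = 1 := by
    rw [expTwoPiI_nat_mul, hw]
    have := (mem_rootsOfUnity q (ζ : ℂˣ)).1 ζ.2
    simpa using congrArg Units.val this
  obtain ⟨n, hn⟩ := expTwoPiI_eq_one_iff.1 h1
  -- Here q w = n, and the minus sign compensates the one in `zetaRoot`.
  refine ⟨-n, Subtype.ext (Units.ext ?_)⟩
  rw [zetaRoot_val, ← hw]
  congr 1
  have : (q : ℂ) ≠ 0 := by exact_mod_cast hq.ne'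
  field_simp
  push_cast
  linear_combination -hn

/-- The image in `PU(q)` of a loop in `U(q)`. -/
def projPath {q : ℕ} (γ : Path (1 : U q) 1) : Path (1 : PU q) 1 :=
  (γ.map (proj q).continuous).cast (proj_one q).symm (proj_one q).symm

theorem piProj_pathClass {q : ℕ} (γ : Path (1 : U q) 1) :
    piProj q (pathClass γ) = pathClass (projPath γ) :=
  mapOfEq_pathClass _ _ γ

/-- The homomorphism `π₁(U(q)) → π₁(PU(q))` in terms of degree and boundary. -/
theorem HasDegree.hasBoundary {q : ℕ} (hq : 0 < q) {c : FundamentalGroup (U q) 1} {n : ℤ}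
    (h : HasDegree (piDet q c) n) : HasBoundary (piProj q c) (zetaRoot hq n) := by
  obtain ⟨γ, rfl⟩ := pathClass_surjective c
  obtain ⟨θ, hθ, h0, h1⟩ := hasDegree_piDet_iff.1 h
  rw [piProj_pathClass, hasBoundary_pathClass_iff hq]
  -- The factor e^{-2πiθ/q} brings the determinant to 1 without changing the class in PU(q). Its
  -- value at the end, where θ = n, is the root of unity e^{-2πin/q}.
  have hc : Continuous fun s => expTwoPiI ((-θ s / q : ℝ)) • (γ s : Matrix (Fin q) (Fin q) ℂ) :=
    (continuous_expTwoPiI.comp (by fun_prop)).smul (continuous_subtype_val.comp γ.continuous)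
  refine ⟨⟨fun s => ⟨_, smul_mem_specialUnitaryGroup hq (γ s).2 (hθ s)⟩, hc.subtype_mk _⟩,
    fun s => ?_, Subtype.ext ?_, ?_⟩
  · change _ = proj q (γ s)
    rw [suProj_apply, eq_comm, proj_eq_iff]
    exact ⟨_, congrArg (· • (γ s : Matrix (Fin q) (Fin q) ℂ)) (circleExp_coe _).symm⟩
  · simp [h0, expTwoPiI_zero]
  · simp [h1, zetaRoot_val]

/-- A loop in `PU(q)` whose lift to `SU(q)` closes up is null-homotopic. -/
theorem eq_one_of_hasBoundary_one {q : ℕ} (hq : 0 < q) {c : FundamentalGroup (PU q) 1}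
    (h : HasBoundary c 1) : c = 1 := by
  obtain ⟨γ, rfl⟩ := pathClass_surjective c
  obtain ⟨Γ, hΓ, h0, h1⟩ := (hasBoundary_pathClass_iff hq).1 h
  have h11 : Γ 1 = 1 := Subtype.ext (by simpa using h1)
  -- The lift closes up to a loop in U(q) of constant determinant 1, hence of degree 0.
  let γU : Path (1 : U q) 1 := ⟨⟨fun s => SU.toU q (Γ s), (SU.continuous_toU q).comp Γ.continuous⟩,
    by simp [h0], by simp [h11]⟩
  have hγ : γ = projPath γU := by
    ext s
    exact (hΓ s).symm
  have hd : HasDegree (piDet q (pathClass γU)) 0 := hasDegree_piDet_iff.2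
    ⟨0, fun s => by
      change expTwoPiI ((0 : ℝ) : ℂ) = (Γ s : Matrix (Fin q) (Fin q) ℂ).det
      rw [SU.det_eq, Complex.ofReal_zero, expTwoPiI_zero], rfl, by simp⟩
  rw [hγ, ← piProj_pathClass, pathClass_eq.2 (homotopic_refl_of_hasDegree_zero hq hd)]
  exact map_one (piProj q)

/-- `π₁(PU(q)) ≅ μ_q` through the connecting map. -/
theorem exists_boundaryEquiv {q : ℕ} (hq : 0 < q) :
    ∃ β : FundamentalGroup (PU q) 1 ≃* rootsOfUnity q ℂ, ∀ c ζ, β c = ζ ↔ HasBoundary c ζ :=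
  exists_mulEquiv_of_rel HasBoundary (exists_hasBoundary hq)
    (fun _ _ _ h h' => hasBoundary_unique hq h h') (fun _ _ _ _ h h' => h.mul hq h')
    (fun _ h => eq_one_of_hasBoundary_one hq h)
    (fun ζ => by
      obtain ⟨n, rfl⟩ := zetaRoot_surjective hq ζ
      obtain ⟨γ, hγ⟩ := exists_loop_of_degree hq n
      exact ⟨_, hγ.hasBoundary hq⟩)

/-! ### Frames of a vector bundle along a map -/

theorem continuousAt_matrix_inv {q : ℕ} {A : Matrix (Fin q) (Fin q) ℂ} (h : A.det ≠ 0) :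
    ContinuousAt (fun M : Matrix (Fin q) (Fin q) ℂ => M⁻¹) A := by
  simp only [Matrix.inv_def, Ring.inverse_eq_inv']
  exact ((continuous_id.matrix_det.continuousAt).inv₀ h).smul
    continuous_id.matrix_adjugate.continuousAt

theorem continuous_mulVec (q : ℕ) :
    Continuous fun y : Matrix (Fin q) (Fin q) ℂ × (Fin q → ℂ) => y.1 *ᵥ y.2 :=
  continuous_fst.matrix_mulVec continuous_snd

theorem continuousWithinAt_inv_mulVec {q : ℕ} {X : Type*} [TopologicalSpace X] {S : Set X} {x₀ : X}
    {A : X → Matrix (Fin q) (Fin q) ℂ} {y : X → Fin q → ℂ} (hA : ContinuousWithinAt A S x₀)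
    (hy : ContinuousWithinAt y S x₀) (hd : (A x₀).det ≠ 0) :
    ContinuousWithinAt (fun x => (A x)⁻¹ *ᵥ y x) S x₀ := by
  have h1 : ContinuousWithinAt (fun x => (A x)⁻¹) S x₀ :=
    (continuousAt_matrix_inv hd).comp_continuousWithinAt hA
  exact (continuous_mulVec q).continuousAt.comp_continuousWithinAt
    (f := fun x => ((A x)⁻¹, y x)) (h1.prodMk hy)

section Frames

variable {q : ℕ} {B : Type*} {E : B → Type*} [∀ x, AddCommGroup (E x)]
  [∀ x, Module ℂ (E x)] [TopologicalSpace (Bundle.TotalSpace (Fin q → ℂ) E)]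

/-- `F` is a continuous frame, over the set `S`, of the pull back of the bundle along `p`. -/
structure FrameOn {X : Type*} [TopologicalSpace X] (p : X → B)
    (F : X → (Fin q → ℂ) → Bundle.TotalSpace (Fin q → ℂ) E) (S : Set X) : Prop where
  exists_equiv : ∀ x ∈ S, ∃ L : (Fin q → ℂ) ≃ₗ[ℂ] E (p x), ∀ w,
    F x w = Bundle.TotalSpace.mk' (Fin q → ℂ) (p x) (L w)
  continuousOn : ContinuousOn (fun y : X × (Fin q → ℂ) => F y.1 y.2) (S ×ˢ Set.univ)

variable {X Y : Type*} [TopologicalSpace X] [TopologicalSpace Y] {p : X → B}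
  {F F' : X → (Fin q → ℂ) → Bundle.TotalSpace (Fin q → ℂ) E} {S T : Set X}

theorem FrameOn.continuous (hF : FrameOn p F Set.univ) :
    Continuous fun y : X × (Fin q → ℂ) => F y.1 y.2 := by
  simpa [continuousOn_univ] using hF.continuousOn

theorem FrameOn.mono (hF : FrameOn p F S) (h : T ⊆ S) : FrameOn p F T :=
  ⟨fun x hx => hF.exists_equiv x (h hx), hF.continuousOn.mono (Set.prod_mono h le_rfl)⟩

theorem FrameOn.congr (hF : FrameOn p F S) (h : ∀ x ∈ S, F' x = F x) : FrameOn p F' S :=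
  ⟨fun x hx => by rw [h x hx]; exact hF.exists_equiv x hx,
    hF.continuousOn.congr fun y hy => by rw [h y.1 hy.1]⟩

theorem FrameOn.comp (hF : FrameOn p F S) {f : Y → X} {T : Set Y} (hf : ContinuousOn f T)
    (h : Set.MapsTo f T S) : FrameOn (p ∘ f) (F ∘ f) T :=
  ⟨fun y hy => hF.exists_equiv (f y) (h hy),
    hF.continuousOn.comp (f := fun z : Y × (Fin q → ℂ) => (f z.1, z.2))
      ((hf.comp continuousOn_fst fun _ hz => hz.1).prodMk continuousOn_snd)
      fun _ hz => ⟨h hz.1, trivial⟩⟩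

theorem FrameOn.congr_base (hF : FrameOn p F S) {p' : X → B} (h : ∀ x ∈ S, p' x = p x) :
    FrameOn p' F S :=
  ⟨fun x hx => by rw [h x hx]; exact hF.exists_equiv x hx, hF.continuousOn⟩

theorem FrameOn.proj_eq (hF : FrameOn p F S) {x : X} (hx : x ∈ S) (w : Fin q → ℂ) :
    (F x w).proj = p x := by
  obtain ⟨L, hL⟩ := hF.exists_equiv x hx
  rw [hL]

theorem FrameOn.injective (hF : FrameOn p F S) {x : X} (hx : x ∈ S) :
    Function.Injective (F x) := by
  obtain ⟨L, hL⟩ := hF.exists_equiv x hx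
  intro w w' h
  rw [hL, hL] at h
  exact L.injective (Bundle.TotalSpace.mk_injective _ h)

theorem matrix_det_ne_zero_mulVec {A : Matrix (Fin q) (Fin q) ℂ} (h : A.det ≠ 0) :
    ∃ L : (Fin q → ℂ) ≃ₗ[ℂ] (Fin q → ℂ), ∀ w, L w = A *ᵥ w :=
  ⟨Matrix.toLinearEquiv' A (A.invertibleOfIsUnitDet h.isUnit), fun _ => rfl⟩

theorem FrameOn.mul (hF : FrameOn p F S) {h : X → Matrix (Fin q) (Fin q) ℂ}
    (hh : ContinuousOn h S) (hd : ∀ x ∈ S, (h x).det ≠ 0) :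
    FrameOn p (fun x w => F x (h x *ᵥ w)) S := by
  refine ⟨fun x hx => ?_, ?_⟩
  · obtain ⟨L, hL⟩ := hF.exists_equiv x hx
    obtain ⟨M, hM⟩ := matrix_det_ne_zero_mulVec (hd x hx)
    exact ⟨M.trans L, fun w => by rw [hL, LinearEquiv.trans_apply, hM]⟩
  · refine hF.continuousOn.comp (f := fun z : X × (Fin q → ℂ) => (z.1, h z.1 *ᵥ z.2)) ?_
      fun z hz => ⟨hz.1, trivial⟩
    refine continuousOn_fst.prodMk ?_
    have h1 : ContinuousOn (fun z : X × (Fin q → ℂ) => (h z.1, z.2)) (S ×ˢ Set.univ) :=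
      (hh.comp continuousOn_fst fun _ hz => hz.1).prodMk continuousOn_snd
    exact (continuous_mulVec q).comp_continuousOn h1

theorem FrameOn.union (hS : FrameOn p F S) (hT : FrameOn p F T) (cS : IsClosed S)
    (cT : IsClosed T) : FrameOn p F (S ∪ T) := by
  refine ⟨fun x hx => hx.elim (hS.exists_equiv x) (hT.exists_equiv x), ?_⟩
  rw [Set.union_prod]
  exact hS.continuousOn.union_of_isClosed hT.continuousOn (cS.prod isClosed_univ)
    (cT.prod isClosed_univ)

/-- The matrix of a linear automorphism. -/
theorem matrix_of_linearEquiv (M : (Fin q → ℂ) ≃ₗ[ℂ] (Fin q → ℂ)) :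
    (Matrix.of fun i j => M (Pi.single j 1) i).det ≠ 0 ∧
      ∀ w, (Matrix.of fun i j => M (Pi.single j 1) i) *ᵥ w = M w := by
  have hM : (Matrix.of fun i j => M (Pi.single j 1) i) =
      LinearMap.toMatrix' (M : (Fin q → ℂ) →ₗ[ℂ] (Fin q → ℂ)) := by
    ext i j
    rw [LinearMap.toMatrix'_apply]
    rfl
  rw [hM]
  refine ⟨?_, fun w => ?_⟩
  · rw [LinearMap.det_toMatrix']
    exact (LinearEquiv.isUnit_det' M).ne_zero
  · rw [← Matrix.toLin'_apply, Matrix.toLin'_toMatrix']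
    rfl

/-- A frame read in a trivialization. -/
theorem FrameOn.trivialization_matrix [TopologicalSpace B] (hF : FrameOn p F S)
    (e : Bundle.Trivialization (Fin q → ℂ) (Bundle.TotalSpace.proj (F := Fin q → ℂ) (E := E)))
    [e.IsLinear ℂ] {x : X} (hx : x ∈ S) (hb : p x ∈ e.baseSet) :
    (Matrix.of fun i j => (e (F x (Pi.single j 1))).2 i).det ≠ 0 ∧
      ∀ w, (Matrix.of fun i j => (e (F x (Pi.single j 1))).2 i) *ᵥ w = (e (F x w)).2 := by
  obtain ⟨L, hL⟩ := hF.exists_equiv x hx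
  have hM : ∀ w, (e (F x w)).2 = (L.trans (e.linearEquivAt ℂ (p x) hb)) w := fun w => by
    rw [hL]; rfl
  simp only [hM]
  exact matrix_of_linearEquiv _

/-! ### Transition matrices, extension of frames, and triviality over the plane -/

section VectorBundle

variable [TopologicalSpace B] [∀ x, TopologicalSpace (E x)] [FiberBundle (Fin q → ℂ) E] [VectorBundle ℂ (Fin q → ℂ) E]

/-- The coordinates of a continuous section with respect to a continuous frame are continuous. -/
theorem FrameOn.exists_coords (hF : FrameOn p F S)
    {s : X → Bundle.TotalSpace (Fin q → ℂ) E} (hs : ContinuousOn s S)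
    (hp : ∀ x ∈ S, (s x).proj = p x) :
    ∃ c : X → Fin q → ℂ, ContinuousOn c S ∧ ∀ x ∈ S, F x (c x) = s x := by
  have hex : ∀ x, ∃ c : Fin q → ℂ, x ∈ S → F x c = s x := fun x => by
    by_cases hx : x ∈ S
    · obtain ⟨L, hL⟩ := hF.exists_equiv x hx
      have hpx := hp x hx
      revert hpx
      obtain ⟨b, v⟩ := s x
      rintro rfl
      exact ⟨L.symm v, fun _ => by rw [hL, L.apply_symm_apply]⟩
    · exact ⟨0, fun h => absurd h hx⟩
  choose c hc using hex
  refine ⟨c, fun x₀ hx₀ => ?_, fun x hx => hc x hx⟩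
  let e := trivializationAt (Fin q → ℂ) E (p x₀)
  have hcp : ContinuousOn p S := by
    have : ContinuousOn (fun x => (F x 0).proj) S :=
      (FiberBundle.continuous_proj (Fin q → ℂ) E).comp_continuousOn
        (hF.continuousOn.comp (f := fun x => (x, 0)) (by fun_prop) fun x hx => ⟨hx, trivial⟩)
    exact this.congr fun x hx => (hF.proj_eq hx 0).symm
  have hbase : ∀ᶠ x in nhdsWithin x₀ S, p x ∈ e.baseSet :=
    (hcp x₀ hx₀).eventually (e.open_baseSet.mem_nhds (FiberBundle.mem_baseSet_trivializationAt' _))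
  -- In a local trivialization the frame is the matrix A and the coordinates sought are A⁻¹ applied
  -- to the section, so continuity reduces to that of matrix inversion.
  let A : X → Matrix (Fin q) (Fin q) ℂ := fun x =>
    Matrix.of fun i j => (e (F x (Pi.single j 1))).2 i
  have he : ∀ {y : X → Bundle.TotalSpace (Fin q → ℂ) E}, ContinuousWithinAt y S x₀ →
      (y x₀).proj = p x₀ → ContinuousWithinAt (fun x => (e (y x)).2) S x₀ := fun hy hy0 =>
    continuous_snd.continuousAt.comp_continuousWithinAt
      ((e.continuousAt (by
        rw [e.mem_source, hy0]
        exact FiberBundle.mem_baseSet_trivializationAt' _)).comp_continuousWithinAt hy)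
  have hA : ContinuousWithinAt A S x₀ := by
    refine continuousWithinAt_pi.2 fun i => continuousWithinAt_pi.2 fun j => ?_
    have hcol : ContinuousOn (fun x => F x (Pi.single j 1)) S :=
      hF.continuousOn.comp (f := fun x => (x, Pi.single j 1)) (by fun_prop)
        fun x hx => ⟨hx, trivial⟩
    exact (continuous_apply i).continuousAt.comp_continuousWithinAt
      (he (hcol x₀ hx₀) (hF.proj_eq hx₀ _))
  have hlin : ∀ x ∈ S, p x ∈ e.baseSet → (A x).det ≠ 0 ∧
      ∀ w, A x *ᵥ w = (e (F x w)).2 := fun x hx hb => hF.trivialization_matrix e hx hb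
  have hb₀ : p x₀ ∈ e.baseSet := FiberBundle.mem_baseSet_trivializationAt' _
  have hinv : ContinuousWithinAt (fun x => (A x)⁻¹ *ᵥ (e (s x)).2) S x₀ :=
    continuousWithinAt_inv_mulVec hA (he (hs x₀ hx₀) (hp x₀ hx₀)) (hlin x₀ hx₀ hb₀).1
  have hloc : ∀ x ∈ S, p x ∈ e.baseSet → c x = (A x)⁻¹ *ᵥ (e (s x)).2 := fun x hx hb => by
    rw [← hc x hx, ← (hlin x hx hb).2, Matrix.mulVec_mulVec,
      Matrix.nonsing_inv_mul _ (hlin x hx hb).1.isUnit, Matrix.one_mulVec]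
  refine hinv.congr_of_eventuallyEq ?_ (hloc x₀ hx₀ hb₀)
  filter_upwards [hbase, self_mem_nhdsWithin] with x h1 h2 using hloc x h2 h1

/-- Two continuous frames differ by a continuous family of nonsingular matrices. -/
theorem FrameOn.exists_transition (hF : FrameOn p F S) (hF' : FrameOn p F' S) :
    ∃ h : X → Matrix (Fin q) (Fin q) ℂ, ContinuousOn h S ∧ ∀ x ∈ S, (h x).det ≠ 0 ∧
      ∀ w, F' x w = F x (h x *ᵥ w) := by
  have hcol : ∀ j : Fin q, ∃ c : X → Fin q → ℂ, ContinuousOn c S ∧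
      ∀ x ∈ S, F x (c x) = F' x (Pi.single j 1) := fun j =>
    hF.exists_coords (hF'.continuousOn.comp (f := fun x => (x, Pi.single j 1)) (by fun_prop)
        fun x hx => ⟨hx, trivial⟩) fun x hx => hF'.proj_eq hx _
  choose c hc hFc using hcol
  refine ⟨fun x => Matrix.of fun i j => c j x i, ?_, fun x hx => ?_⟩
  · exact continuousOn_pi.2 fun i => continuousOn_pi.2 fun j =>
      (continuous_apply i).comp_continuousOn (hc j)
  · obtain ⟨L, hL⟩ := hF.exists_equiv x hx
    obtain ⟨L', hL'⟩ := hF'.exists_equiv x hx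
    let M : (Fin q → ℂ) ≃ₗ[ℂ] (Fin q → ℂ) := L'.trans L.symm
    have hcM : ∀ j, c j x = M (Pi.single j 1) := fun j => by
      have h1 := hFc j x hx
      rw [hL, hL'] at h1
      rw [LinearEquiv.trans_apply, LinearEquiv.eq_symm_apply]
      exact Bundle.TotalSpace.mk_injective _ h1
    have hM := matrix_of_linearEquiv M
    simp only [← hcM] at hM
    refine ⟨hM.1, fun w => ?_⟩
    rw [hM.2, hL, hL']
    simp [M]

/-- Frames exist locally. -/
theorem exists_frameOn_nhds (hp : Continuous p) (x₀ : X) : ∃ S : Set X, IsOpen S ∧ x₀ ∈ S ∧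
    ∃ F : X → (Fin q → ℂ) → Bundle.TotalSpace (Fin q → ℂ) E, FrameOn p F S := by
  let e := trivializationAt (Fin q → ℂ) E (p x₀)
  refine ⟨p ⁻¹' e.baseSet, e.open_baseSet.preimage hp, FiberBundle.mem_baseSet_trivializationAt' _,
    fun x w => Bundle.TotalSpace.mk' _ (p x) (e.symm (p x) w), fun x hx => ?_, ?_⟩
  · exact ⟨(e.linearEquivAt ℂ (p x) hx).symm, fun w => rfl⟩
  · refine e.continuousOn_symm.comp (f := fun z : X × (Fin q → ℂ) => (p z.1, z.2)) (by fun_prop)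
      fun z hz => ?_
    exact ⟨hz.1, trivial⟩

/-- A frame over `S` extends over `T` when there is a frame over `T` and a retraction of `T` to
`S ∩ T`. -/
theorem FrameOn.extend (hF : FrameOn p F S) (hF' : FrameOn p F' T) (cS : IsClosed S)
    (cT : IsClosed T) {r : X → X} (hr : ContinuousOn r T) (hm : Set.MapsTo r T (S ∩ T))
    (hid : ∀ x ∈ S ∩ T, r x = x) :
    ∃ F'' : X → (Fin q → ℂ) → Bundle.TotalSpace (Fin q → ℂ) E, FrameOn p F'' (S ∪ T) ∧
      ∀ x ∈ S, F'' x = F x := by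
  classical
  obtain ⟨h, hh, hd⟩ := (hF'.mono Set.inter_subset_right).exists_transition
    (hF.mono Set.inter_subset_left)
  -- On S ∩ T the frames satisfy F = F'·h. Composing h with the retraction extends it to T, and
  -- F'·(h ∘ r) agrees with F on the overlap.
  let F'' : X → (Fin q → ℂ) → Bundle.TotalSpace (Fin q → ℂ) E := fun x =>
    if x ∈ S then F x else fun w => F' x (h (r x) *ᵥ w)
  have h1 : ∀ x ∈ S, F'' x = F x := fun x hx => if_pos hx
  have h2 : ∀ x ∈ T, F'' x = fun w => F' x (h (r x) *ᵥ w) := fun x hx => by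
    by_cases hxS : x ∈ S
    · rw [h1 x hxS, hid x ⟨hxS, hx⟩]
      exact funext (hd x ⟨hxS, hx⟩).2
    · exact if_neg hxS
  exact ⟨F'', (hF.congr h1).union ((hF'.mul (hh.comp hr hm) fun x hx => (hd _ (hm hx)).1).congr h2)
    cS cT, h1⟩

/-- Gluing frames over consecutive strips. -/
theorem exists_frameOn_strip {p : ℝ × Y → B} {J : Set Y} (hJ : IsClosed J) {t : ℕ → ℝ}
    (ht : Monotone t) (n : ℕ)
    (h : ∀ k ≤ n, ∃ F : ℝ × Y → (Fin q → ℂ) → Bundle.TotalSpace (Fin q → ℂ) E,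
      FrameOn p F (Set.Icc (t k) (t (k + 1)) ×ˢ J)) :
    ∃ F : ℝ × Y → (Fin q → ℂ) → Bundle.TotalSpace (Fin q → ℂ) E,
      FrameOn p F (Set.Icc (t 0) (t (n + 1)) ×ˢ J) := by
  induction n with
  | zero => exact h 0 le_rfl
  | succ n ih =>
    obtain ⟨F, hF⟩ := ih fun k hk => h k (hk.trans n.le_succ)
    obtain ⟨F', hF'⟩ := h (n + 1) le_rfl
    have h0 : t 0 ≤ t (n + 1) := ht (Nat.zero_le _)
    have h1 : t (n + 1) ≤ t (n + 1 + 1) := ht (Nat.le_succ _)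
    obtain ⟨F'', hF'', -⟩ := hF.extend hF' (isClosed_Icc.prod hJ) (isClosed_Icc.prod hJ)
      (r := fun x => (t (n + 1), x.2)) (by fun_prop)
      (fun x hx => ⟨⟨⟨h0, le_rfl⟩, hx.2⟩, ⟨le_rfl, h1⟩, hx.2⟩)
      (fun x hx => Prod.ext (le_antisymm hx.2.1.1 hx.1.1.2) rfl)
    rw [← Set.union_prod, Set.Icc_union_Icc_eq_Icc h0 h1] at hF''
    exact ⟨F'', hF''⟩

/-- Frames exist over boxes. -/
theorem exists_frameOn_box {p : ℝ × ℝ → B} (hp : Continuous p) (N : ℕ) :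
    ∃ F : ℝ × ℝ → (Fin q → ℂ) → Bundle.TotalSpace (Fin q → ℂ) E,
      FrameOn p F (Set.Icc (-N : ℝ) N ×ˢ Set.Icc (-N : ℝ) N) := by
  choose U hU hxU F hF using exists_frameOn_nhds (q := q) (E := E) hp
  obtain ⟨δ, hδ, hleb⟩ := lebesgue_number_lemma_of_metric
    (isCompact_Icc.prod isCompact_Icc : IsCompact (Set.Icc (-N : ℝ) N ×ˢ Set.Icc (-N : ℝ) N)) hU
    (fun x _ => Set.mem_iUnion.2 ⟨x, hxU x⟩)
  -- Cutting each side into n + 1 pieces makes the cells smaller than the Lebesgue number δ, so each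
  -- cell lies in one domain of a local frame.
  obtain ⟨n, hn⟩ := exists_nat_gt (2 * N / δ)
  let η : ℝ := 2 * N / (n + 1)
  have hn0 : (0 : ℝ) < n + 1 := by positivity
  have hη0 : 0 ≤ η := by positivity
  have hηδ : η < δ := by
    rw [div_lt_iff₀ hn0]
    rw [div_lt_iff₀ hδ] at hn
    nlinarith
  let t : ℕ → ℝ := fun k => -N + k * η
  have ht : Monotone t := fun a b hab => by
    have : (a : ℝ) ≤ b := by exact_mod_cast hab
    simp only [t]
    nlinarith
  have ht0 : t 0 = -N := by simp [t]
  have htn : t (n + 1) = N := by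
    simp only [t, η]
    push_cast
    field_simp
    ring
  have hts : ∀ k, t (k + 1) = t k + η := fun k => by
    simp only [t]; push_cast; ring
  have hmem : ∀ k ≤ n, t k ∈ Set.Icc (-N : ℝ) N := fun k hk =>
    ⟨ht0 ▸ ht (Nat.zero_le k), htn ▸ ht (hk.trans n.le_succ)⟩
  have hcell : ∀ k ≤ n, ∀ l ≤ n, ∃ F : ℝ × ℝ → (Fin q → ℂ) → Bundle.TotalSpace (Fin q → ℂ) E,
      FrameOn p F (Set.Icc (t k) (t (k + 1)) ×ˢ Set.Icc (t l) (t (l + 1))) := fun k hk l hl => by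
    obtain ⟨x, hx⟩ := hleb (t k, t l) ⟨hmem k hk, hmem l hl⟩
    refine ⟨F x, (hF x).mono (Set.Subset.trans (fun y hy => ?_) hx)⟩
    rw [Metric.mem_ball, Prod.dist_eq, Real.dist_eq, Real.dist_eq, max_lt_iff]
    have h1 := hy.1
    have h2 := hy.2
    rw [hts, Set.mem_Icc] at h1 h2
    constructor <;> rw [abs_lt] <;> constructor <;> dsimp only <;> linarith [h1.1, h1.2, h2.1, h2.2]
  -- Cells are glued along the first coordinate; the swap then presents the resulting rows as strips
  -- in the other direction.
  have hcol : ∀ l ≤ n, ∃ F : ℝ × ℝ → (Fin q → ℂ) → Bundle.TotalSpace (Fin q → ℂ) E,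
      FrameOn (p ∘ Prod.swap) F (Set.Icc (t l) (t (l + 1)) ×ˢ Set.Icc (-N : ℝ) N) := fun l hl => by
    obtain ⟨F, hF⟩ := exists_frameOn_strip (isClosed_Icc (a := t l) (b := t (l + 1))) ht n
      fun k hk => hcell k hk l hl
    rw [ht0, htn] at hF
    exact ⟨_, hF.comp continuous_swap.continuousOn fun y hy => ⟨hy.2, hy.1⟩⟩
  obtain ⟨F, hF⟩ := exists_frameOn_strip isClosed_Icc ht n hcol
  rw [ht0, htn] at hF
  exact ⟨_, hF.comp (f := Prod.swap) continuous_swap.continuousOn fun y hy => ⟨hy.2, hy.1⟩⟩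

/-- Vector bundles over the plane are trivial. -/
theorem exists_frameOn_plane {p : ℝ × ℝ → B} (hp : Continuous p) :
    ∃ F : ℝ × ℝ → (Fin q → ℂ) → Bundle.TotalSpace (Fin q → ℂ) E, FrameOn p F Set.univ := by
  let K : ℕ → Set (ℝ × ℝ) := fun n => Set.Icc (-n : ℝ) n ×ˢ Set.Icc (-n : ℝ) n
  have hKc : ∀ n, IsClosed (K n) := fun n => isClosed_Icc.prod isClosed_Icc
  have hKm : Monotone K := fun a b hab => by
    have : (a : ℝ) ≤ b := by exact_mod_cast hab
    exact Set.prod_mono (Set.Icc_subset_Icc (neg_le_neg this) this)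
      (Set.Icc_subset_Icc (neg_le_neg this) this)
  have step : ∀ n (F : {F : ℝ × ℝ → (Fin q → ℂ) → Bundle.TotalSpace (Fin q → ℂ) E //
      FrameOn p F (K n)}), ∃ F' : {F : ℝ × ℝ → (Fin q → ℂ) → Bundle.TotalSpace (Fin q → ℂ) E //
        FrameOn p F (K (n + 1))}, ∀ x ∈ K n, F'.1 x = F.1 x := fun n F => by
    obtain ⟨G, hG⟩ := exists_frameOn_box (q := q) (E := E) hp (n + 1)
    have hsub : K n ⊆ K (n + 1) := hKm n.le_succ
    have hn : (-n : ℝ) ≤ n := by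
      have : (0 : ℝ) ≤ n := Nat.cast_nonneg n
      linarith
    -- Clamping both coordinates retracts the larger box onto the smaller one.
    let ρ : ℝ → ℝ := fun a => Set.projIcc (-n : ℝ) n hn a
    have hρ : Continuous ρ := continuous_subtype_val.comp continuous_projIcc
    have hρm : ∀ a, ρ a ∈ Set.Icc (-n : ℝ) n := fun a => (Set.projIcc (-n : ℝ) n hn a).2
    have hρi : ∀ a ∈ Set.Icc (-n : ℝ) n, ρ a = a := fun a ha => by
      simp only [ρ, Set.projIcc_of_mem hn ha]
    obtain ⟨F', hF', hFF'⟩ := F.2.extend hG (hKc n) (hKc (n + 1))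
      (r := fun x => (ρ x.1, ρ x.2)) (by fun_prop)
      (fun x _ => ⟨⟨hρm _, hρm _⟩, hsub ⟨hρm _, hρm _⟩⟩)
      (fun x hx => Prod.ext (hρi _ hx.1.1) (hρi _ hx.1.2))
    exact ⟨⟨F', hF'.mono Set.subset_union_right⟩, hFF'⟩
  choose next hnext using step
  obtain ⟨F₀, hF₀⟩ := exists_frameOn_box (q := q) (E := E) hp 0
  let F : ∀ n, {F : ℝ × ℝ → (Fin q → ℂ) → Bundle.TotalSpace (Fin q → ℂ) E // FrameOn p F (K n)} :=
    fun n => Nat.rec ⟨F₀, hF₀⟩ next n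
  have hF : ∀ m n, m ≤ n → ∀ x ∈ K m, (F n).1 x = (F m).1 x := fun m n hmn => by
    induction n, hmn using Nat.le_induction with
    | base => exact fun x _ => rfl
    | succ n hmn ih => exact fun x hx => (hnext n (F n) x (hKm hmn hx)).trans (ih x hx)
  have hKnorm : ∀ (n : ℕ) (x : ℝ × ℝ), ‖x‖ ≤ n → x ∈ K n := fun n x hx => by
    rw [Prod.norm_def, max_le_iff, Real.norm_eq_abs, Real.norm_eq_abs, abs_le, abs_le] at hx
    exact ⟨⟨hx.1.1, hx.1.2⟩, hx.2.1, hx.2.2⟩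
  -- The successive extensions agree on the smaller boxes, so any box containing x gives the same
  -- value.
  let G : ℝ × ℝ → (Fin q → ℂ) → Bundle.TotalSpace (Fin q → ℂ) E := fun x => (F ⌈‖x‖⌉₊).1 x
  have hG : ∀ n, ∀ x ∈ K n, G x = (F n).1 x := fun n x hx => by
    have hx' := hKnorm _ x (Nat.le_ceil ‖x‖)
    rcases le_total ⌈‖x‖⌉₊ n with h | h
    · exact (hF _ _ h x hx').symm
    · exact hF _ _ h x hx
  have hGn : ∀ n, FrameOn p G (K n) := fun n => (F n).2.congr (hG n)
  refine ⟨G, fun x _ => (hGn _).exists_equiv x (hKnorm _ x (Nat.le_ceil ‖x‖)), ?_⟩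
  rw [Set.univ_prod_univ, continuousOn_univ, continuous_iff_continuousAt]
  rintro ⟨x, w⟩
  obtain ⟨n, hn⟩ := exists_nat_gt ‖x‖
  refine (hGn n).continuousOn.continuousAt (prod_mem_nhds ?_ Filter.univ_mem)
  have : {y : ℝ × ℝ | ‖y‖ < n} ∈ nhds x :=
    (isOpen_lt continuous_norm continuous_const).mem_nhds hn
  exact Filter.mem_of_superset this fun y hy => hKnorm n y (le_of_lt hy)

end VectorBundle

end Frames

/-! ### The universal cover of the torus -/

/-- The covering map `ℝ² → T²`. -/
def cover (x : Fin 2 → ℝ) : T2 := fun j => (x j : UnitAddCircle)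

theorem continuous_cover : Continuous cover :=
  continuous_pi fun j => (AddCircle.continuous_mk' 1).comp (continuous_apply j)

/-- The lattice point of `ℝ²` with the given integral coordinates. -/
def lat (l : Fin 2 → ℤ) : Fin 2 → ℝ := fun j => (l j : ℝ)

theorem lat_add (l m : Fin 2 → ℤ) : lat (l + m) = lat l + lat m := by
  ext j; simp [lat]

theorem cover_add_lat (x : Fin 2 → ℝ) (l : Fin 2 → ℤ) : cover (x + lat l) = cover x := by
  ext j
  simp [cover, lat]

/-- The point with coordinates `(s, t)` in the basis `v`. -/
def pt (v : Module.Basis (Fin 2) ℤ (Fin 2 → ℤ)) (s t : ℝ) : Fin 2 → ℝ :=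
  fun j => v 0 j * s + v 1 j * t

theorem continuous_pt (v : Module.Basis (Fin 2) ℤ (Fin 2 → ℤ)) :
    Continuous fun x : ℝ × ℝ => pt v x.1 x.2 := by
  unfold pt; fun_prop

theorem cover_pt (v : Module.Basis (Fin 2) ℤ (Fin 2 → ℤ)) (s : ℝ) (t : I) :
    cover (pt v s t) = glue v (s : UnitAddCircle) t := by
  ext j
  simp [cover, pt, glue, ← zsmul_eq_mul]

theorem pt_zero_zero (v : Module.Basis (Fin 2) ℤ (Fin 2 → ℤ)) : pt v 0 0 = 0 := by
  ext j; simp [pt]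

theorem pt_one_left (v : Module.Basis (Fin 2) ℤ (Fin 2 → ℤ)) (t : ℝ) :
    pt v 1 t = pt v 0 t + lat (v 0) := by
  ext j; simp [pt, lat, add_comm]

theorem pt_one_right (v : Module.Basis (Fin 2) ℤ (Fin 2 → ℤ)) (s : ℝ) :
    pt v s 1 = pt v s 0 + lat (v 1) := by
  ext j; simp [pt, lat]

theorem glue_one (v : Module.Basis (Fin 2) ℤ (Fin 2 → ℤ)) (s : UnitAddCircle) :
    glue v s 1 = glue v s 0 := by
  ext j
  have h : ((1 : ℝ) : UnitAddCircle) = 0 := coe_one_eq_zero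
  simp [glue, h]

/-! ### The alternating form of a logarithmic cocycle -/

/-- Logarithms of a multiplicative cocycle of the lattice with values in the nonvanishing functions
on the plane. -/
structure IsLogCocycle (f : (Fin 2 → ℤ) → (Fin 2 → ℝ) → ℂ) : Prop where
  continuous : ∀ l, Continuous (f l)
  mul : ∀ l m x, expTwoPiI (f (l + m) x) = expTwoPiI (f l x) * expTwoPiI (f m (x + lat l))

/-- The commutator pairing of a logarithmic cocycle. -/
def pairing (f : (Fin 2 → ℤ) → (Fin 2 → ℝ) → ℂ) (x : Fin 2 → ℝ) (l m : Fin 2 → ℤ) : ℂ :=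
  f l (x + lat m) - f l x - f m (x + lat l) + f m x

theorem pairing_self (f : (Fin 2 → ℤ) → (Fin 2 → ℝ) → ℂ) (x : Fin 2 → ℝ) (l : Fin 2 → ℤ) :
    pairing f x l l = 0 := by
  unfold pairing; ring

theorem pairing_swap (f : (Fin 2 → ℤ) → (Fin 2 → ℝ) → ℂ) (x : Fin 2 → ℝ) (l m : Fin 2 → ℤ) :
    pairing f x l m = -pairing f x m l := by
  unfold pairing; ring

/-- The multiplicative cocycle relation lifts to the logarithms up to an integer-valued continuous
function on the plane, that is, a constant. -/
theorem IsLogCocycle.sub_eq {f : (Fin 2 → ℤ) → (Fin 2 → ℝ) → ℂ} (hf : IsLogCocycle f)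
    (l m : Fin 2 → ℤ) (x y : Fin 2 → ℝ) :
    f (l + m) x - f (l + m) y = f l x + f m (x + lat l) - (f l y + f m (y + lat l)) :=
  sub_eq_sub_of_expTwoPiI (φ := f (l + m)) (ψ := fun z => f l z + f m (z + lat l)) (c := 1)
    (hf.continuous _)
    ((hf.continuous l).add ((hf.continuous m).comp (continuous_id.add continuous_const)))
    (fun z => by rw [hf.mul, expTwoPiI_add, one_mul]) x y

/-- Up to constants, f_l(x) + f_m(x + l) and f_m(x) + f_l(x + m) are both f_{l+m}(x); the pairing is
their difference up to sign. -/
theorem IsLogCocycle.pairing_eq {f : (Fin 2 → ℤ) → (Fin 2 → ℝ) → ℂ} (hf : IsLogCocycle f)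
    (x y : Fin 2 → ℝ) (l m : Fin 2 → ℤ) : pairing f x l m = pairing f y l m := by
  have h1 := hf.sub_eq l m x y
  have h2 := hf.sub_eq m l x y
  rw [add_comm m l] at h2
  unfold pairing
  linear_combination h1 - h2

theorem IsLogCocycle.pairing_add {f : (Fin 2 → ℤ) → (Fin 2 → ℝ) → ℂ} (hf : IsLogCocycle f)
    (x : Fin 2 → ℝ) (l l' m : Fin 2 → ℤ) :
    pairing f x (l + l') m = pairing f x l m + pairing f x l' m := by
  -- Evaluating the second summand at x + l makes the terms in f_m telescope.
  rw [hf.pairing_eq x (x + lat l) l' m]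
  have h1 := hf.sub_eq l l' (x + lat m) x
  have e1 : x + lat m + lat l = x + lat l + lat m := add_right_comm _ _ _
  have e2 : x + lat (l + l') = x + lat l + lat l' := by rw [lat_add, add_assoc]
  rw [e1] at h1
  unfold pairing
  rw [e2]
  linear_combination h1

theorem IsLogCocycle.pairing_add_right {f : (Fin 2 → ℤ) → (Fin 2 → ℝ) → ℂ} (hf : IsLogCocycle f)
    (x : Fin 2 → ℝ) (l m m' : Fin 2 → ℤ) :
    pairing f x l (m + m') = pairing f x l m + pairing f x l m' := by
  rw [pairing_swap f x l, hf.pairing_add, pairing_swap f x m, pairing_swap f x m']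
  ring

theorem IsLogCocycle.pairing_eq_det {f : (Fin 2 → ℤ) → (Fin 2 → ℝ) → ℂ} (hf : IsLogCocycle f)
    (x : Fin 2 → ℝ) (l m : Fin 2 → ℤ) : pairing f x l m =
      ((l 0 * m 1 - l 1 * m 0 : ℤ) : ℂ) * pairing f x (Pi.single 0 1) (Pi.single 1 1) := by
  let L : (Fin 2 → ℤ) → (Fin 2 → ℤ) →+ ℂ := fun m =>
    AddMonoidHom.mk' (fun l => pairing f x l m) fun a b => hf.pairing_add x a b m
  let R : (Fin 2 → ℤ) → (Fin 2 → ℤ) →+ ℂ := fun l =>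
    AddMonoidHom.mk' (fun m => pairing f x l m) fun a b => hf.pairing_add_right x l a b
  have hexp : ∀ l : Fin 2 → ℤ, l = l 0 • Pi.single 0 1 + l 1 • Pi.single 1 1 := fun l => by
    ext j; fin_cases j <;> simp
  have hL : ∀ l m, pairing f x l m =
      l 0 * pairing f x (Pi.single 0 1) m + l 1 * pairing f x (Pi.single 1 1) m := fun l m => by
    have : L m l = L m (l 0 • Pi.single 0 1 + l 1 • Pi.single 1 1) := by rw [← hexp]
    rw [map_add, map_zsmul, map_zsmul, zsmul_eq_mul, zsmul_eq_mul] at this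
    exact this
  have hR : ∀ l m, pairing f x l m =
      m 0 * pairing f x l (Pi.single 0 1) + m 1 * pairing f x l (Pi.single 1 1) := fun l m => by
    have : R l m = R l (m 0 • Pi.single 0 1 + m 1 • Pi.single 1 1) := by rw [← hexp]
    rw [map_add, map_zsmul, map_zsmul, zsmul_eq_mul, zsmul_eq_mul] at this
    exact this
  rw [hL, hR _ m, hR _ m, pairing_self, pairing_self, pairing_swap f x (Pi.single 1 1)]
  push_cast
  ring

/-! ### Positive bases -/

/-- The determinant of a positively oriented basis is determined by the orientation. -/
theorem exists_sign (o : Orientation ℝ (Fin 2 → ℝ) (Fin 2)) : ∃ ε : ℤ, ∀ v, IsPositive o v →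
    v 0 0 * v 1 1 - v 0 1 * v 1 0 = ε := by
  have key : ∀ v w : Module.Basis (Fin 2) ℤ (Fin 2 → ℤ), IsPositive o v → IsPositive o w →
      v 0 0 * v 1 1 - v 0 1 * v 1 0 = w 0 0 * w 1 1 - w 0 1 * w 1 0 := by
    rintro v w ⟨b, hb, hbo⟩ ⟨c, hc, hco⟩
    have hdet : ∀ (v : Module.Basis (Fin 2) ℤ (Fin 2 → ℤ)),
        IsUnit (v 0 0 * v 1 1 - v 0 1 * v 1 0) := fun v => by
      have h := Module.Basis.isUnit_det (Pi.basisFun ℤ (Fin 2)) v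
      rw [Module.Basis.det_apply, Matrix.det_fin_two] at h
      simpa [Module.Basis.toMatrix_apply, mul_comm] using h
    have hreal : ∀ (v : Module.Basis (Fin 2) ℤ (Fin 2 → ℤ)) (b : Module.Basis (Fin 2) ℝ (Fin 2 → ℝ)),
        (∀ i j, b i j = (v i j : ℝ)) →
        (Pi.basisFun ℝ (Fin 2)).det b = ((v 0 0 * v 1 1 - v 0 1 * v 1 0 : ℤ) : ℝ) := fun v b hb => by
      rw [Module.Basis.det_apply, Matrix.det_fin_two]
      simp [Module.Basis.toMatrix_apply, hb, mul_comm]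
    have h0 : 0 < b.det c := (Module.Basis.orientation_eq_iff_det_pos b c).1 (hbo.trans hco.symm)
    have hmul : (Pi.basisFun ℝ (Fin 2)).det b * b.det c = (Pi.basisFun ℝ (Fin 2)).det c := by
      rw [Module.Basis.det_apply, Module.Basis.det_apply, Module.Basis.det_apply, ← Matrix.det_mul,
        Module.Basis.toMatrix_mul_toMatrix]
    rw [hreal v b hb, hreal w c hc] at hmul
    -- Determinants of bases of ℤ² are ±1, so equality of orientations, which compares signs, makes
    -- them equal.
    have hv := Int.isUnit_iff.1 (hdet v)
    have hw := Int.isUnit_iff.1 (hdet w)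
    rcases hv with hv | hv <;> rcases hw with hw | hw <;> rw [hv, hw] at hmul ⊢ <;>
      push_cast at hmul <;> linarith
  by_cases h : ∃ v, IsPositive o v
  · obtain ⟨v, hv⟩ := h
    exact ⟨_, fun w hw => key w v hw hv⟩
  · exact ⟨0, fun v hv => absurd ⟨v, hv⟩ h⟩

theorem exists_isPositive (o : Orientation ℝ (Fin 2 → ℝ) (Fin 2)) : ∃ v, IsPositive o v := by
  by_cases h : (Pi.basisFun ℝ (Fin 2)).orientation = o
  · exact ⟨Pi.basisFun ℤ (Fin 2), Pi.basisFun ℝ (Fin 2),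
      fun i j => by simp [Pi.single_apply], h⟩
  · let b := Pi.basisFun ℝ (Fin 2)
    refine ⟨(Pi.basisFun ℤ (Fin 2)).reindex (Equiv.swap 0 1), b.reindex (Equiv.swap 0 1),
      fun i j => by simp [b, Pi.single_apply], ?_⟩
    have h1 : (b.reindex (Equiv.swap 0 1)).orientation ≠ b.orientation := by
      rw [ne_comm, Ne, Module.Basis.orientation_eq_iff_det_pos, Module.Basis.det_apply,
        Matrix.det_fin_two]
      simp [b, Module.Basis.toMatrix_apply]
    rw [Module.Basis.orientation_ne_iff_eq_neg] at h1
    have h2 := (Module.Basis.orientation_ne_iff_eq_neg b o).1 (Ne.symm h)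
    rw [h1, h2]

/-! ### The lattice cocycle of a vector bundle -/

theorem matrix_eq_of_mulVec {q : ℕ} {A B : Matrix (Fin q) (Fin q) ℂ} (h : ∀ w, A *ᵥ w = B *ᵥ w) :
    A = B := Matrix.mulVec_injective (funext h)

section Cocycle

variable {q : ℕ} {E : T2 → Type*} [∀ x, AddCommGroup (E x)] [∀ x, Module ℂ (E x)]
  [TopologicalSpace (Bundle.TotalSpace (Fin q → ℂ) E)]

/-- A frame on the universal cover of the torus, the matrix cocycle by which it fails to be
periodic, and a logarithm of the determinant of this cocycle. -/
structure IsPeriodFrame (F : (Fin 2 → ℝ) → (Fin q → ℂ) → Bundle.TotalSpace (Fin q → ℂ) E)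
    (a : (Fin 2 → ℤ) → (Fin 2 → ℝ) → Matrix (Fin q) (Fin q) ℂ)
    (f : (Fin 2 → ℤ) → (Fin 2 → ℝ) → ℂ) : Prop where
  frameOn : FrameOn cover F Set.univ
  continuous : ∀ l, Continuous (a l)
  translate : ∀ l x w, F (x + lat l) w = F x (a l x *ᵥ w)
  log : ∀ l x, expTwoPiI (f l x) = (a l x).det
  isLogCocycle : IsLogCocycle f

variable {F : (Fin 2 → ℝ) → (Fin q → ℂ) → Bundle.TotalSpace (Fin q → ℂ) E}
  {a : (Fin 2 → ℤ) → (Fin 2 → ℝ) → Matrix (Fin q) (Fin q) ℂ} {f : (Fin 2 → ℤ) → (Fin 2 → ℝ) → ℂ}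

theorem IsPeriodFrame.det_ne_zero (hF : IsPeriodFrame F a f) (l : Fin 2 → ℤ) (x : Fin 2 → ℝ) :
    (a l x).det ≠ 0 := hF.log l x ▸ expTwoPiI_ne_zero _

/-- Both products express F(x + l + m) in terms of F(x). -/
theorem IsPeriodFrame.mul_comm_translate (hF : IsPeriodFrame F a f) (l m : Fin 2 → ℤ)
    (x : Fin 2 → ℝ) : a l x * a m (x + lat l) = a m x * a l (x + lat m) := by
  refine matrix_eq_of_mulVec fun w => hF.frameOn.injective (Set.mem_univ x) ?_
  rw [← Matrix.mulVec_mulVec, ← Matrix.mulVec_mulVec, ← hF.translate, ← hF.translate,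
    ← hF.translate, ← hF.translate, add_right_comm]

theorem IsPeriodFrame.frameOn_square (hF : IsPeriodFrame F a f)
    (v : Module.Basis (Fin 2) ℤ (Fin 2 → ℤ)) :
    FrameOn (fun x : I × I => glue v (toCircle x.1) x.2) (fun x => F (pt v x.1 x.2)) Set.univ := by
  have hc : Continuous fun x : I × I => pt v x.1 x.2 :=
    (continuous_pt v).comp (f := fun x : I × I => ((x.1 : ℝ), (x.2 : ℝ))) (by fun_prop)
  exact (hF.frameOn.comp hc.continuousOn (Set.mapsTo_univ _ _)).congr_base
    fun x _ => (cover_pt v x.1 x.2).symm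

theorem VectorFrame.frameOn {v : Module.Basis (Fin 2) ℤ (Fin 2 → ℤ)} (τ : VectorFrame q E v) :
    FrameOn (fun x : UnitAddCircle × I => glue v x.1 x.2)
      (fun x w => Bundle.TotalSpace.mk' (Fin q → ℂ) (glue v x.1 x.2) (τ.toEquiv x.1 x.2 w))
      Set.univ :=
  ⟨fun x _ => ⟨τ.toEquiv x.1 x.2, fun _ => rfl⟩,
    (τ.continuous_toEquiv.comp (f := fun y : (UnitAddCircle × I) × (Fin q → ℂ) =>
      (y.1.1, y.1.2, y.2)) (by fun_prop)).continuousOn⟩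

/-- A frame over the cylinder is a trivialization. -/
theorem FrameOn.exists_vectorFrame {v : Module.Basis (Fin 2) ℤ (Fin 2 → ℤ)}
    {G : UnitAddCircle × I → (Fin q → ℂ) → Bundle.TotalSpace (Fin q → ℂ) E}
    (hG : FrameOn (fun x : UnitAddCircle × I => glue v x.1 x.2) G Set.univ) :
    ∃ τ : VectorFrame q E v, ∀ s t w,
      Bundle.TotalSpace.mk' (Fin q → ℂ) (glue v s t) (τ.toEquiv s t w) = G (s, t) w := by
  choose L hL using fun x => hG.exists_equiv x (Set.mem_univ x)
  refine ⟨⟨fun s t => L (s, t), ?_⟩, fun s t w => (hL (s, t) w).symm⟩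
  refine (hG.continuous.comp (f := fun p : UnitAddCircle × I × (Fin q → ℂ) =>
    ((p.1, p.2.1), p.2.2)) (by fun_prop)).congr fun p => ?_
  exact hL (p.1, p.2.1) p.2.2

theorem FrameOn.exists_descent {v : Module.Basis (Fin 2) ℤ (Fin 2 → ℤ)}
    {G : I × I → (Fin q → ℂ) → Bundle.TotalSpace (Fin q → ℂ) E}
    (hG : FrameOn (fun x : I × I => glue v (toCircle x.1) x.2) G Set.univ)
    (h : ∀ t, G (0, t) = G (1, t)) :
    ∃ G' : UnitAddCircle × I → (Fin q → ℂ) → Bundle.TotalSpace (Fin q → ℂ) E,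
      FrameOn (fun x : UnitAddCircle × I => glue v x.1 x.2) G' Set.univ := by
  obtain ⟨G', hG', hGG'⟩ := TorusTwist.exists_descent (Z := I × (Fin q → ℂ))
    (f := fun y => G (y.1, y.2.1) y.2.2)
    (hG.continuous.comp (f := fun y : I × I × (Fin q → ℂ) => ((y.1, y.2.1), y.2.2)) (by fun_prop))
    (fun z => congrFun (h z.1) z.2)
  refine ⟨fun x w => G' (x.1, x.2, w), fun x _ => ?_, ?_⟩
  · obtain ⟨s, hs⟩ := toCircle_surjective x.1
    obtain ⟨L, hL⟩ := hG.exists_equiv (s, x.2) trivial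
    obtain ⟨x, t⟩ := x
    obtain rfl := hs
    exact ⟨L, fun w => (hGG' _ _).trans (hL w)⟩
  · exact (hG'.comp (f := fun y : (UnitAddCircle × I) × (Fin q → ℂ) => (y.1.1, y.1.2, y.2))
      (by fun_prop)).continuousOn

/-- Over the square, the frame on the edge s = 1 is that on s = 0 times b(t). Connectedness of GL
and contractibility of the interval permit a correction equal to 1 on one edge and to b(t)⁻¹ on the
other. -/
theorem IsPeriodFrame.exists_frameOn_cylinder (hF : IsPeriodFrame F a f)
    (v : Module.Basis (Fin 2) ℤ (Fin 2 → ℤ)) :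
    ∃ G : UnitAddCircle × I → (Fin q → ℂ) → Bundle.TotalSpace (Fin q → ℂ) E,
      FrameOn (fun x : UnitAddCircle × I => glue v x.1 x.2) G Set.univ := by
  let b : C(I, GL (Fin q) ℂ) := glMap (fun t : I => a (v 0) (pt v 0 t))
    ((hF.continuous _).comp ((continuous_pt v).comp (f := fun t : I => (0, (t : ℝ)))
      (by fun_prop))) fun t => hF.det_ne_zero _ _
  obtain ⟨β, hβ0, hβ1⟩ := exists_gl_path ((b 0)⁻¹)
  -- At s = 0 this is b(0) b(0)⁻¹ = 1; at s = 1 the path β reaches b(0)⁻¹ and leaves b(t)⁻¹.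
  let K : C(I × I, GL (Fin q) ℂ) :=
    ⟨fun x => β x.1 * b 0 * (b (x.1 * x.2))⁻¹, by fun_prop⟩
  have hK := (hF.frameOn_square v).mul (h := fun x => (K x : Matrix (Fin q) (Fin q) ℂ))
    (Units.continuous_val.comp K.continuous).continuousOn
    (fun x _ => (Matrix.isUnits_det_units _).ne_zero)
  refine hK.exists_descent fun t => funext fun w => ?_
  have h0 : K (0, t) = 1 := by simp [K, hβ0]
  have h1 : b t * K (1, t) = 1 := by simp [K, hβ1]
  have h1' : a (v 0) (pt v 0 t) * (K (1, t) : Matrix (Fin q) (Fin q) ℂ) = 1 :=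
    congrArg Units.val h1
  simp only [Set.Icc.coe_zero, Set.Icc.coe_one, pt_one_left, hF.translate, h0, Units.val_one,
    Matrix.mulVec_mulVec, h1']

variable [∀ x, TopologicalSpace (E x)] [FiberBundle (Fin q → ℂ) E] [VectorBundle ℂ (Fin q → ℂ) E]

-- The covering is invariant under lattice translations, so the translated frame is a frame of the
-- same pullback and differs from the original by a matrix function, whose determinant has a
-- logarithm on the plane.
variable (q E) in
theorem exists_isPeriodFrame :
    ∃ (F : (Fin 2 → ℝ) → (Fin q → ℂ) → Bundle.TotalSpace (Fin q → ℂ) E)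
      (a : (Fin 2 → ℤ) → (Fin 2 → ℝ) → Matrix (Fin q) (Fin q) ℂ)
      (f : (Fin 2 → ℤ) → (Fin 2 → ℝ) → ℂ), IsPeriodFrame F a f := by
  have hc : Continuous fun x : ℝ × ℝ => cover ![x.1, x.2] :=
    continuous_cover.comp (continuous_pi fun j => by fin_cases j <;> simp <;> fun_prop)
  obtain ⟨G, hG⟩ := exists_frameOn_plane (q := q) (E := E) hc
  let F : (Fin 2 → ℝ) → (Fin q → ℂ) → Bundle.TotalSpace (Fin q → ℂ) E := fun x => G (x 0, x 1)
  have hF : FrameOn cover F Set.univ := by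
    refine (hG.comp (f := fun x : Fin 2 → ℝ => (x 0, x 1)) (T := Set.univ) (by fun_prop)
      (Set.mapsTo_univ _ _)).congr_base fun x _ => congrArg cover ?_
    ext j; fin_cases j <;> rfl
  have ha : ∀ l : Fin 2 → ℤ, ∃ a : (Fin 2 → ℝ) → Matrix (Fin q) (Fin q) ℂ, Continuous a ∧
      ∀ x, (a x).det ≠ 0 ∧ ∀ w, F (x + lat l) w = F x (a x *ᵥ w) := fun l => by
    have hl : FrameOn cover (fun x => F (x + lat l)) Set.univ :=
      (hF.comp (f := fun x => x + lat l) (T := Set.univ) (by fun_prop)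
        (Set.mapsTo_univ _ _)).congr_base fun x _ => (cover_add_lat x l).symm
    obtain ⟨a, ha, h⟩ := hF.exists_transition hl
    exact ⟨a, continuousOn_univ.1 ha, fun x => h x trivial⟩
  choose a ha hd haF using ha
  have hf : ∀ l, ∃ f : (Fin 2 → ℝ) → ℂ, Continuous f ∧ ∀ x, expTwoPiI (f x) = (a l x).det :=
    fun l => exists_continuous_log_plane (ha l).matrix_det (hd l)
  choose f hf hfa using hf
  refine ⟨F, a, f, hF, ha, haF, hfa, hf, fun l m x => ?_⟩
  rw [hfa, hfa, hfa, ← Matrix.det_mul]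
  congr 1
  refine matrix_eq_of_mulVec fun w => hF.injective (Set.mem_univ x) ?_
  rw [← haF, ← Matrix.mulVec_mulVec, ← haF, ← haF, lat_add, add_assoc]

/-! ### The twist computed from the cocycle -/

/-- Let h be the transition matrix over the square from the given frame to F. The vertical edges
differ by the period matrix of v₀, the horizontal ones by that of v₁ and by g. Comparing the
increments of log det h along opposite edges leaves n on one side and the pairing on the other. -/
theorem IsPeriodFrame.degree_eq (hF : IsPeriodFrame F a f)
    {v : Module.Basis (Fin 2) ℤ (Fin 2 → ℤ)} {τ : VectorFrame q E v} {g : C(UnitAddCircle, U q)}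
    (hg : τ.IsClutching g) {n : ℤ} (hn : HasDegree (piDet q (loopClass g)) n) :
    (n : ℂ) = pairing f 0 (v 0) (v 1) := by
  have hτ := τ.frameOn.comp (f := fun x : I × I => (toCircle x.1, x.2)) (T := Set.univ)
    (by fun_prop) (Set.mapsTo_univ _ _)
  obtain ⟨h, hh, hd⟩ := hτ.exists_transition (hF.frameOn_square v)
  rw [continuousOn_univ] at hh
  have hdet : ∀ x, (h x).det ≠ 0 := fun x => (hd x trivial).1
  have htr : ∀ x w, F (pt v (x : I × I).1 x.2) w =
      Bundle.TotalSpace.mk' (Fin q → ℂ) (glue v (toCircle x.1) x.2)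
        (τ.toEquiv (toCircle x.1) x.2 (h x *ᵥ w)) := fun x => (hd x trivial).2
  have hinj := fun x : I × I => hτ.injective (Set.mem_univ x)
  have edge₁ : ∀ t : I, h (1, t) = h (0, t) * a (v 0) (pt v 0 t) := fun t => by
    refine matrix_eq_of_mulVec fun w => hinj (0, t) ?_
    have h1 := htr (1, t) w
    rw [Set.Icc.coe_one, pt_one_left, hF.translate] at h1
    have h0 := htr (0, t) (a (v 0) (pt v 0 t) *ᵥ w)
    rw [Set.Icc.coe_zero] at h0
    rw [← Matrix.mulVec_mulVec]
    have h01 : toCircle 0 = toCircle 1 := toCircle_zero.trans toCircle_one.symm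
    exact (congrArg (fun c => Bundle.TotalSpace.mk' (Fin q → ℂ) (glue v c t)
      (τ.toEquiv c t (h (1, t) *ᵥ w))) h01).trans (h1.symm.trans h0)
  have edge₂ : ∀ s : I, h (s, 1) = (g (toCircle s) : Matrix (Fin q) (Fin q) ℂ) *
      (h (s, 0) * a (v 1) (pt v s 0)) := fun s => by
    refine matrix_eq_of_mulVec fun w => hinj (s, 1) ?_
    have h1 := htr (s, 1) w
    rw [Set.Icc.coe_one, pt_one_right, hF.translate] at h1
    have h0 := htr (s, 0) (a (v 1) (pt v s 0) *ᵥ w)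
    rw [Set.Icc.coe_zero, hg] at h0
    rw [← Matrix.mulVec_mulVec, ← Matrix.mulVec_mulVec]
    exact h1.symm.trans h0
  obtain ⟨φ, hφ, hφh⟩ := exists_continuous_log_square hh.matrix_det hdet
  obtain ⟨θ, hθ, hθ0, hθ1⟩ := hasDegree_piDet_iff.1 hn
  have hgdet : ∀ s : I, (g (toCircle s) : Matrix (Fin q) (Fin q) ℂ).det =
      (g 0 : Matrix (Fin q) (Fin q) ℂ).det * expTwoPiI (θ s) := fun s => by
    rw [hθ, ← Matrix.det_mul, ← Matrix.UnitaryGroup.mul_val]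
    congr 2
    exact (mul_inv_cancel_left (g 0) (g (toCircle s))).symm
  have hpt : ∀ t : I → ℝ × ℝ, Continuous t → Continuous fun x => pt v (t x).1 (t x).2 :=
    fun t ht => (continuous_pt v).comp ht
  -- Logarithms of the determinants of `edge₁` and `edge₂`, compared between the endpoints of the
  -- edges. The constant factor det g(0) drops out of the increments.
  have key₁ := sub_eq_sub_of_expTwoPiI (φ := fun t : I => φ (1, t))
    (ψ := fun t : I => φ (0, t) + f (v 0) (pt v 0 t)) (c := 1) (by fun_prop)
    (Continuous.add (by fun_prop) ((hF.isLogCocycle.continuous _).comp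
      (hpt (fun t => (0, t)) (by fun_prop))))
    (fun t => by rw [hφh, edge₁, Matrix.det_mul, expTwoPiI_add, hφh, hF.log, one_mul]) 1 0
  have key₂ := sub_eq_sub_of_expTwoPiI (φ := fun s : I => φ (s, 1))
    (ψ := fun s : I => θ s + (φ (s, 0) + f (v 1) (pt v s 0)))
    (c := (g 0 : Matrix (Fin q) (Fin q) ℂ).det) (by fun_prop)
    (Continuous.add (by fun_prop) (Continuous.add (by fun_prop)
      ((hF.isLogCocycle.continuous _).comp (hpt (fun s => (s, 0)) (by fun_prop)))))
    (fun s => by rw [hφh, edge₂, Matrix.det_mul, Matrix.det_mul, expTwoPiI_add, expTwoPiI_add, hφh,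
      hF.log, hgdet, mul_assoc]) 1 0
  simp only [hθ0, hθ1, Set.Icc.coe_one, Set.Icc.coe_zero, pt_one_left, pt_one_right,
    pt_zero_zero] at key₁ key₂
  unfold pairing
  push_cast at key₂
  linear_combination key₁ - key₂

/-! ### Existence of unitary clutching maps -/

section Polar

open scoped ComplexOrder

/-- A convex combination of 1 and a positive definite matrix is positive definite. -/
theorem det_segment_ne_zero {P : Matrix (Fin q) (Fin q) ℂ} (hP : P.PosDef) (t : I) :
    (((1 - (t : ℝ) : ℝ) : ℂ) • (1 : Matrix (Fin q) (Fin q) ℂ) + ((t : ℝ) : ℂ) • P).det ≠ 0 := by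
  rcases eq_or_ne t 0 with rfl | ht
  · simp
  · have ht0 : (0 : ℝ) < t := lt_of_le_of_ne t.2.1 fun h => ht (Subtype.ext h.symm)
    refine (Matrix.PosDef.det_pos ?_).ne'
    refine Matrix.PosDef.posSemidef_add (Matrix.PosSemidef.smul Matrix.PosSemidef.one ?_)
      (hP.smul ?_)
    · exact_mod_cast sub_nonneg.2 t.2.2
    · exact_mod_cast ht0

/-- The clutching matrix of a cylinder frame factors as P u by polar decomposition. Deforming the
frame across the cylinder from 1 to P absorbs P at t = 1 and leaves the unitary u. -/
theorem IsPeriodFrame.exists_isClutching (hF : IsPeriodFrame F a f)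
    (v : Module.Basis (Fin 2) ℤ (Fin 2 → ℤ)) :
    ∃ (τ : VectorFrame q E v) (g : C(UnitAddCircle, U q)), τ.IsClutching g := by
  obtain ⟨G, hG⟩ := hF.exists_frameOn_cylinder v
  have hG0 := hG.comp (f := fun x : UnitAddCircle => (x, 0)) (T := Set.univ) (by fun_prop)
    (Set.mapsTo_univ _ _)
  have hG1 := (hG.comp (f := fun x : UnitAddCircle => (x, 1)) (T := Set.univ) (by fun_prop)
    (Set.mapsTo_univ _ _)).congr_base (p' := fun x => glue v x 0) fun x _ => (glue_one v x).symm
  obtain ⟨h, hh, hd⟩ := hG1.exists_transition hG0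
  obtain ⟨P, u, hPc, hP, hPu, -⟩ := exists_polar q
  let g : C(UnitAddCircle, GL (Fin q) ℂ) :=
    glMap h (continuousOn_univ.1 hh) fun x => (hd x trivial).1
  have hg : ∀ x w, G (x, 0) w = G (x, 1) (P (g x) *ᵥ ((u (g x) : Matrix (Fin q) (Fin q) ℂ) *ᵥ w)) :=
    fun x w => by
      rw [Matrix.mulVec_mulVec, hPu]
      exact (hd x trivial).2 w
  have hPg : Continuous fun x : UnitAddCircle × I => P (g x.1) :=
    hPc.comp (g.continuous.comp continuous_fst)
  have h1 : Continuous fun x : UnitAddCircle × I => ((1 - (x.2 : ℝ) : ℝ) : ℂ) := by fun_prop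
  have h2 : Continuous fun x : UnitAddCircle × I => ((x.2 : ℝ) : ℂ) := by fun_prop
  have hm : Continuous fun x : UnitAddCircle × I => ((1 - (x.2 : ℝ) : ℝ) : ℂ) •
      (1 : Matrix (Fin q) (Fin q) ℂ) + ((x.2 : ℝ) : ℂ) • P (g x.1) :=
    (h1.smul continuous_const).add (h2.smul hPg)
  obtain ⟨τ, hτ⟩ := (hG.mul hm.continuousOn fun x _ =>
    det_segment_ne_zero (hP (g x.1)) x.2).exists_vectorFrame
  refine ⟨τ, u.comp g, fun x w => ?_⟩
  rw [hτ, hτ]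
  simpa using hg x w

end Polar

/-- The twist is well defined and can be computed from the cocycle. -/
theorem IsPeriodFrame.isTwist_iff (hF : IsPeriodFrame F a f)
    (o : Orientation ℝ (Fin 2 → ℝ) (Fin 2)) : (∀ n, IsTwist (q := q) o E n ↔ n = twist q o E) ∧
      ∀ v, IsPositive o v → (twist q o E : ℂ) = pairing f 0 (v 0) (v 1) := by
  have hex : ∀ v, IsPositive o v → ∃ n, IsTwist (q := q) o E n ∧
      (n : ℂ) = pairing f 0 (v 0) (v 1) := fun v hv => by
    obtain ⟨τ, g, hg⟩ := hF.exists_isClutching v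
    obtain ⟨n, hn⟩ := exists_hasDegree (piDet q (loopClass g))
    exact ⟨n, ⟨v, hv, τ, g, hg, hn⟩, hF.degree_eq hg hn⟩
  obtain ⟨ε, hε⟩ := exists_sign o
  -- The right side involves neither the basis nor the trivialization: the basis enters only through
  -- its determinant ε.
  have hval : ∀ n, IsTwist (q := q) o E n →
      (n : ℂ) = ε * pairing f 0 (Pi.single 0 1) (Pi.single 1 1) := by
    rintro n ⟨v, hv, τ, g, hg, hn⟩
    rw [hF.degree_eq hg hn, hF.isLogCocycle.pairing_eq_det, hε v hv]
  have huniq : ∀ m n, IsTwist (q := q) o E m → IsTwist (q := q) o E n → m = n := fun m n hm hn => by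
    exact_mod_cast (hval m hm).trans (hval n hn).symm
  have hspec : IsTwist (q := q) o E (twist q o E) := by
    obtain ⟨v, hv⟩ := exists_isPositive o
    obtain ⟨n, hn, -⟩ := hex v hv
    exact Classical.epsilon_spec (p := fun n => IsTwist (q := q) o E n) ⟨n, hn⟩
  refine ⟨fun n => ⟨fun hn => huniq _ _ hn hspec, fun hn => hn ▸ hspec⟩, fun v hv => ?_⟩
  obtain ⟨n, hn, h⟩ := hex v hv
  rw [← huniq _ _ hn hspec, h]

end Cocycle

/-! ### Families of automorphisms of the matrix algebra -/

section Automorphisms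

variable {q : ℕ}

/-- The endomorphisms of a vector space with a frame form a matrix algebra. -/
theorem exists_frameAlgEquiv {V : Type*} [AddCommGroup V] [Module ℂ V] [TopologicalSpace V]
    [IsTopologicalAddGroup V] [ContinuousSMul ℂ V] [T2Space V] (L : (Fin q → ℂ) ≃ₗ[ℂ] V) :
    ∃ A : Matrix (Fin q) (Fin q) ℂ ≃ₐ[ℂ] (V →L[ℂ] V), ∀ M w, A M (L w) = L (M *ᵥ w) := by
  refine ⟨(Matrix.toLinAlgEquiv'.trans (Module.End.toContinuousLinearMap (Fin q → ℂ))).trans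
    L.toContinuousLinearEquiv.conjContinuousAlgEquiv.toAlgEquiv, fun M w => ?_⟩
  change L (M *ᵥ L.symm (L w)) = _
  rw [L.symm_apply_apply]

/-- The transporter between two automorphisms of the matrix algebra. -/
def transporter (i₀ : Fin q) (ψ χ : Matrix (Fin q) (Fin q) ℂ ≃ₐ[ℂ] Matrix (Fin q) (Fin q) ℂ) :
    Matrix (Fin q) (Fin q) ℂ :=
  ∑ i, ψ (Matrix.single i i₀ 1) * χ (Matrix.single i₀ i 1)

theorem transporter_self (i₀ : Fin q)
    (ψ : Matrix (Fin q) (Fin q) ℂ ≃ₐ[ℂ] Matrix (Fin q) (Fin q) ℂ) : transporter i₀ ψ ψ = 1 := by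
  simp_rw [transporter, ← map_mul, Matrix.single_mul_single_same, mul_one, ← map_sum,
    Matrix.sum_single_one, map_one]

/-- Expanding M times a matrix unit on the left and a matrix unit times M on the right gives the
same double sum. Where it is invertible, the transporter is thus an explicit intertwiner, continuous
in both automorphisms. -/
theorem mul_transporter (i₀ : Fin q)
    (ψ χ : Matrix (Fin q) (Fin q) ℂ ≃ₐ[ℂ] Matrix (Fin q) (Fin q) ℂ) (M : Matrix (Fin q) (Fin q) ℂ) :
    ψ M * transporter i₀ ψ χ = transporter i₀ ψ χ * χ M := by
  have h1 : ∀ i, M * Matrix.single i i₀ 1 = ∑ j, M j i • Matrix.single j i₀ (1 : ℂ) := fun i => by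
    ext a b
    by_cases hb : i₀ = b
    · subst hb
      simp [Matrix.sum_apply, Matrix.single_apply]
    · simp [Matrix.sum_apply, hb, Ne.symm hb]
  have h2 : ∀ j, Matrix.single i₀ j 1 * M = ∑ i, M j i • Matrix.single i₀ i (1 : ℂ) := fun j => by
    ext a b
    by_cases ha : i₀ = a
    · subst ha
      simp [Matrix.sum_apply, Matrix.single_apply]
    · simp [Matrix.sum_apply, ha, Ne.symm ha]
  simp_rw [transporter, Finset.mul_sum, Finset.sum_mul, ← mul_assoc, mul_assoc, ← map_mul,
    ← mul_assoc, ← map_mul, h1, h2, map_sum, map_smul, Finset.sum_mul, Finset.mul_sum,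
    Matrix.smul_mul, Matrix.mul_smul]
  exact Finset.sum_comm

/-- Automorphisms of the matrix algebra are inner. -/
theorem exists_inner (ψ : Matrix (Fin q) (Fin q) ℂ ≃ₐ[ℂ] Matrix (Fin q) (Fin q) ℂ) :
    ∃ A : Matrix (Fin q) (Fin q) ℂ, A.det ≠ 0 ∧ ∀ M, A * ψ M = M * A := by
  let e : Matrix (Fin q) (Fin q) ℂ ≃ₐ[ℂ] Module.End ℂ (Fin q → ℂ) := Matrix.toLinAlgEquiv'
  obtain ⟨T, hT⟩ := ((e.symm.trans ψ).trans e).eq_linearEquivConjAlgEquiv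
  obtain ⟨hd, hm⟩ := matrix_of_linearEquiv T.symm
  refine ⟨_, hd, fun M => matrix_eq_of_mulVec fun w => ?_⟩
  have h : e (ψ M) w = T (e M (T.symm w)) := by
    have := congrArg (fun f : Module.End ℂ (Fin q → ℂ) ≃ₐ[ℂ] Module.End ℂ (Fin q → ℂ) =>
      f (e M) w) hT
    simpa using this
  rw [← Matrix.mulVec_mulVec, ← Matrix.mulVec_mulVec, hm, hm]
  change T.symm (e (ψ M) w) = _
  rw [h, T.symm_apply_apply]
  rfl

/-- A continuous family of automorphisms of the matrix algebra over a square is inner. -/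
theorem exists_continuous_inner (hq : 0 < q)
    {φ : I × I → (Matrix (Fin q) (Fin q) ℂ ≃ₐ[ℂ] Matrix (Fin q) (Fin q) ℂ)}
    (hφ : ∀ M, Continuous fun x => φ x M) :
    ∃ H : I × I → Matrix (Fin q) (Fin q) ℂ, Continuous H ∧ (∀ x, (H x).det = 1) ∧
      ∀ x M, H x * φ x M = M * H x := by
  let i₀ : Fin q := ⟨0, hq⟩
  let h : (I × I) × (I × I) → Matrix (Fin q) (Fin q) ℂ := fun y => transporter i₀ (φ y.1) (φ y.2)
  have hh : Continuous h := continuous_finsetSum _ fun i _ =>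
    ((hφ _).comp continuous_fst).matrix_mul ((hφ _).comp continuous_snd)
  -- On the diagonal the transporter is 1; compactness gives a uniform ε within which it stays
  -- invertible.
  have hnear : {y | (h y).det ≠ 0} ∈ uniformity (I × I) := by
    rw [← nhdsSet_diagonal_eq_uniformity]
    refine (isOpen_ne_fun hh.matrix_det continuous_const).mem_nhdsSet.2 ?_
    rintro ⟨x, y⟩ hxy
    obtain rfl : x = y := hxy
    simp [h, transporter_self]
  obtain ⟨ε, hε, hεh⟩ := Metric.mem_uniformity_dist.1 hnear
  obtain ⟨n, hn⟩ := exists_nat_gt (1 / ε)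
  have hn0 : (0 : ℝ) < n := lt_trans (by positivity) hn
  let r : ℕ → I := fun k => projI (k / n)
  -- The square is contracted to its corner in n steps, each moving points by less than ε. An inner
  -- form at the corner is propagated outward by multiplying successive transporters.
  let c : ℕ → I × I → I × I := fun k x => (r k * x.1, r k * x.2)
  have hc : ∀ k, Continuous (c k) := fun k => by fun_prop
  have hr : ∀ k, |(r (k + 1) : ℝ) - r k| < ε := fun k => by
    have h1 := (LipschitzWith.projIcc (zero_le_one' ℝ)).dist_le_mul ((k + 1 : ℕ) / n) (k / n)
    rw [Subtype.dist_eq, Real.dist_eq, Real.dist_eq, NNReal.coe_one, one_mul] at h1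
    refine lt_of_le_of_lt h1 ?_
    have h2 : ((k + 1 : ℕ) : ℝ) / n - k / n = 1 / n := by push_cast; ring
    rw [h2, abs_of_pos (by positivity)]
    rwa [div_lt_comm₀ hε hn0] at hn
  have hrc : ∀ k x, dist (c k x) (c (k + 1) x) < ε := fun k x => by
    have key : ∀ t : I, dist (r k * t) (r (k + 1) * t) < ε := fun t => by
      rw [dist_comm, Subtype.dist_eq, Real.dist_eq, Set.Icc.coe_mul, Set.Icc.coe_mul, ← sub_mul,
        abs_mul, abs_of_nonneg t.2.1]
      exact lt_of_le_of_lt (mul_le_of_le_one_right (abs_nonneg _) t.2.2) (hr k)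
    rw [Prod.dist_eq]
    exact max_lt (key _) (key _)
  have chain : ∀ k, ∃ H : I × I → Matrix (Fin q) (Fin q) ℂ, Continuous H ∧
      (∀ x, (H x).det ≠ 0) ∧ ∀ x M, H x * φ (c k x) M = M * H x := fun k => by
    induction k with
    | zero =>
      obtain ⟨A, hA, hAφ⟩ := exists_inner (φ (0, 0))
      refine ⟨fun _ => A, continuous_const, fun _ => hA, fun x M => ?_⟩
      have : c 0 x = (0, 0) := by
        have : r 0 = 0 := by simp [r, projI]
        simp [c, this]
      rw [this, hAφ]
    | succ k ih =>
      obtain ⟨H, hH, hd, hHφ⟩ := ih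
      refine ⟨fun x => H x * h (c k x, c (k + 1) x),
        hH.matrix_mul (hh.comp ((hc k).prodMk (hc (k + 1)))), fun x => ?_, fun x M => ?_⟩
      · rw [Matrix.det_mul]
        exact mul_ne_zero (hd x) (hεh (hrc k x))
      · rw [mul_assoc, ← mul_transporter, ← mul_assoc, hHφ, mul_assoc]
  obtain ⟨H, hH, hd, hHφ⟩ := chain n
  have hcn : ∀ x, c n x = x := fun x => by
    have : r n = 1 := by simp [r, projI, div_self hn0.ne']
    simp [c, this]
  obtain ⟨ψ, hψ, hψH⟩ := exists_continuous_log_square hH.matrix_det hd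
  -- Division by a continuous q-th root of the determinant normalizes it to 1; scalars do not affect
  -- the intertwining relation.
  refine ⟨fun x => expTwoPiI (-ψ x / q) • H x,
    (continuous_expTwoPiI.comp (hψ.neg.div_const _)).smul hH, fun x => ?_, fun x M => ?_⟩
  · rw [Matrix.det_smul, Fintype.card_fin, expTwoPiI_div_pow hq, expTwoPiI_neg, hψH,
      inv_mul_cancel₀ (hd x)]
  · have := hHφ x M
    rw [hcn] at this
    rw [Matrix.smul_mul, this, Matrix.mul_smul]

/-- A matrix commuting with all matrices is scalar. -/
theorem eq_smul_one_of_forall_commute (i₀ : Fin q) {B : Matrix (Fin q) (Fin q) ℂ}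
    (h : ∀ M, M * B = B * M) : B = B i₀ i₀ • 1 := by
  obtain ⟨c, hc⟩ := Matrix.mem_range_scalar_of_commute_single (M := B) fun i j _ => h _
  have hB : B = c • 1 := hc.symm.trans (Matrix.smul_one_eq_diagonal c).symm
  simp [hB]

end Automorphisms

/-! ### The endomorphism bundle -/

/-- The fibres of the endomorphism bundle. -/
abbrev EndFib (E : T2 → Type*) [∀ x, AddCommGroup (E x)] [∀ x, Module ℂ (E x)]
    [∀ x, TopologicalSpace (E x)] (x : T2) : Type _ := E x →L[ℂ] E x

theorem t2Space_fibre (q : ℕ) {B : Type*} [TopologicalSpace B] (E : B → Type*)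
    [∀ x, AddCommGroup (E x)] [∀ x, Module ℂ (E x)] [∀ x, TopologicalSpace (E x)]
    [TopologicalSpace (Bundle.TotalSpace (Fin q → ℂ) E)] [FiberBundle (Fin q → ℂ) E]
    [VectorBundle ℂ (Fin q → ℂ) E] (x : B) : T2Space (E x) :=
  ((trivializationAt (Fin q → ℂ) E x).continuousLinearEquivAt ℂ x
    (FiberBundle.mem_baseSet_trivializationAt' x)).toHomeomorph.symm.t2Space

section Endomorphisms

variable {q : ℕ} {E : T2 → Type*} [∀ x, AddCommGroup (E x)] [∀ x, Module ℂ (E x)]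
  [∀ x, TopologicalSpace (E x)]

/-- Comparison of two frames of a fibre and of the matrix algebra structures they define on its
endomorphisms. -/
theorem mul_eq_mul_of_frames {b b' : T2} (hb : b = b') {A : E b →L[ℂ] E b} {A' : E b' →L[ℂ] E b'}
    (hA : Bundle.TotalSpace.mk' ((Fin q → ℂ) →L[ℂ] (Fin q → ℂ)) (E := EndFib E) b A =
      Bundle.TotalSpace.mk' ((Fin q → ℂ) →L[ℂ] (Fin q → ℂ)) b' A')
    {L : (Fin q → ℂ) ≃ₗ[ℂ] E b} {L' : (Fin q → ℂ) ≃ₗ[ℂ] E b'} {B M M' : Matrix (Fin q) (Fin q) ℂ}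
    (hL : ∀ w, Bundle.TotalSpace.mk' (Fin q → ℂ) b' (L' w) =
      Bundle.TotalSpace.mk' (Fin q → ℂ) b (L (B *ᵥ w)))
    (hM : ∀ w, A (L w) = L (M *ᵥ w)) (hM' : ∀ w, A' (L' w) = L' (M' *ᵥ w)) : M * B = B * M' := by
  subst hb
  obtain rfl := Bundle.TotalSpace.mk_injective _ hA
  have hL' : ∀ w, L' w = L (B *ᵥ w) := fun w => Bundle.TotalSpace.mk_injective _ (hL w)
  refine matrix_eq_of_mulVec fun w => L.injective ?_
  rw [← Matrix.mulVec_mulVec, ← hM, ← hL', hM', hL', Matrix.mulVec_mulVec]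

theorem mk_eq_mk_of_frames {b b' : T2} (hb : b = b') {A : E b →L[ℂ] E b} {A' : E b' →L[ℂ] E b'}
    {L : (Fin q → ℂ) ≃ₗ[ℂ] E b} {L' : (Fin q → ℂ) ≃ₗ[ℂ] E b'} {B M M' : Matrix (Fin q) (Fin q) ℂ}
    (hL : ∀ w, Bundle.TotalSpace.mk' (Fin q → ℂ) b (L w) =
      Bundle.TotalSpace.mk' (Fin q → ℂ) b' (L' (B *ᵥ w)))
    (hM : ∀ w, A (L w) = L (M *ᵥ w)) (hM' : ∀ w, A' (L' w) = L' (M' *ᵥ w)) (h : B * M = M' * B) :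
    Bundle.TotalSpace.mk' ((Fin q → ℂ) →L[ℂ] (Fin q → ℂ)) (E := EndFib E) b A =
      Bundle.TotalSpace.mk' ((Fin q → ℂ) →L[ℂ] (Fin q → ℂ)) b' A' := by
  subst hb
  have hL' : ∀ w, L w = L' (B *ᵥ w) := fun w => Bundle.TotalSpace.mk_injective _ (hL w)
  refine congrArg _ (ContinuousLinearMap.ext fun x => ?_)
  obtain ⟨w, rfl⟩ := L.surjective x
  rw [hM, hL', hL', hM', Matrix.mulVec_mulVec, Matrix.mulVec_mulVec, h]

variable [TopologicalSpace (Bundle.TotalSpace (Fin q → ℂ) E)] [FiberBundle (Fin q → ℂ) E]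
  [VectorBundle ℂ (Fin q → ℂ) E]

variable [∀ x, IsTopologicalAddGroup (E x)] [∀ x, ContinuousSMul ℂ (E x)]

/-- Continuity of a family of endomorphisms given by a continuous family of matrices with respect
to a continuous frame. -/
theorem FrameOn.continuous_endomorphism {X : Type*} [TopologicalSpace X] {p : X → T2}
    {F : X → (Fin q → ℂ) → Bundle.TotalSpace (Fin q → ℂ) E} (hF : FrameOn p F Set.univ)
    {L : ∀ x, (Fin q → ℂ) ≃ₗ[ℂ] E (p x)}
    (hL : ∀ x w, F x w = Bundle.TotalSpace.mk' (Fin q → ℂ) (p x) (L x w))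
    {A : ∀ x, E (p x) →L[ℂ] E (p x)} {M : X → Matrix (Fin q) (Fin q) ℂ} (hM : Continuous M)
    (hA : ∀ x w, A x (L x w) = L x (M x *ᵥ w)) :
    Continuous fun x => Bundle.TotalSpace.mk' ((Fin q → ℂ) →L[ℂ] (Fin q → ℂ)) (E := EndFib E)
      (p x) (A x) := by
  have hp : Continuous p := by
    have : Continuous fun x => (F x 0).proj :=
      (FiberBundle.continuous_proj (Fin q → ℂ) E).comp
        (hF.continuous.comp (f := fun x => (x, 0)) (by fun_prop))
    exact this.congr fun x => hF.proj_eq (Set.mem_univ x) 0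
  refine continuous_iff_continuousAt.2 fun x₀ => (continuousAt_hom_bundle (RingHom.id ℂ) _).2
    ⟨hp.continuousAt, ?_⟩
  let e := trivializationAt (Fin q → ℂ) E (p x₀)
  have hb₀ : p x₀ ∈ e.baseSet := FiberBundle.mem_baseSet_trivializationAt' _
  let C : X → Matrix (Fin q) (Fin q) ℂ := fun x =>
    Matrix.of fun i j => (e (F x (Pi.single j 1))).2 i
  have hC : ContinuousAt C x₀ := by
    refine continuousAt_pi.2 fun i => continuousAt_pi.2 fun j => ?_
    have hcol : Continuous fun x => F x (Pi.single j 1) :=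
      hF.continuous.comp (f := fun x => (x, Pi.single j 1)) (by fun_prop)
    have he : ContinuousAt e (F x₀ (Pi.single j 1)) := e.continuousAt (by
      rw [e.mem_source, hF.proj_eq (Set.mem_univ x₀)]
      exact hb₀)
    exact (continuous_apply i).continuousAt.comp
      (continuous_snd.continuousAt.comp (ContinuousAt.comp (f := fun x => F x (Pi.single j 1))
        he hcol.continuousAt))
  have hCd : ∀ x, p x ∈ e.baseSet → (C x).det ≠ 0 ∧ ∀ w, C x *ᵥ w = (e (F x w)).2 :=
    fun x hx => hF.trivialization_matrix e (Set.mem_univ x) hx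
  let T : Matrix (Fin q) (Fin q) ℂ →ₗ[ℂ] ((Fin q → ℂ) →L[ℂ] (Fin q → ℂ)) :=
    (Matrix.toLin'.trans LinearMap.toContinuousLinearMap).toLinearMap
  have hT : Continuous T := T.continuous_of_finiteDimensional
  -- If C is the frame read in the local trivialization, the endomorphism reads as C M C⁻¹.
  have hTC : ContinuousAt (fun x => T (C x * M x * (C x)⁻¹)) x₀ := by
    have h1 : ContinuousAt (fun x => (C x)⁻¹) x₀ :=
      (continuousAt_matrix_inv (hCd x₀ hb₀).1).comp hC
    exact hT.continuousAt.comp ((hC.mul hM.continuousAt).mul h1)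
  refine hTC.congr_of_eventuallyEq ?_
  filter_upwards [hp.continuousAt.eventually (e.open_baseSet.mem_nhds hb₀)] with x hx
  refine ContinuousLinearMap.ext fun w => ?_
  obtain ⟨hd, hCF⟩ := hCd x hx
  have hCF' : ∀ w, C x *ᵥ w = e.continuousLinearMapAt ℂ (p x) (L x w) := fun w => by
    rw [hCF, hL, e.continuousLinearMapAt_apply_of_mem _ hx]
  have hinv : e.symmL ℂ (p x) w = L x ((C x)⁻¹ *ᵥ w) := by
    have h1 : w = e.continuousLinearMapAt ℂ (p x) (L x ((C x)⁻¹ *ᵥ w)) := by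
      rw [← hCF', Matrix.mulVec_mulVec, Matrix.mul_nonsing_inv _ hd.isUnit, Matrix.one_mulVec]
    conv_lhs => rw [h1]
    exact e.symmL_continuousLinearMapAt hx _
  change e.continuousLinearMapAt ℂ (p x) (A x (e.symmL ℂ (p x) w)) =
    (C x * M x * (C x)⁻¹) *ᵥ w
  rw [hinv, hA, ← hCF', Matrix.mulVec_mulVec, Matrix.mulVec_mulVec, mul_assoc]

/-- A trivialization of a vector bundle trivializes its endomorphism bundle. -/
theorem VectorFrame.exists_matrixFrame {v : Module.Basis (Fin 2) ℤ (Fin 2 → ℤ)}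
    (τ : VectorFrame q E v) :
    ∃ α : MatrixFrame q ((Fin q → ℂ) →L[ℂ] (Fin q → ℂ)) (EndFib E) v,
      ∀ s t M w, α.toEquiv s t M (τ.toEquiv s t w) = τ.toEquiv s t (M *ᵥ w) := by
  have hT2 := t2Space_fibre q E
  choose A hA using fun s t => exists_frameAlgEquiv (τ.toEquiv s t)
  refine ⟨⟨A, ?_⟩, hA⟩
  have hF := τ.frameOn.comp
    (f := fun y : UnitAddCircle × I × Matrix (Fin q) (Fin q) ℂ => (y.1, y.2.1)) (T := Set.univ)
    (by fun_prop) (Set.mapsTo_univ _ _)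
  exact hF.continuous_endomorphism (fun _ _ => rfl) (continuous_snd.comp continuous_snd)
    fun y w => hA y.1 y.2.1 y.2.2 w

/-- Any representative u of the class of g(s) differs from g(s) by a scalar, which cancels in the
conjugation. -/
theorem VectorFrame.IsClutching.matrixFrame {v : Module.Basis (Fin 2) ℤ (Fin 2 → ℤ)}
    {τ : VectorFrame q E v} {g : C(UnitAddCircle, U q)} (hg : τ.IsClutching g)
    {α : MatrixFrame q ((Fin q → ℂ) →L[ℂ] (Fin q → ℂ)) (EndFib E) v}
    (hα : ∀ s t M w, α.toEquiv s t M (τ.toEquiv s t w) = τ.toEquiv s t (M *ᵥ w)) :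
    α.IsClutching ((proj q).comp g) := fun s u hu M => by
  obtain ⟨z, hz⟩ := proj_eq_iff.1 hu
  refine mk_eq_mk_of_frames (glue_one v s).symm (hg s) (hα s 0 M) (hα s 1 _) ?_
  have hu : (u : Matrix (Fin q) (Fin q) ℂ)ᴴ * u = 1 := Matrix.UnitaryGroup.star_mul_self u
  rw [hz, Matrix.mul_smul, mul_assoc, hu, mul_one, Matrix.smul_mul]

/-- The homotopy class of the projection of a free loop. -/
theorem loopClass_proj (g : C(UnitAddCircle, U q)) :
    loopClass ((proj q).comp g) = piProj q (loopClass g) := by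
  unfold loopClass
  refine Eq.trans ?_ (piProj_pathClass _).symm
  exact congrArg pathClass (Path.ext rfl)

end Endomorphisms

/-! ### The invariant of the endomorphism bundle computed from the cocycle -/

section Omega

variable {q : ℕ} {E : T2 → Type*} [∀ x, AddCommGroup (E x)] [∀ x, Module ℂ (E x)]
  [∀ x, TopologicalSpace (E x)] [TopologicalSpace (Bundle.TotalSpace (Fin q → ℂ) E)]
  [FiberBundle (Fin q → ℂ) E] [VectorBundle ℂ (Fin q → ℂ) E]
  [∀ x, IsTopologicalAddGroup (E x)] [∀ x, ContinuousSMul ℂ (E x)]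
  {F : (Fin 2 → ℝ) → (Fin q → ℂ) → Bundle.TotalSpace (Fin q → ℂ) E}
  {a : (Fin 2 → ℤ) → (Fin 2 → ℝ) → Matrix (Fin q) (Fin q) ℂ} {f : (Fin 2 → ℤ) → (Fin 2 → ℝ) → ℂ}
  {v : Module.Basis (Fin 2) ℤ (Fin 2 → ℤ)}

/-- Modifying a frame by unimodular matrices, one can make it induce a given trivialization of the
endomorphism bundle. -/
theorem IsPeriodFrame.exists_adapted (hq : 0 < q) (hF : IsPeriodFrame F a f)
    (α : MatrixFrame q ((Fin q → ℂ) →L[ℂ] (Fin q → ℂ)) (EndFib E) v) :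
    ∃ (N : I × I → Matrix (Fin q) (Fin q) ℂ)
      (Λ : ∀ x : I × I, (Fin q → ℂ) ≃ₗ[ℂ] E (glue v (toCircle x.1) x.2)),
      Continuous N ∧ (∀ x, (N x).det = 1) ∧
      (∀ x w, Bundle.TotalSpace.mk' (Fin q → ℂ) (glue v (toCircle x.1) x.2) (Λ x w) =
        F (pt v x.1 x.2) (N x *ᵥ w)) ∧
      ∀ x M w, α.toEquiv (toCircle x.1) x.2 M (Λ x w) = Λ x (M *ᵥ w) := by
  have hT2 := t2Space_fibre q E
  have hFs := hF.frameOn_square v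
  choose L hL using fun x => hFs.exists_equiv x (Set.mem_univ x)
  choose A hA using fun x => exists_frameAlgEquiv (L x)
  -- Comparing α with the matrix structure induced by F gives a family of automorphisms of the
  -- matrix algebra. If H makes it inner, the frame F·H⁻¹ induces α.
  let φ : I × I → (Matrix (Fin q) (Fin q) ℂ ≃ₐ[ℂ] Matrix (Fin q) (Fin q) ℂ) := fun x =>
    (α.toEquiv (toCircle x.1) x.2).trans (A x).symm
  have hφα : ∀ x M w, α.toEquiv (toCircle x.1) x.2 M (L x w) = L x (φ x M *ᵥ w) := fun x M w => by
    rw [← hA x (φ x M), AlgEquiv.trans_apply, AlgEquiv.apply_symm_apply]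
  have hφ : ∀ M, Continuous fun x => φ x M := fun M => by
    refine continuous_pi fun i => continuous_pi fun j => ?_
    have hα : Continuous fun x : I × I => Bundle.TotalSpace.mk' ((Fin q → ℂ) →L[ℂ] (Fin q → ℂ))
        (E := EndFib E) (glue v (toCircle x.1) x.2) (α.toEquiv (toCircle x.1) x.2 M) :=
      α.continuous_toEquiv.comp (f := fun x : I × I => (toCircle x.1, x.2, M)) (by fun_prop)
    have hcol : Continuous fun x : I × I => Bundle.TotalSpace.mk' (Fin q → ℂ)
        (glue v (toCircle x.1) x.2) (L x (Pi.single j 1)) :=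
      (hFs.continuous.comp (f := fun x : I × I => (x, Pi.single j 1)) (by fun_prop)).congr
        fun x => hL x _
    -- The j-th column of φ(M) consists of the coordinates of α(M) applied to the j-th frame vector,
    -- a continuous section.
    obtain ⟨c, hc, hcF⟩ := hFs.exists_coords (hα.clm_bundle_apply hcol).continuousOn
      fun x _ => rfl
    have hcφ : ∀ x, c x = φ x M *ᵥ Pi.single j 1 := fun x => by
      refine hFs.injective (Set.mem_univ x) ?_
      rw [hcF x trivial, hφα, hL]
    have : Continuous fun x => c x i := (continuous_apply i).comp (continuousOn_univ.1 hc)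
    refine this.congr fun x => ?_
    rw [hcφ, Matrix.mulVec_single_one]
    rfl
  obtain ⟨H, hH, hd, hHφ⟩ := exists_continuous_inner hq hφ
  have hunit : ∀ x, IsUnit (H x).det := fun x => by rw [hd]; exact isUnit_one
  have hdN : ∀ x, (H x)⁻¹.det = 1 := fun x => by
    rw [Matrix.det_nonsing_inv, hd, Ring.inverse_one]
  choose T hT using fun x => matrix_det_ne_zero_mulVec (A := (H x)⁻¹) (by rw [hdN]; exact one_ne_zero)
  refine ⟨fun x => (H x)⁻¹, fun x => (T x).trans (L x),
    continuous_matrix_inv hH fun x => (hunit x).ne_zero, hdN, fun x w => ?_, fun x M w => ?_⟩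
  · rw [LinearEquiv.trans_apply, hT, hL x]
  · rw [LinearEquiv.trans_apply, LinearEquiv.trans_apply, hφα, hT, hT, Matrix.mulVec_mulVec,
      Matrix.mulVec_mulVec]
    congr 2
    rw [← Matrix.nonsing_inv_mul_cancel_left (H x) (φ x M * (H x)⁻¹) (hunit x), ← mul_assoc (H x),
      hHφ, mul_assoc M, Matrix.mul_nonsing_inv _ (hunit x), mul_one]

/-- A matrix which becomes scalar after a unimodular change of bases on both sides. -/
theorem exists_eq_smul_of_forall_commute (hq : 0 < q) {X : Type*} [TopologicalSpace X]
    {A N N' : X → Matrix (Fin q) (Fin q) ℂ} (hA : Continuous A) (hN : Continuous N)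
    (hN' : Continuous N') (hd : ∀ x, (N x).det = 1)
    (h : ∀ x M, M * ((N x)⁻¹ * A x * N' x) = (N x)⁻¹ * A x * N' x * M) :
    ∃ z : X → ℂ, Continuous z ∧ (∀ x, A x * N' x = z x • N x) ∧ ∀ x, z x ^ q = (A x).det * (N' x).det := by
  have hunit : ∀ x, IsUnit (N x).det := fun x => by rw [hd]; exact isUnit_one
  let i₀ : Fin q := ⟨0, hq⟩
  have hz := fun x => eq_smul_one_of_forall_commute i₀ (h x)
  have key : ∀ x, A x * N' x = ((N x)⁻¹ * A x * N' x) i₀ i₀ • N x := fun x => by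
    have := congrArg (N x * ·) (hz x)
    simp only [Matrix.mul_smul, mul_one] at this
    rw [← this, mul_assoc, Matrix.mul_nonsing_inv_cancel_left _ _ (hunit x)]
  refine ⟨fun x => ((N x)⁻¹ * A x * N' x) i₀ i₀, ?_, key, fun x => ?_⟩
  · exact (((continuous_matrix_inv hN fun x => (hunit x).ne_zero).matrix_mul hA).matrix_mul
      hN').matrix_elem _ _
  · have := congrArg Matrix.det (key x)
    rw [Matrix.det_mul, Matrix.det_smul, hd, mul_one, Fintype.card_fin] at this
    exact this.symm

/-- For the adapted frame F·N, the identification of opposite edges commutes with all matrices, so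
it is given by scalars z and y. Since det N = 1, their q-th powers are det a_{v₀} and det a_{v₁}
times a constant, so their logarithms vary by 1/q of those of the cocycle. The two ways around the
corner differ by ζ. -/
theorem IsPeriodFrame.boundary_eq (hq : 0 < q) (hF : IsPeriodFrame F a f)
    {α : MatrixFrame q ((Fin q → ℂ) →L[ℂ] (Fin q → ℂ)) (EndFib E) v} {g : C(UnitAddCircle, PU q)}
    (hg : α.IsClutching g) {ζ : rootsOfUnity q ℂ} (hζ : HasBoundary (loopClass g) ζ) :
    ((ζ : ℂˣ) : ℂ) = expTwoPiI (-pairing f 0 (v 0) (v 1) / q) := by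
  obtain ⟨N, Λ, hN, hd, hΛ, hα⟩ := hF.exists_adapted hq α
  have hunit : ∀ x, IsUnit (N x).det := fun x => by rw [hd]; exact isUnit_one
  have hchange : ∀ (x y : I × I) (l : Fin 2 → ℤ), pt v y.1 y.2 = pt v x.1 x.2 + lat l → ∀ w,
      Bundle.TotalSpace.mk' (Fin q → ℂ) (glue v (toCircle y.1) y.2) (Λ y w) =
        Bundle.TotalSpace.mk' (Fin q → ℂ) (glue v (toCircle x.1) x.2)
          (Λ x (((N x)⁻¹ * a l (pt v x.1 x.2) * N y) *ᵥ w)) := fun x y l h w => by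
    rw [hΛ, hΛ, h, hF.translate, Matrix.mulVec_mulVec, Matrix.mulVec_mulVec, ← mul_assoc,
      Matrix.mul_nonsing_inv_cancel_left _ _ (hunit x)]
  -- the edges `s = 0` and `s = 1`
  have hpt₁ : Continuous fun t : I => pt v 0 t :=
    (continuous_pt v).comp (f := fun t : I => ((0 : ℝ), (t : ℝ))) (by fun_prop)
  have h01 : toCircle 0 = toCircle 1 := toCircle_zero.trans toCircle_one.symm
  obtain ⟨z, hz, hzN, hzq⟩ := exists_eq_smul_of_forall_commute hq
    (A := fun t : I => a (v 0) (pt v 0 t)) (N := fun t => N (0, t)) (N' := fun t => N (1, t))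
    ((hF.continuous _).comp hpt₁) (hN.comp (by fun_prop)) (hN.comp (by fun_prop))
    (fun t => hd _) fun t M => by
      have h1 := hchange (0, t) (1, t) (v 0) (pt_one_left v t)
      refine mul_eq_mul_of_frames (congrArg (fun c => glue v c t) h01) ?_ h1 (hα (0, t) M)
        (hα (1, t) M)
      exact congrArg (fun c => Bundle.TotalSpace.mk' ((Fin q → ℂ) →L[ℂ] (Fin q → ℂ))
        (E := EndFib E) (glue v c t) (α.toEquiv c t M)) h01
  -- the edges `t = 0` and `t = 1`
  obtain ⟨Γ, hΓ, hΓ0, hΓ1⟩ := (hasBoundary_pathClass_iff hq).1 hζ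
  obtain ⟨u₀, hu₀⟩ := proj_surjective q (g 0)
  have hu : ∀ s : I, proj q (u₀ * SU.toU q (Γ s)) = g (toCircle s) := fun s => by
    rw [proj_mul, ← suProj_apply, hΓ, hu₀]
    exact mul_inv_cancel_left (g 0) (g (toCircle s))
  -- A lift of g to U(q) along the interval: a fixed representative of g(0) times the path in SU(q).
  -- Its determinant is constant, and it fails to close up exactly by ζ.
  let u : I → Matrix (Fin q) (Fin q) ℂ := fun s =>
    (u₀ : Matrix (Fin q) (Fin q) ℂ) * (Γ s : Matrix (Fin q) (Fin q) ℂ)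
  have hpt₂ : Continuous fun s : I => pt v s 0 :=
    (continuous_pt v).comp (f := fun s : I => ((s : ℝ), (0 : ℝ))) (by fun_prop)
  have huc : Continuous u :=
    continuous_const.matrix_mul (continuous_subtype_val.comp Γ.continuous)
  have hud : ∀ s, (u s).det = (u₀ : Matrix (Fin q) (Fin q) ℂ).det := fun s => by
    rw [Matrix.det_mul, SU.det_eq, mul_one]
  obtain ⟨y, hy, hyN, hyq⟩ := exists_eq_smul_of_forall_commute hq
    (A := fun s : I => a (v 1) (pt v s 0)) (N := fun s => N (s, 0))
    (N' := fun s => N (s, 1) * u s)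
    ((hF.continuous _).comp hpt₂) (hN.comp (by fun_prop))
    ((hN.comp (Continuous.prodMk_left 1)).matrix_mul huc)
    (fun s => hd _) fun s M => by
      have h1 := hchange (s, 0) (s, 1) (v 1) (pt_one_right v s)
      have h2 := mul_eq_mul_of_frames (glue_one v (toCircle s)).symm
        (hg (toCircle s) (u₀ * SU.toU q (Γ s)) (hu s) M) h1 (hα (s, 0) M) (hα (s, 1) _)
      have h3 : (u s)ᴴ * u s = 1 := Matrix.UnitaryGroup.star_mul_self (u₀ * SU.toU q (Γ s))
      change _ = _ * (u s * M * (u s)ᴴ) at h2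
      have h4 := congrArg (· * u s) h2
      simp only [mul_assoc, h3, mul_one] at h4 ⊢
      exact h4
  have hu₀ : (u₀ : Matrix (Fin q) (Fin q) ℂ).det ≠ 0 :=
    (Matrix.isUnit_iff_isUnit_det _).1 ⟨Unitary.toUnits u₀, rfl⟩ |>.ne_zero
  have hz0 : ∀ t, z t ≠ 0 := fun t h => by
    have := hzq t
    rw [h, zero_pow hq.ne', hd, mul_one] at this
    exact hF.det_ne_zero _ _ this.symm
  have hy0 : ∀ s, y s ≠ 0 := fun s h => by
    have := hyq s
    rw [h, zero_pow hq.ne', Matrix.det_mul, hd, one_mul, hud] at this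
    exact mul_ne_zero (hF.det_ne_zero _ _) hu₀ this.symm
  obtain ⟨Z, hZ, hZz⟩ := exists_continuous_log_I hz hz0
  obtain ⟨Y, hY, hYy⟩ := exists_continuous_log_I hy hy0
  have keyZ := sub_eq_sub_of_expTwoPiI (φ := fun t => q * Z t) (ψ := fun t : I => f (v 0) (pt v 0 t))
    (c := 1) (by fun_prop) ((hF.isLogCocycle.continuous _).comp hpt₁)
    (fun t => by rw [expTwoPiI_nat_mul, hZz, hzq, hd, hF.log, mul_one, one_mul]) 1 0
  have keyY := sub_eq_sub_of_expTwoPiI (φ := fun s => q * Y s) (ψ := fun s : I => f (v 1) (pt v s 0))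
    (c := (u₀ : Matrix (Fin q) (Fin q) ℂ).det) (by fun_prop)
    ((hF.isLogCocycle.continuous _).comp hpt₂)
    (fun s => by rw [expTwoPiI_nat_mul, hYy, hyq, Matrix.det_mul, hd, one_mul, hud, hF.log,
      mul_comm]) 1 0
  simp only [Set.Icc.coe_one, Set.Icc.coe_zero, pt_one_left, pt_one_right, pt_zero_zero,
    zero_add] at keyZ keyY
  -- the cocycle relation at the corner
  have hz₀ := hzN 0
  have hz₁ := hzN 1
  have hy₀ := hyN 0
  have hy₁ := hyN 1
  simp only [Set.Icc.coe_one, Set.Icc.coe_zero, pt_one_left, pt_one_right, pt_zero_zero,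
    zero_add] at hz₀ hz₁ hy₀ hy₁
  have hu1 : u 1 = ((ζ : ℂˣ) : ℂ) • u 0 := by
    simp only [u, hΓ0, hΓ1, Matrix.mul_smul, mul_one]
    rw [show ((1 : SU q) : Matrix (Fin q) (Fin q) ℂ) = 1 from rfl, mul_one]
  have hcomm := hF.mul_comm_translate (v 0) (v 1) 0
  rw [zero_add, zero_add] at hcomm
  have hcorner : (((ζ : ℂˣ) : ℂ) * z 1 * y 0) • N (0, 0) = (y 1 * z 0) • N (0, 0) := by
    calc _ = ((ζ : ℂˣ) : ℂ) • z 1 • a (v 1) 0 * (N (0, 1) * u 0) := by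
          rw [Matrix.smul_mul, Matrix.smul_mul, hy₀, smul_smul, smul_smul]
      _ = a (v 1) 0 * (a (v 0) (lat (v 1)) * N (1, 1)) * u 1 := by
          rw [hz₁, hu1]
          simp only [Matrix.smul_mul, Matrix.mul_smul, mul_assoc]
      _ = a (v 0) 0 * (a (v 1) (lat (v 0)) * (N (1, 1) * u 1)) := by
          simp only [← mul_assoc, hcomm]
      _ = _ := by rw [hy₁, Matrix.mul_smul, hz₀, smul_smul]
  have hN0 : N (0, 0) ≠ 0 := fun h => by
    have : Nonempty (Fin q) := ⟨⟨0, hq⟩⟩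
    have h1 := hd (0, 0)
    rw [h, Matrix.det_zero] at h1
    exact zero_ne_one h1
  have hscalar := smul_left_injective ℂ hN0 hcorner
  have hq0 : (q : ℂ) ≠ 0 := by exact_mod_cast hq.ne'
  -- q times the increment of Z minus that of Y is the pairing; the minus sign comes from ζ z(1)
  -- y(0) = y(1) z(0).
  have hexp : -pairing f 0 (v 0) (v 1) / q = Y 1 + Z 0 - (Z 1 + Y 0) := by
    rw [div_eq_iff hq0]
    unfold pairing
    rw [zero_add, zero_add]
    linear_combination keyZ - keyY
  rw [hexp, expTwoPiI_sub, expTwoPiI_add, expTwoPiI_add, hYy, hZz, hZz, hYy,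
    eq_div_iff (mul_ne_zero (hz0 1) (hy0 0)), ← mul_assoc]
  exact hscalar

/-- The invariant of the endomorphism bundle is well defined and determined by the twist. -/
theorem IsPeriodFrame.isOmega_iff (hq : 0 < q) (hF : IsPeriodFrame F a f)
    (o : Orientation ℝ (Fin 2 → ℝ) (Fin 2)) (ζ : rootsOfUnity q ℂ) :
    IsOmega o ((Fin q → ℂ) →L[ℂ] (Fin q → ℂ)) (EndFib E) ζ ↔ ζ = zetaRoot hq (twist q o E) := by
  obtain ⟨htw, hval⟩ := hF.isTwist_iff o
  constructor
  · rintro ⟨v, hv, α, g, hg, hζ⟩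
    refine Subtype.ext (Units.ext ?_)
    rw [hF.boundary_eq hq hg hζ, zetaRoot_val, hval v hv]
  · rintro rfl
    -- The value is attained by the trivialization of the endomorphisms induced from one realizing
    -- the twist.
    obtain ⟨v, hv, τ, g, hg, hn⟩ := (htw _).2 rfl
    obtain ⟨α, hα⟩ := τ.exists_matrixFrame
    refine ⟨v, hv, α, _, hg.matrixFrame hα, ?_⟩
    rw [loopClass_proj]
    exact hn.hasBoundary hq

end Omega

end TorusTwist

end

/-- The matrix bundle `E ⊗ E*` is the endomorphism bundle of `E`, with Mathlib's topology. -/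
theorem mainTheorem5 (q : ℕ) (hq : 0 < q) (o : Orientation ℝ (Fin 2 → ℝ) (Fin 2))
    (E : TorusTwist.T2 → Type*) [∀ x, AddCommGroup (E x)] [∀ x, Module ℂ (E x)]
    [∀ x, TopologicalSpace (E x)] [∀ x, IsTopologicalAddGroup (E x)]
    [∀ x, ContinuousSMul ℂ (E x)] [TopologicalSpace (Bundle.TotalSpace (Fin q → ℂ) E)]
    [FiberBundle (Fin q → ℂ) E] [VectorBundle ℂ (Fin q → ℂ) E] :
    ∃ (δ : FundamentalGroup (TorusTwist.U q) 1 ≃* Multiplicative ℤ)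
      (β : FundamentalGroup (TorusTwist.PU q) 1 ≃* rootsOfUnity q ℂ),
      -- `δ` is `π₁(det)` followed by the degree, `β` is the connecting map
      (∀ c n, δ c = Multiplicative.ofAdd n ↔ TorusTwist.HasDegree (TorusTwist.piDet q c) n) ∧
      (∀ c ζ, β c = ζ ↔ TorusTwist.HasBoundary c ζ) ∧
      -- `tw(E)` and `ω(E ⊗ E*)` are well defined
      (∀ n, TorusTwist.IsTwist (q := q) o E n ↔ n = TorusTwist.twist q o E) ∧
      (∀ ζ, TorusTwist.IsOmega (q := q) o ((Fin q → ℂ) →L[ℂ] (Fin q → ℂ))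
          (fun x => E x →L[ℂ] E x) ζ ↔
        ζ = TorusTwist.omega q o ((Fin q → ℂ) →L[ℂ] (Fin q → ℂ)) (fun x => E x →L[ℂ] E x)) ∧
      -- `ω(E ⊗ E*)` is the image of `tw(E)`
      TorusTwist.omega q o ((Fin q → ℂ) →L[ℂ] (Fin q → ℂ)) (fun x => E x →L[ℂ] E x) =
        β (TorusTwist.piProj q (δ.symm (Multiplicative.ofAdd (TorusTwist.twist q o E)))) := by
  obtain ⟨δ, hδ⟩ := TorusTwist.exists_degreeEquiv hq
  obtain ⟨β, hβ⟩ := TorusTwist.exists_boundaryEquiv hq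
  obtain ⟨F, a, f, hF⟩ := TorusTwist.exists_isPeriodFrame q E
  have hω := hF.isOmega_iff hq o
  -- The predicate is satisfied by e^{-2πi tw/q}, so the choice in `omega` satisfies it too and must
  -- be this value.
  have hspec : TorusTwist.omega q o ((Fin q → ℂ) →L[ℂ] (Fin q → ℂ)) (TorusTwist.EndFib E) =
      TorusTwist.zetaRoot hq (TorusTwist.twist q o E) :=
    (hω _).1 (Classical.epsilon_spec (p := fun ζ => TorusTwist.IsOmega (q := q) o
      ((Fin q → ℂ) →L[ℂ] (Fin q → ℂ)) (TorusTwist.EndFib E) ζ) ⟨_, (hω _).2 rfl⟩)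
  refine ⟨δ, β, hδ, hβ, (hF.isTwist_iff o).1, fun ζ => ?_, ?_⟩
  · exact (hω ζ).trans (by rw [hspec])
  · refine hspec.trans ((hβ _ _).2 ?_).symm
    exact ((hδ _ _).1 (δ.apply_symm_apply _)).hasBoundary hq
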